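/- Let $Q$ be a smooth, Hausdorff, second countable $n$-dimensional manifold, let $k\ge 1$ and let $L\in C^\infty(T^kQ\times\mathbb R)$, where $T^rQ=J^r_0(\mathbb R,Q)$ has natural coordinates $(q_0,\dots,q_r)$ and $z$ is the coordinate of $\mathbb R$. Let $J_\beta$ and $\Delta_\beta$ be the vertical endomorphisms and canonical vector fields of $T^rQ$ (extended to $T^rQ\times\mathbb R$), and let $\tau:T^{r+1}Q\times\mathbb R\to T^rQ\times\mathbb R$ be the projection. For functions and forms on $T^rQ\times\mathbb R$ ($r\ge k$) put $D_L\xi=\mathcal L_\Gamma(\tau^*\xi)-\frac{\partial L}{\partial z}\tau^*\xi$, where $\Gamma$ is any semispray of type 1 on $T^{r+1}Q\times\mathbb R$ with $i(\Gamma)dz=L$. On $T^{2k-1}Q\times\mathbb R$ let $$E_L=\sum_{\beta=1}^k\frac{(-1)^{\beta-1}}{\beta!}D_L^{\beta-1}(\Delta_\beta L)-L,\qquad \theta_L=\sum_{\beta=1}^k\frac{(-1)^{\beta-1}}{\beta!}D_L^{\beta-1}\,i(J_\beta)dL,\qquad \eta_L=dz-\theta_L .$$ Let $\mathcal W=T^{2k-1}Q\times_{T^{k-1}Q}T^*(T^{k-1}Q)\times\mathbb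 R$, with projections $\varrho_1:\mathcal W\to T^{2k-1}Q\times\mathbb R$ and $\varrho_2:\mathcal W\to T^*(T^{k-1}Q)\times\mathbb R$; let $\eta_{\mathcal W}=\varrho_2^*(dz-\vartheta)$, with $\vartheta$ the canonical 1-form of $T^*(T^{k-1}Q)$, and let $\mathcal H(x,\xi,z)=\langle\xi,j_k(x)\rangle-L$, where $j_k:T^{2k-1}Q\to T(T^{k-1}Q)$, $(q_0,\dots,q_{2k-1})\mapsto(q_0,\dots,q_{k-1};q_1,\dots,q_k)$. Let $\mathcal W_1\subset\mathcal W$ be the graph of the generalized Legendre map, i.e. the set of $(x,\xi,z)$ with $(\theta_L)_{(x,z)}(u)=\langle\xi,T\rho(u)\rangle$ for all $u\in T_{(x,z)}(T^{2k-1}Q\times\mathbb R)$, where $\rho:T^{2k-1}Q\times\mathbb R\to T^{k-1}Q$ is the projection. A Reeb vector field of a 1-form $\eta$ is a vector field $R$ (not necessarily smooth) with $i(R)d\eta=0$ and $i(R)\eta=1$; let $R$ be any Reeb vector field of $\eta_{\mathcal W}$ (for example $\partial/\partial z$). Consider the unified contact equations $$i(X_{\mathcal H})d\eta_{\mathcal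 W}=d\mathcal H-R(\mathcal H)\,\eta_{\mathcal W},\qquad i(X_{\mathcal H})\eta_{\mathcal W}=-\mathcal H \tag{1}$$ and the contact Lagrangian equations $$i(X_L)d\eta_L=dE_L-R_L(E_L)\,\eta_L,\qquad i(X_L)\eta_L=-E_L. \tag{2}$$ In (2), $R_L(E_L)$ stands for the derivative of $E_L$ along a Reeb vector field $R_L$ of $\eta_L$, or for $-\partial L/\partial z$ (the two agree when $L$ is regular, and the second also makes sense when $\eta_L$ has no Reeb vector field). A vector field $X_L$ on $T^{2k-1}Q\times\mathbb R$ is holonomic at a point if $J_1(X_L)=\Delta_1$ there, and a vector field $X_{\mathcal H}$ on $\mathcal W$ is holonomic at $w$ if $J_1(T\varrho_1(X_{\mathcal H}(w)))=\Delta_1$ at $\varrho_1(w)$. Tangency to a subset at a point means being the velocity of a smooth curve contained in the subset. Let $\mathcal W_f$ be any subset of $\mathcal W_1$ (in particular an embedded submanifold, or $\mathcal W_1$ itself) and put $S_f=\varrho_1(\mathcal W_f)$. Then $\varrho_1$ restricts to a bijection $\mathcal W_1\to T^{2k-1}Q\times\mathbb R$, $\mathcal H=E_L\circ\varrho_1$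 on $\mathcal W_1$, and the following hold. (a) Let $X_{\mathcal H}$ be a smooth vector field on $\mathcal W$ that satisfies (1) at the points of $\mathcal W_f$ and is tangent to $\mathcal W_f$. Suppose that $X_{\mathcal H}$ is holonomic at the points of $\mathcal W_f$, or that $L$ is regular (its Hessian $\partial^2L/\partial q_k\partial q_k$ is everywhere nonsingular), or that $k=1$. Then the vector field $X_L$ on $T^{2k-1}Q\times\mathbb R$ defined by $X_L\circ\varrho_1=T\varrho_1\circ X_{\mathcal H}$ on $\mathcal W_1$ is smooth, is holonomic at the points of $S_f$, is tangent to $S_f$, and satisfies (2) at the points of $S_f$, for every admissible reading of $R_L(E_L)$. Moreover every integral curve of $X_L$ contained in $S_f$ is holonomic, i.e. its component in $T^{2k-1}Q$ is the canonical lift of its projection to $Q$. (b) Conversely, let $X_L$ be a smooth vector field on $T^{2k-1}Q\times\mathbb R$ that is holonomic at the points of $S_f$ and satisfies (2) there, for some admissible reading of $R_L(E_L)$. Then there is a smooth vector field $X_{\mathcal H}$ on $\mathcal W$ that satisfies (1) at the points of $\mathcal W_f$, is tangent to $\mathcal W_1$, is tangent to $\mathcal W_f$ whenever $X_L$ is tangent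 to $S_f$, and satisfies $X_L\circ\varrho_1=T\varrho_1\circ X_{\mathcal H}$ on $\mathcal W_1$. -/

import Mathlib

open Set Filter Topology Manifold Bundle
open scoped ContDiff

namespace HigherOrderContact

/-- The model space `ℝⁿ` of the configuration manifold. -/
abbrev Model (n : ℕ) := EuclideanSpace ℝ (Fin n)

/-- The model space of `TʳQ`: coordinates `(q₀, …, q_r)` with every `q_α` in `ℝⁿ`. -/
abbrev JetModel (n r : ℕ) := Fin (r + 1) → Model n

section Jets

/-- `c` is smooth in a neighbourhood of `0`. -/
def SmoothNearZero (n : ℕ) {Q : Type*} [TopologicalSpace Q] [ChartedSpace (Model n) Q]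
    (c : ℝ → Q) : Prop :=
  ∀ᶠ t in 𝓝 (0 : ℝ), ContMDiffAt 𝓘(ℝ, ℝ) 𝓘(ℝ, Model n) ∞ c t

variable (n r : ℕ) (Q : Type*) [TopologicalSpace Q] [ChartedSpace (Model n) Q]

/-- Two curves have the same `r`-jet at `0` when they have the same value and the same
derivatives up to order `r` at `0` in the charts of `Q` around that value. -/
def jetSetoid : Setoid {c : ℝ → Q // SmoothNearZero n c} where
  r c d := c.1 0 = d.1 0 ∧ ∀ e ∈ atlas (Model n) Q, c.1 0 ∈ e.source → ∀ α ≤ r,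
    iteratedDeriv α (e ∘ c.1) 0 = iteratedDeriv α (e ∘ d.1) 0
  iseqv :=
    ⟨fun _ => ⟨rfl, fun _ _ _ _ _ => rfl⟩,
     fun h => ⟨h.1.symm, fun e he hs α hα => (h.2 e he (h.1 ▸ hs) α hα).symm⟩,
     fun h h' => ⟨h.1.trans h'.1, fun e he hs α hα =>
      (h.2 e he hs α hα).trans (h'.2 e he (h.1 ▸ hs) α hα)⟩⟩

/-- The `r`-th order tangent bundle `TʳQ = J₀ʳ(ℝ, Q)`, as a set. -/
def Jet : Type _ := Quotient (jetSetoid n r Q)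

variable {n r Q}

/-- The `r`-jet at `0` of a curve. -/
def Jet.mk (c : ℝ → Q) (hc : SmoothNearZero n c) : Jet n r Q :=
  Quotient.mk (jetSetoid n r Q) ⟨c, hc⟩

/-- The projection `TʳQ → Q`. -/
def Jet.base (x : Jet n r Q) : Q := Quotient.lift (s := jetSetoid n r Q) (fun c => c.1 0) (fun _ _ h => h.1) x

/-- The projection `ρˢ_r : TˢQ → TʳQ`. -/
def Jet.proj {s : ℕ} (h : r ≤ s) (x : Jet n s Q) : Jet n r Q :=
  Quotient.map (sa := jetSetoid n s Q) (sb := jetSetoid n r Q) id (fun _ _ hcd =>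
    ⟨hcd.1, fun e he hs α hα => hcd.2 e he hs α (hα.trans h)⟩) x

/-- The natural coordinates `q_α = d^α(φ ∘ c)/dt^α(0)` of the jet of `c`, for a chart `φ` of `Q`. -/
noncomputable def Jet.coord (e : OpenPartialHomeomorph Q (Model n)) (x : Jet n r Q) :
    JetModel n r :=
  fun α => iteratedDeriv α (e ∘ (Quotient.out x).1) 0

/-- The polynomial curve with derivatives `a₀, …, a_r` at `0`. -/
noncomputable def polyCurve (a : JetModel n r) (t : ℝ) : Model n :=
  ∑ α : Fin (r + 1), (t ^ (α : ℕ) / (α : ℕ).factorial) • a α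

open Classical in
/-- The jet with natural coordinates `a` in the chart `e` (a junk value if `a₀ ∉ e.target`). -/
noncomputable def Jet.ofCoord (e : OpenPartialHomeomorph Q (Model n)) (a : JetModel n r) :
    Jet n r Q :=
  if h : SmoothNearZero n (fun t => e.symm (polyCurve a t)) then Jet.mk _ h
  else Jet.mk (fun _ => e.symm (a 0)) (.of_forall fun _ => contMDiffAt_const)

theorem contDiff_polyCurve (a : JetModel n r) : ContDiff ℝ ∞ (polyCurve a) := by
  unfold polyCurve; fun_prop

theorem iteratedDeriv_polyCurve (a : JetModel n r) (α : Fin (r + 1)) :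
    iteratedDeriv α (polyCurve a) 0 = a α := by
  unfold polyCurve
  rw [iteratedDeriv_fun_sum (fun i _ => by fun_prop), Finset.sum_eq_single α]
  · rw [iteratedDeriv_smul_const (by fun_prop), iteratedDeriv_div_const,
      iteratedDeriv_fun_pow_zero, if_pos rfl, div_self (by positivity), one_smul]
  · intro b _ hb
    rw [iteratedDeriv_smul_const (by fun_prop), iteratedDeriv_div_const,
      iteratedDeriv_fun_pow_zero, if_neg (fun h => hb (Fin.ext h.symm))]
    simp
  · simp

@[simp] theorem polyCurve_zero (a : JetModel n r) : polyCurve a 0 = a 0 := by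
  simpa using iteratedDeriv_polyCurve a 0

theorem iteratedDeriv_comp_congr {f g : ℝ → Model n} {Φ : Model n → Model n}
    (hf : ContDiffAt ℝ ∞ f 0) (hg : ContDiffAt ℝ ∞ g 0) (hΦ : ContDiffAt ℝ ∞ Φ (f 0))
    (h : ∀ α ≤ r, iteratedDeriv α f 0 = iteratedDeriv α g 0) (α : ℕ) (hα : α ≤ r) :
    iteratedDeriv α (Φ ∘ f) 0 = iteratedDeriv α (Φ ∘ g) 0 := by
  have h0 : f 0 = g 0 := by simpa using h 0 (Nat.zero_le _)
  have hα' : (α : WithTop ℕ∞) ≤ ∞ := by exact_mod_cast le_top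
  rw [iteratedDeriv_vcomp_eq_sum_orderedFinpartition hΦ hf hα',
    iteratedDeriv_vcomp_eq_sum_orderedFinpartition (h0 ▸ hΦ) hg hα', h0]
  refine Finset.sum_congr rfl fun c _ => ?_
  congr 1
  funext j
  exact h _ ((c.partSize_le j).trans hα)

theorem contDiffAt_multilinear_apply {X : Type*} [NormedAddCommGroup X] [NormedSpace ℝ X] {m : ℕ}
    {f : X → (Model n) [×m]→L[ℝ] (Model n)} {g : X → Fin m → Model n} {a : X}
    (hf : ContDiffAt ℝ ∞ f a) (hg : ContDiffAt ℝ ∞ g a) :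
    ContDiffAt ℝ ∞ (fun x => f x (g x)) a := by
  have key : ∀ x, f x (g x) = ∑ i : Fin m → Fin n, (∏ j, g x j (i j)) •
      f x (fun j => EuclideanSpace.basisFun (Fin n) ℝ (i j)) := by
    intro x
    have h : g x = fun j => ∑ i, g x j i • EuclideanSpace.basisFun (Fin n) ℝ i := by
      funext j
      simpa using ((EuclideanSpace.basisFun (Fin n) ℝ).sum_repr (g x j)).symm
    conv_lhs => rw [h]
    rw [ContinuousMultilinearMap.map_sum]
    exact Finset.sum_congr rfl fun i _ => (f x).map_smul_univ _ _
  refine ContDiffAt.congr_of_eventuallyEq ?_ (.of_forall key)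
  refine ContDiffAt.sum fun i _ => ContDiffAt.fun_smul ?_ ?_
  · exact contDiffAt_prod fun j _ => by fun_prop
  · exact (ContinuousMultilinearMap.apply ℝ (fun _ : Fin m => Model n) (Model n)
      (fun j => EuclideanSpace.basisFun (Fin n) ℝ (i j))).contDiff.contDiffAt.comp a hf

theorem contDiffOn_iteratedDeriv_polyCurve {Φ : Model n → Model n} {U : Set (Model n)}
    (hU : IsOpen U) (hΦ : ContDiffOn ℝ ∞ Φ U) :
    ContDiffOn ℝ ∞ (fun (a : JetModel n r) (α : Fin (r + 1)) =>
      iteratedDeriv α (Φ ∘ polyCurve a) 0) {a | a 0 ∈ U} := by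
  rw [contDiffOn_pi]
  intro α
  have hα' : ((α : ℕ) : WithTop ℕ∞) ≤ ∞ := by exact_mod_cast le_top
  have key : ∀ a ∈ {a : JetModel n r | a 0 ∈ U}, iteratedDeriv α (Φ ∘ polyCurve a) 0 =
      ∑ c : OrderedFinpartition α, iteratedFDeriv ℝ c.length Φ (a 0)
        (fun j => a ⟨c.partSize j, by have := c.partSize_le j; omega⟩) := by
    intro a ha
    rw [iteratedDeriv_vcomp_eq_sum_orderedFinpartition (n := ∞) ?_
      (contDiff_polyCurve a).contDiffAt hα']
    · refine Finset.sum_congr rfl fun c _ => ?_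
      rw [polyCurve_zero]
      congr 1
      funext j
      exact iteratedDeriv_polyCurve a ⟨c.partSize j, by have := c.partSize_le j; omega⟩
    · rw [polyCurve_zero]; exact hΦ.contDiffAt (hU.mem_nhds ha)
  refine ContDiffOn.congr ?_ key
  refine ContDiffOn.sum fun c _ => ?_
  intro a ha
  refine ContDiffAt.contDiffWithinAt ?_
  have h1 : ContDiffAt ℝ ∞ (fun a : JetModel n r => iteratedFDeriv ℝ c.length Φ (a 0)) a := by
    have h2 : ContDiffAt ℝ ∞ (iteratedFDeriv ℝ c.length Φ) (a 0) :=
      (hΦ.contDiffAt (hU.mem_nhds ha)).iteratedFDeriv_right (by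
        rw [show (∞ : WithTop ℕ∞) + (c.length : WithTop ℕ∞) = ∞ from rfl])
    exact h2.comp a (by fun_prop)
  have h3 : ContDiffAt ℝ ∞ (fun (a : JetModel n r) (j : Fin c.length) =>
      a ⟨c.partSize j, by have := c.partSize_le j; omega⟩) a := by fun_prop
  exact contDiffAt_multilinear_apply h1 h3

section Charts

variable {e e' : OpenPartialHomeomorph Q (Model n)}

theorem Jet.base_mk (c : ℝ → Q) (hc : SmoothNearZero n c) :
    (Jet.mk c hc : Jet n r Q).base = c 0 := rfl

theorem Jet.coord_mk (he : e ∈ atlas (Model n) Q) (c : ℝ → Q) (hc : SmoothNearZero n c)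
    (h0 : c 0 ∈ e.source) (α : Fin (r + 1)) :
    (Jet.mk c hc : Jet n r Q).coord e α = iteratedDeriv α (e ∘ c) 0 := by
  have h : (jetSetoid n r Q).r _ _ := Quotient.mk_out (s := jetSetoid n r Q) ⟨c, hc⟩
  exact h.2 e he (by rw [h.1]; exact h0) α (Nat.le_of_lt_succ α.2)

theorem Jet.mk_out (x : Jet n r Q) : x = Jet.mk (Quotient.out x).1 (Quotient.out x).2 :=
  (Quotient.out_eq x).symm

theorem Jet.coord_zero (he : e ∈ atlas (Model n) Q) (x : Jet n r Q) (hx : x.base ∈ e.source) :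
    x.coord e 0 = e x.base := by
  rw [x.mk_out] at hx ⊢
  rw [Jet.coord_mk he _ _ hx]
  simp [Jet.base_mk]

theorem Jet.base_proj {s : ℕ} (h : r ≤ s) (x : Jet n s Q) : (x.proj h).base = x.base := by
  rw [x.mk_out]; rfl

theorem Jet.coord_proj (he : e ∈ atlas (Model n) Q) {s : ℕ} (h : r ≤ s) (x : Jet n s Q)
    (hx : x.base ∈ e.source) :
    (x.proj h).coord e = fun α => x.coord e (Fin.castLE (Nat.succ_le_succ h) α) := by
  funext α
  rw [x.mk_out] at hx ⊢
  rw [Jet.coord_mk he _ _ hx]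
  exact Jet.coord_mk he _ _ hx α

variable [IsManifold 𝓘(ℝ, Model n) ∞ Q]

theorem contDiffOn_chart_change (he : e ∈ atlas (Model n) Q) (he' : e' ∈ atlas (Model n) Q) :
    ContDiffOn ℝ ∞ (e' ∘ e.symm) (e.symm.trans e').source := by
  have h := (contDiffGroupoid ∞ 𝓘(ℝ, Model n)).compatible he he'
  rw [contDiffGroupoid, mem_groupoid_of_pregroupoid] at h
  simpa [contDiffPregroupoid] using h.1

theorem smoothNearZero_symm_polyCurve (he : e ∈ atlas (Model n) Q) {a : JetModel n r}
    (ha : a 0 ∈ e.target) : SmoothNearZero n (fun t => e.symm (polyCurve a t)) := by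
  have hc : Continuous (polyCurve a) := (contDiff_polyCurve a).continuous
  have : ∀ᶠ t in 𝓝 (0 : ℝ), polyCurve a t ∈ e.target :=
    hc.continuousAt.eventually_mem (by rw [polyCurve_zero]; exact e.open_target.mem_nhds ha)
  filter_upwards [this] with t ht
  have h1 := (contMDiffOn_symm_of_mem_maximalAtlas (I := 𝓘(ℝ, Model n)) (n := ∞)
    (IsManifold.subset_maximalAtlas he)).contMDiffAt (e.open_target.mem_nhds ht)
  exact h1.comp t (contDiff_polyCurve a).contMDiff.contMDiffAt

theorem contDiffAt_chart_comp (he : e ∈ atlas (Model n) Q) {c : ℝ → Q} (hc : SmoothNearZero n c)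
    (h0 : c 0 ∈ e.source) : ContDiffAt ℝ ∞ (e ∘ c) 0 := by
  rw [← contMDiffAt_iff_contDiffAt]
  exact ((contMDiffOn_of_mem_maximalAtlas (I := 𝓘(ℝ, Model n)) (n := ∞)
    (IsManifold.subset_maximalAtlas he)).contMDiffAt (e.open_source.mem_nhds h0)).comp 0
      hc.self_of_nhds

theorem Jet.ofCoord_eq (he : e ∈ atlas (Model n) Q) {a : JetModel n r} (ha : a 0 ∈ e.target) :
    Jet.ofCoord e a = Jet.mk _ (smoothNearZero_symm_polyCurve he ha) := by
  rw [Jet.ofCoord, dif_pos]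

theorem Jet.base_ofCoord (he : e ∈ atlas (Model n) Q) {a : JetModel n r} (ha : a 0 ∈ e.target) :
    (Jet.ofCoord e a).base = e.symm (a 0) := by
  rw [Jet.ofCoord_eq he ha, Jet.base_mk, polyCurve_zero]

/-- The change of natural coordinates of jets. -/
theorem Jet.coord_ofCoord (he : e ∈ atlas (Model n) Q) (he' : e' ∈ atlas (Model n) Q)
    {a : JetModel n r} (ha : a 0 ∈ e.target) (ha' : e.symm (a 0) ∈ e'.source) :
    (Jet.ofCoord e a).coord e' = fun α : Fin (r + 1) => iteratedDeriv α ((e' ∘ e.symm) ∘ polyCurve a) 0 := by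
  funext α
  rw [Jet.ofCoord_eq he ha, Jet.coord_mk he' _ _ (by simpa using ha')]
  rfl

/-- The natural chart of `TʳQ` induced by a chart `e` of `Q`. -/
noncomputable def jetChart (r : ℕ) (he : e ∈ atlas (Model n) Q) :
    PartialEquiv (Jet n r Q) (JetModel n r) where
  toFun := Jet.coord e
  invFun := Jet.ofCoord e
  source := {x | x.base ∈ e.source}
  target := {a | a 0 ∈ e.target}
  map_source' x hx := by
    change x.coord e 0 ∈ e.target
    rw [Jet.coord_zero he x hx]
    exact e.map_source hx
  map_target' a ha := by
    change (Jet.ofCoord e a).base ∈ e.source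
    rw [Jet.base_ofCoord he ha]
    exact e.map_target ha
  left_inv' x hx := by
    have ha : x.coord e 0 ∈ e.target := by
      rw [Jet.coord_zero he x hx]; exact e.map_source hx
    rw [Jet.ofCoord_eq he ha]
    conv_rhs => rw [x.mk_out]
    set c := (Quotient.out x).1 with hcdef
    have hc : SmoothNearZero n c := (Quotient.out x).2
    have hx0 : c 0 ∈ e.source := by
      rw [x.mk_out] at hx; exact hx
    have hbase : e.symm (polyCurve (x.coord e) 0) = c 0 := by
      rw [polyCurve_zero, Jet.coord_zero he x hx, e.left_inv hx]
      conv_lhs => rw [x.mk_out]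
      rfl
    refine Quotient.sound (s := jetSetoid n r Q) ⟨hbase, fun e' he' hs α hα => ?_⟩
    have hs' : c 0 ∈ e'.source := by rw [← hbase]; exact hs
    have h1 : (e' ∘ fun t => e.symm (polyCurve (x.coord e) t)) =
        (e' ∘ e.symm) ∘ polyCurve (x.coord e) := rfl
    have h2 : (e' ∘ c) =ᶠ[𝓝 0] (e' ∘ e.symm) ∘ (e ∘ c) := by
      have : ∀ᶠ t in 𝓝 (0 : ℝ), c t ∈ e.source :=
        hc.self_of_nhds.continuousAt.eventually_mem (e.open_source.mem_nhds hx0)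
      filter_upwards [this] with t ht
      simp [e.left_inv ht]
    have hval : ∀ β ≤ r, iteratedDeriv β (polyCurve (x.coord e)) 0 =
        iteratedDeriv β (e ∘ c) 0 := fun β hβ =>
      iteratedDeriv_polyCurve (x.coord e) ⟨β, Nat.lt_succ_of_le hβ⟩
    rw [h1, h2.iteratedDeriv_eq]
    refine iteratedDeriv_comp_congr (contDiff_polyCurve _).contDiffAt
      (contDiffAt_chart_comp he hc hx0) ?_ hval α hα
    refine (contDiffOn_chart_change he he').contDiffAt ?_
    refine (e.symm.trans e').open_source.mem_nhds ?_
    rw [polyCurve_zero]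
    refine ⟨ha, ?_⟩
    rw [polyCurve_zero] at hbase
    change e.symm (x.coord e 0) ∈ e'.source
    rw [hbase]; exact hs'
  right_inv' a ha := by
    rw [Jet.coord_ofCoord he he ha (e.map_target ha)]
    funext α
    have : (e ∘ e.symm) ∘ polyCurve a =ᶠ[𝓝 0] polyCurve a := by
      have : ∀ᶠ t in 𝓝 (0 : ℝ), polyCurve a t ∈ e.target :=
        (contDiff_polyCurve a).continuous.continuousAt.eventually_mem
          (by rw [polyCurve_zero]; exact e.open_target.mem_nhds ha)
      filter_upwards [this] with t ht
      simp [e.right_inv ht]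
    rw [this.iteratedDeriv_eq, iteratedDeriv_polyCurve]

theorem jetChart_trans_source (he : e ∈ atlas (Model n) Q) (he' : e' ∈ atlas (Model n) Q) :
    ((jetChart r he).symm.trans (jetChart r he')).source =
      {a : JetModel n r | a 0 ∈ (e.symm.trans e').source} := by
  ext a
  constructor
  · rintro ⟨h1, h2⟩
    refine ⟨h1, ?_⟩
    change e.symm (a 0) ∈ e'.source
    rw [← Jet.base_ofCoord he (r := r) h1]; exact h2
  · rintro ⟨h1, h2⟩
    refine ⟨h1, ?_⟩
    change (Jet.ofCoord e a).base ∈ e'.source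
    rw [Jet.base_ofCoord he h1]; exact h2

theorem contDiffOn_jetChart_trans (he : e ∈ atlas (Model n) Q) (he' : e' ∈ atlas (Model n) Q) :
    ContDiffOn ℝ ∞ ((jetChart r he).symm.trans (jetChart r he'))
      ((jetChart r he).symm.trans (jetChart r he')).source := by
  rw [jetChart_trans_source]
  refine (contDiffOn_iteratedDeriv_polyCurve (e.symm.trans e').open_source
    (contDiffOn_chart_change he he')).congr ?_
  rintro a ⟨h1, h2⟩
  exact Jet.coord_ofCoord he he' h1 h2

variable (n r Q) in
/-- The natural charts of `TʳQ`. -/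
noncomputable def jetCore : ChartedSpaceCore (JetModel n r) (Jet n r Q) where
  atlas := {E | ∃ e, ∃ he : e ∈ atlas (Model n) Q, E = jetChart r he}
  chartAt x := jetChart r (chart_mem_atlas (Model n) x.base)
  mem_chart_source x := mem_chart_source (Model n) x.base
  chart_mem_atlas x := ⟨_, _, rfl⟩
  open_source := by
    rintro _ _ ⟨e, he, rfl⟩ ⟨e', he', rfl⟩
    rw [jetChart_trans_source]
    exact (e.symm.trans e').open_source.preimage (continuous_apply 0)
  continuousOn_toFun := by
    rintro _ _ ⟨e, he, rfl⟩ ⟨e', he', rfl⟩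
    exact (contDiffOn_jetChart_trans he he').continuousOn

noncomputable instance : TopologicalSpace (Jet n r Q) := (jetCore n r Q).toTopologicalSpace

noncomputable instance : ChartedSpace (JetModel n r) (Jet n r Q) := (jetCore n r Q).toChartedSpace

instance : IsManifold 𝓘(ℝ, JetModel n r) ∞ (Jet n r Q) := by
  refine isManifold_of_contDiffOn _ _ _ ?_
  rintro E E' hE hE'
  change E ∈ ⋃ (e : PartialEquiv (Jet n r Q) (JetModel n r)) (he : e ∈ (jetCore n r Q).atlas),
    {(jetCore n r Q).openPartialHomeomorph e he} at hE
  change E' ∈ ⋃ (e : PartialEquiv (Jet n r Q) (JetModel n r)) (he : e ∈ (jetCore n r Q).atlas),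
    {(jetCore n r Q).openPartialHomeomorph e he} at hE'
  simp only [mem_iUnion, mem_singleton_iff] at hE hE'
  obtain ⟨_, ⟨e, he, rfl⟩, rfl⟩ := hE
  obtain ⟨_, ⟨e', he', rfl⟩, rfl⟩ := hE'
  have h := contDiffOn_jetChart_trans (r := r) he he'
  simp only [modelWithCornersSelf_coe, modelWithCornersSelf_coe_symm, range_id, inter_univ,
    preimage_id, Function.comp_id, Function.id_comp]
  exact h

theorem Jet.contMDiff_proj {s : ℕ} (h : r ≤ s) :
    ContMDiff 𝓘(ℝ, JetModel n s) 𝓘(ℝ, JetModel n r) ∞ (Jet.proj (Q := Q) (n := n) h) := by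
  intro x
  let R : JetModel n s → JetModel n r := fun a α => a (Fin.castLE (Nat.succ_le_succ h) α)
  have hR : ContDiff ℝ ∞ R := by fun_prop
  have hx := mem_chart_source (JetModel n s) x
  have h1 : ContMDiffAt 𝓘(ℝ, JetModel n s) 𝓘(ℝ, JetModel n s) ∞ (chartAt (JetModel n s) x) x :=
    (contMDiffOn_chart (I := 𝓘(ℝ, JetModel n s))).contMDiffAt
      ((chartAt (JetModel n s) x).open_source.mem_nhds hx)
  have key : ∀ y ∈ (chartAt (JetModel n s) x).source,
      R (chartAt (JetModel n s) x y) ∈ (chartAt (JetModel n r) (x.proj h)).target ∧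
      y.proj h = (chartAt (JetModel n r) (x.proj h)).symm (R (chartAt (JetModel n s) x y)) := by
    intro y hy
    have hy' : y.base ∈ (chartAt (Model n) x.base).source := hy
    have h2 : y.proj h ∈ (chartAt (JetModel n r) (x.proj h)).source := by
      change (y.proj h).base ∈ (chartAt (Model n) (x.proj h).base).source
      rw [Jet.base_proj, Jet.base_proj]; exact hy'
    have h3 : chartAt (JetModel n r) (x.proj h) (y.proj h) = R (chartAt (JetModel n s) x y) := by
      change (y.proj h).coord (chartAt (Model n) (x.proj h).base) =
        R (y.coord (chartAt (Model n) x.base))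
      rw [Jet.base_proj, Jet.coord_proj (chart_mem_atlas _ _) h y hy']
    rw [← h3]
    exact ⟨(chartAt (JetModel n r) (x.proj h)).map_source h2,
      ((chartAt (JetModel n r) (x.proj h)).left_inv h2).symm⟩
  have h4 : ContMDiffAt 𝓘(ℝ, JetModel n r) 𝓘(ℝ, JetModel n r) ∞
      (chartAt (JetModel n r) (x.proj h)).symm (R (chartAt (JetModel n s) x x)) :=
    (contMDiffOn_chart_symm (I := 𝓘(ℝ, JetModel n r))).contMDiffAt
      ((chartAt (JetModel n r) (x.proj h)).open_target.mem_nhds (key x hx).1)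
  have h5 := h4.comp x (hR.contMDiff.contMDiffAt.comp x h1)
  refine h5.congr_of_eventuallyEq ?_
  filter_upwards [(chartAt (JetModel n s) x).open_source.mem_nhds hx] with y hy
  exact (key y hy).2

end Charts

end Jets

section Forms

variable {E H M : Type*} [NormedAddCommGroup E] [NormedSpace ℝ E] [TopologicalSpace H]
  (I : ModelWithCorners ℝ E H) [TopologicalSpace M] [ChartedSpace H M]

/-- A smooth vector field on `M`. -/
def IsSmoothVectorField [IsManifold I 1 M] (X : (x : M) → TangentSpace I x) : Prop :=
  ContMDiff I I.tangent ∞ (fun x => (⟨x, X x⟩ : TangentBundle I M))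

/-- A 1-form on `M`. -/
abbrev OneForm (M : Type*) [TopologicalSpace M] [ChartedSpace H M] : Type _ :=
  (x : M) → TangentSpace I x →L[ℝ] ℝ

variable {I}

/-- The local expression of a 1-form in the chart at `x₀`. -/
noncomputable def formInChart (ξ : OneForm I M) (x₀ : M) (y : E) : E →L[ℝ] ℝ :=
  (ξ ((extChartAt I x₀).symm y)).comp (mfderiv 𝓘(ℝ, E) I (extChartAt I x₀).symm y)

/-- The exterior derivative `dξ(u, v) = D_u ξ(v) - D_v ξ(u)` of a 1-form on a boundaryless
manifold, computed in the chart at `x` (by which Mathlib identifies `T_x M` with the model space). -/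
noncomputable def extD (ξ : OneForm I M) (x : M) :
    TangentSpace I x →L[ℝ] TangentSpace I x →L[ℝ] ℝ :=
  let D : E →L[ℝ] E →L[ℝ] ℝ := fderiv ℝ (formInChart ξ x) (extChartAt I x x)
  D - D.flip

/-- The differential of a function, as a 1-form. -/
noncomputable def dfun (I : ModelWithCorners ℝ E H) (f : M → ℝ) : OneForm I M :=
  fun x => mfderiv I 𝓘(ℝ, ℝ) f x

/-- `R` is a Reeb vector field of `η`: `i(R) dη = 0` and `i(R) η = 1`. -/
def IsReeb (η : OneForm I M) (R : (x : M) → TangentSpace I x) : Prop :=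
  ∀ x, (∀ v, extD η x (R x) v = 0) ∧ η x (R x) = 1

/-- On the points of `S`, `X` solves `i(X) dη = dF - ρ η` and `i(X) η = -F`. These are the contact
Hamiltonian equations of `F` when `ρ = R(F)` for a Reeb vector field `R`. -/
def SolvesContactEq (η : OneForm I M) (F ρ : M → ℝ) (X : (x : M) → TangentSpace I x)
    (S : Set M) : Prop :=
  ∀ x ∈ S, (∀ v, extD η x (X x) v = dfun I F x v - ρ x * η x v) ∧ η x (X x) = -F x

/-- `X` is tangent to `S`: at each `x ∈ S`, the vector `X x` is the velocity of a smooth curve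
contained in `S`. For an embedded submanifold `S` this means `X x ∈ T_x S`. -/
def IsTangentTo (X : (x : M) → TangentSpace I x) (S : Set M) : Prop :=
  ∀ x ∈ S, ∃ γ : ℝ → M, (∀ᶠ t in 𝓝 (0 : ℝ), ContMDiffAt 𝓘(ℝ, ℝ) I ∞ γ t ∧ γ t ∈ S) ∧
    (⟨γ 0, mfderiv 𝓘(ℝ, ℝ) I γ 0 (1 : ℝ)⟩ : TangentBundle I M) = ⟨x, X x⟩

end Forms

section Extended

variable {n r s k : ℕ} {Q : Type*} [TopologicalSpace Q] [ChartedSpace (Model n) Q]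
  [IsManifold 𝓘(ℝ, Model n) ∞ Q]

/-- The extended higher-order tangent bundle `TʳQ × ℝ`. -/
abbrev ExtJet (n r : ℕ) (Q : Type*) [TopologicalSpace Q] [ChartedSpace (Model n) Q] : Type _ :=
  Jet n r Q × ℝ

/-- The model with corners of `TʳQ × ℝ`. -/
noncomputable abbrev extModel (n r : ℕ) := 𝓘(ℝ, JetModel n r).prod 𝓘(ℝ, ℝ)

/-- The projection `τˢ_r : TˢQ × ℝ → TʳQ × ℝ`. -/
def extProj (h : r ≤ s) (x : ExtJet n s Q) : ExtJet n r Q := (x.1.proj h, x.2)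

/-- The natural coordinates of a jet in the preferred chart of `Q` at its base point. By
construction of the tangent spaces in Mathlib, `T_x(TʳQ)` is the model space `(v₀, …, v_r)`, with
respect to these same natural coordinates. -/
noncomputable def Jet.q (x : Jet n r Q) : JetModel n r := x.coord (chartAt (Model n) x.base)

/-- The canonical injection `j_{r+1} : TˢQ → T(TʳQ)`,
`(q₀, …, q_s) ↦ (q₀, …, q_r; q₁, …, q_{r+1})`. -/
noncomputable def Jet.inj (h : r < s) (x : Jet n s Q) :
    TangentSpace 𝓘(ℝ, JetModel n r) (x.proj h.le) :=
  show JetModel n r from fun α => x.q ⟨(α : ℕ) + 1, by omega⟩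

/-- The vertical endomorphism `J_β` of `T(TʳQ)`:
`J_β = ∑_α (β + α)! / α! dq_α ⊗ ∂/∂q_{β+α}`. -/
noncomputable def Jet.J (β : ℕ) (x : Jet n r Q) :
    TangentSpace 𝓘(ℝ, JetModel n r) x →L[ℝ] TangentSpace 𝓘(ℝ, JetModel n r) x :=
  show JetModel n r →L[ℝ] JetModel n r from
    ContinuousLinearMap.pi fun α : Fin (r + 1) =>
      if β ≤ (α : ℕ) then ((α : ℕ).descFactorial β : ℝ) • ContinuousLinearMap.proj
        (R := ℝ) (φ := fun _ : Fin (r + 1) => Model n) ⟨(α : ℕ) - β, by omega⟩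
      else 0

/-- The canonical vector field `Δ_β` on `TʳQ`, for `1 ≤ β`:
`Δ_β = ∑_α (β + α)! / α! q_{α+1} ∂/∂q_{β+α}`. -/
noncomputable def Jet.Delta (β : ℕ) (x : Jet n r Q) : TangentSpace 𝓘(ℝ, JetModel n r) x :=
  show JetModel n r from fun α =>
    if h : 1 ≤ β ∧ β ≤ (α : ℕ) then ((α : ℕ).descFactorial β : ℝ) • x.q ⟨(α : ℕ) - β + 1, by omega⟩ else 0

/-- The vertical endomorphism `𝒥_β` of `T(TʳQ × ℝ)`. -/
noncomputable def extJ (β : ℕ) (x : ExtJet n r Q) :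
    TangentSpace (extModel n r) x →L[ℝ] TangentSpace (extModel n r) x :=
  show JetModel n r × ℝ →L[ℝ] JetModel n r × ℝ from
    (ContinuousLinearMap.prodMap (x.1.J β) (0 : ℝ →L[ℝ] ℝ))

/-- The canonical vector field `Δ_β` on `TʳQ × ℝ`. -/
noncomputable def extDelta (β : ℕ) (x : ExtJet n r Q) : TangentSpace (extModel n r) x :=
  show JetModel n r × ℝ from (x.1.Delta β, 0)

/-- A tangent vector `v` of `TʳQ × ℝ` at `x` satisfies the condition of holonomic vector fields
(semisprays of order 1): `𝒥₁ v = Δ₁`. -/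
def IsHolonomicVector (x : ExtJet n r Q) (v : TangentSpace (extModel n r) x) : Prop :=
  extJ 1 x v = extDelta 1 x

/-- The curve `γ` in `TʳQ × ℝ` is holonomic on `s`: its component in `TʳQ` is the canonical lift
(the prolongation) of its projection to `Q`. -/
def IsHolonomicCurveOn (γ : ℝ → ExtJet n r Q) (s : Set ℝ) : Prop :=
  ∀ t ∈ s, ∃ h : SmoothNearZero n (fun τ => (γ (τ + t)).1.base), (γ t).1 = Jet.mk _ h

/-! ### Lagrangian objects -/

/-- `∂L/∂z`. -/
noncomputable def dLdz (L : ExtJet n k Q → ℝ) (x : ExtJet n k Q) : ℝ :=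
  dfun (extModel n k) L x (show JetModel n k × ℝ from (0, 1))

/-- The vector `Tτ(Γ)` at `τ(x)`, where `τ : T^{r+1}Q × ℝ → TʳQ × ℝ` is the projection and `Γ` is
any semispray of type 1 on `T^{r+1}Q × ℝ` with `i(Γ) dz = L`:
`q₁ ∂/∂q₀ + … + q_{r+1} ∂/∂q_r + L ∂/∂z`. -/
noncomputable def totalVector (L : ExtJet n k Q → ℝ) (h : k ≤ r) (x : ExtJet n (r + 1) Q) :
    TangentSpace (extModel n r) (extProj r.le_succ x) :=
  show JetModel n r × ℝ from (x.1.inj r.lt_succ_self, L (extProj (h.trans r.le_succ) x))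

/-- `d_L F = ℒ_Γ(τ^* F)` for a function `F`. -/
noncomputable def dL (L : ExtJet n k Q → ℝ) (h : k ≤ r) (F : ExtJet n r Q → ℝ)
    (x : ExtJet n (r + 1) Q) : ℝ :=
  dfun (extModel n r) F (extProj r.le_succ x) (totalVector L h x)

/-- The Lagrangian total derivative `D_L F = d_L F - (∂L/∂z) τ^* F` of a function `F`. -/
noncomputable def DL (L : ExtJet n k Q → ℝ) (h : k ≤ r) (F : ExtJet n r Q → ℝ)
    (x : ExtJet n (r + 1) Q) : ℝ :=
  dL L h F x - dLdz L (extProj (h.trans r.le_succ) x) * F (extProj r.le_succ x)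

/-- The pullback `τ^* ξ` of a 1-form. -/
noncomputable def pullForm (h : r ≤ s) (ξ : OneForm (extModel n r) (ExtJet n r Q)) :
    OneForm (extModel n s) (ExtJet n s Q) :=
  fun x => (ξ (extProj h x)).comp (mfderiv (extModel n s) (extModel n r) (extProj h) x)

/-- `d_L ξ = ℒ_Γ(τ^* ξ) = i(Γ) τ^* dξ + d(i(Γ) τ^* ξ)` for a 1-form `ξ` (this only involves
`Tτ(Γ)`). -/
noncomputable def dLForm (L : ExtJet n k Q → ℝ) (h : k ≤ r)
    (ξ : OneForm (extModel n r) (ExtJet n r Q)) :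
    OneForm (extModel n (r + 1)) (ExtJet n (r + 1) Q) :=
  fun x => (extD ξ (extProj r.le_succ x) (totalVector L h x)).comp
      (mfderiv (extModel n (r + 1)) (extModel n r) (extProj r.le_succ) x) +
    dfun (extModel n (r + 1)) (fun y => ξ (extProj r.le_succ y) (totalVector L h y)) x

/-- The Lagrangian total derivative `D_L ξ = d_L ξ - (∂L/∂z) τ^* ξ` of a 1-form `ξ`. -/
noncomputable def DLForm (L : ExtJet n k Q → ℝ) (h : k ≤ r)
    (ξ : OneForm (extModel n r) (ExtJet n r Q)) :
    OneForm (extModel n (r + 1)) (ExtJet n (r + 1) Q) :=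
  fun x => dLForm L h ξ x - dLdz L (extProj (h.trans r.le_succ) x) • pullForm r.le_succ ξ x

/-- `D_L^m F` for a function `F` on `TᵏQ × ℝ`. -/
noncomputable def DLIter (L : ExtJet n k Q → ℝ) (F : ExtJet n k Q → ℝ) :
    (m : ℕ) → ExtJet n (k + m) Q → ℝ
  | 0 => F
  | m + 1 => DL L (Nat.le_add_right k m) (DLIter L F m)

/-- `D_L^m ξ` for a 1-form `ξ` on `TᵏQ × ℝ`. -/
noncomputable def DLFormIter (L : ExtJet n k Q → ℝ) (ξ : OneForm (extModel n k) (ExtJet n k Q)) :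
    (m : ℕ) → OneForm (extModel n (k + m)) (ExtJet n (k + m) Q)
  | 0 => ξ
  | m + 1 => DLForm L (Nat.le_add_right k m) (DLFormIter L ξ m)

/-- The Lagrangian energy `E_L = ∑_{β=1}^k (-1)^{β-1} (1/β!) D_L^{β-1}(Δ_β(L)) - L` on
`T^{2k-1}Q × ℝ` (with `β = b + 1`). -/
noncomputable def energy (hk : 1 ≤ k) (L : ExtJet n k Q → ℝ) (x : ExtJet n (2 * k - 1) Q) : ℝ :=
  ∑ b : Fin k, (-1 : ℝ) ^ (b : ℕ) / ((b : ℕ) + 1).factorial *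
      DLIter L (fun y => dfun (extModel n k) L y (extDelta ((b : ℕ) + 1) y)) b
        (extProj (by omega) x) -
    L (extProj (by omega) x)

/-- The Cartan 1-form `θ_L = ∑_{β=1}^k (-1)^{β-1} (1/β!) D_L^{β-1}(i(𝒥_β) dL)` on
`T^{2k-1}Q × ℝ` (with `β = b + 1`). -/
noncomputable def cartanForm (L : ExtJet n k Q → ℝ) :
    OneForm (extModel n (2 * k - 1)) (ExtJet n (2 * k - 1) Q) :=
  fun x => ∑ b : Fin k, ((-1 : ℝ) ^ (b : ℕ) / ((b : ℕ) + 1).factorial) •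
    pullForm (by omega)
      (DLFormIter L (fun y => (dfun (extModel n k) L y).comp (extJ ((b : ℕ) + 1) y)) b) x

/-- The contact Lagrangian form `η_L = dz - θ_L`. -/
noncomputable def contactForm (L : ExtJet n k Q → ℝ) :
    OneForm (extModel n (2 * k - 1)) (ExtJet n (2 * k - 1) Q) :=
  fun x => dfun (extModel n (2 * k - 1)) Prod.snd x - cartanForm L x

/-- `L` is regular: the Hessian matrix `∂²L/∂q_k∂q_k` is everywhere nonsingular. -/
def IsRegularLagrangian (L : ExtJet n k Q → ℝ) : Prop :=
  ∀ x : ExtJet n k Q, ∀ u : Model n,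
    (∀ v : Model n, fderiv ℝ (fderiv ℝ fun a : Model n =>
      L (Jet.ofCoord (chartAt (Model n) x.1.base) (Function.update x.1.q (Fin.last k) a), x.2))
        (x.1.q (Fin.last k)) u v = 0) → u = 0

/-- `ρ` can play the role of `R_L(E_L)` in the contact Lagrangian equations: it is `R(E_L)` for a
Reeb vector field `R` of `η_L`, or it is `-∂L/∂z`. (If `L` is regular the two coincide; if `L` is
singular, `η_L` may have several Reeb vector fields, or none.) -/
def IsReebRate (hk : 1 ≤ k) (L : ExtJet n k Q → ℝ) (ρ : ExtJet n (2 * k - 1) Q → ℝ) : Prop :=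
  (∃ R, IsReeb (contactForm L) R ∧
    ρ = fun x => dfun (extModel n (2 * k - 1)) (energy hk L) x (R x)) ∨
  ρ = fun x => -dLdz L (extProj (by omega) x)

/-! ### The unified bundle -/

/-- The cotangent spaces of `TʳQ`. -/
abbrev Cotangent (n r : ℕ) (Q : Type*) [TopologicalSpace Q] [ChartedSpace (Model n) Q]
    [IsManifold 𝓘(ℝ, Model n) ∞ Q] (y : Jet n r Q) : Type _ :=
  TangentSpace 𝓘(ℝ, JetModel n r) y →L[ℝ] Bundle.Trivial (Jet n r Q) ℝ y

/-- The cotangent bundle `T^*(TʳQ)`. -/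
abbrev CotangentBundle (n r : ℕ) (Q : Type*) [TopologicalSpace Q] [ChartedSpace (Model n) Q]
    [IsManifold 𝓘(ℝ, Model n) ∞ Q] : Type _ :=
  TotalSpace (JetModel n r →L[ℝ] ℝ) (Cotangent n r Q)

/-- The model with corners of `T^*(TʳQ)`. -/
noncomputable abbrev cotModel (n r : ℕ) :=
  𝓘(ℝ, JetModel n r).prod 𝓘(ℝ, JetModel n r →L[ℝ] ℝ)

/-- The projection `T^{2k-1}Q × ℝ → T^{k-1}Q`. -/
noncomputable def toMomentumBase (n k : ℕ) (Q : Type*) [TopologicalSpace Q]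
    [ChartedSpace (Model n) Q] [IsManifold 𝓘(ℝ, Model n) ∞ Q] :
    ContMDiffMap (extModel n (2 * k - 1)) 𝓘(ℝ, JetModel n (k - 1))
      (ExtJet n (2 * k - 1) Q) (Jet n (k - 1) Q) ∞ :=
  have h : k - 1 ≤ 2 * k - 1 := by omega
  ⟨fun x => x.1.proj h, (Jet.contMDiff_proj h).comp contMDiff_fst⟩

/-- The higher-order extended unified bundle
`𝒲 = T^{2k-1}Q ×_{T^{k-1}Q} T^*(T^{k-1}Q) × ℝ`, realized as the pullback of `T^*(T^{k-1}Q)` to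
`T^{2k-1}Q × ℝ`: a point is `⟨(x, z), ξ⟩` with `ξ` a covector at the projection of `x`. -/
abbrev Unified (n k : ℕ) (Q : Type*) [TopologicalSpace Q] [ChartedSpace (Model n) Q]
    [IsManifold 𝓘(ℝ, Model n) ∞ Q] : Type _ :=
  TotalSpace (JetModel n (k - 1) →L[ℝ] ℝ) (toMomentumBase n k Q *ᵖ (Cotangent n (k - 1) Q))

/-- The model with corners of `𝒲`. -/
noncomputable abbrev uniModel (n k : ℕ) :=
  (extModel n (2 * k - 1)).prod 𝓘(ℝ, JetModel n (k - 1) →L[ℝ] ℝ)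

/-- The submersion `ϱ₁ : 𝒲 → T^{2k-1}Q × ℝ`. -/
def rho1 (w : Unified n k Q) : ExtJet n (2 * k - 1) Q := w.proj

/-- The submersion `ϱ₂ : 𝒲 → T^*(T^{k-1}Q) × ℝ`. -/
noncomputable def rho2 (w : Unified n k Q) : CotangentBundle n (k - 1) Q × ℝ :=
  (⟨toMomentumBase n k Q w.proj, w.snd⟩, w.proj.2)

/-- The canonical (Liouville) 1-form `ϑ` of `T^*(TʳQ)`: `ϑ_ξ(u) = ξ(Tπ(u))`. -/
noncomputable def liouvilleForm (y : CotangentBundle n r Q) :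
    TangentSpace (cotModel n r) y →L[ℝ] ℝ :=
  ContinuousLinearMap.comp (show TangentSpace 𝓘(ℝ, JetModel n r) y.proj →L[ℝ] ℝ from y.snd)
    (mfderiv (cotModel n r) 𝓘(ℝ, JetModel n r) TotalSpace.proj y)

/-- The canonical contact form `dz - π₁^* ϑ` of `T^*(TʳQ) × ℝ`. -/
noncomputable def canonicalContactForm :
    OneForm ((cotModel n r).prod 𝓘(ℝ, ℝ)) (CotangentBundle n r Q × ℝ) :=
  fun y => dfun ((cotModel n r).prod 𝓘(ℝ, ℝ)) Prod.snd y -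
    (liouvilleForm y.1).comp
      (mfderiv ((cotModel n r).prod 𝓘(ℝ, ℝ)) (cotModel n r) Prod.fst y)

/-- The canonical precontact form `η_𝒲 = ϱ₂^* η_{k-1}` of `𝒲`. -/
noncomputable def unifiedForm : OneForm (uniModel n k) (Unified n k Q) :=
  fun w => (canonicalContactForm (rho2 w)).comp
    (mfderiv (uniModel n k) ((cotModel n (k - 1)).prod 𝓘(ℝ, ℝ)) rho2 w)

/-- The coupling function `𝒞(x, ξ, z) = ⟨ξ, j_k(x)⟩`. -/
noncomputable def coupling (hk : 1 ≤ k) (w : Unified n k Q) : ℝ :=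
  (show TangentSpace 𝓘(ℝ, JetModel n (k - 1)) (toMomentumBase n k Q w.proj) →L[ℝ] ℝ from w.snd)
    (w.proj.1.inj (r := k - 1) (by omega))

/-- The Hamiltonian function `ℋ = 𝒞 - L` on `𝒲`. -/
noncomputable def hamiltonian (hk : 1 ≤ k) (L : ExtJet n k Q → ℝ) (w : Unified n k Q) : ℝ :=
  coupling hk w - L (extProj (by omega) (rho1 w))

/-- The constraint submanifold `𝒲₁`, the graph of the generalized Legendre map: the covector `ξ` is
the one determined by `θ_L(u) = ⟨ξ, Tρ(u)⟩` for every `u` tangent to `T^{2k-1}Q × ℝ`. -/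
def legendreGraph (L : ExtJet n k Q → ℝ) : Set (Unified n k Q) :=
  {w | ∀ u : TangentSpace (extModel n (2 * k - 1)) w.proj, cartanForm L w.proj u =
    (show TangentSpace 𝓘(ℝ, JetModel n (k - 1)) (toMomentumBase n k Q w.proj) →L[ℝ] ℝ from w.snd)
      (mfderiv (extModel n (2 * k - 1)) 𝓘(ℝ, JetModel n (k - 1)) (toMomentumBase n k Q) w.proj u)}

end Extended

end HigherOrderContact

open HigherOrderContact

/-! In natural coordinates `(q₀, …, q_{2k-1}, z)` both systems become the same equations for one
tangent vector. Let `D` be the Lagrangian total derivative and define the Jacobi–Ostrogradsky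
momenta by `p_i = ∂L/∂q_{i+1} - D p_{i+1}`, with `p_i = 0` for `i ≥ k`. Then `θ_L = ∑_{i<k} p_i
dq_i` and `E_L = ∑_{i<k} p_i q_{i+1} - L` (`isFormRep_cartanForm`, `isLocalRep_energy`). To reach
these from the sums over `J_β` and `Δ_β`, note that `D_L` acts on the coefficients of `∑ f_γ dq_γ`
as `D` plus the index shift. The two commute, the binomial theorem expands the powers, and an
alternating binomial sum collapses the result to the momenta (`sum_seqD_iterate_eq_momentumSeq`).

Consequently `𝒲₁` is the image of a smooth section `s` of `ϱ₁` (`legendreSection`), whose covector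
is `(p_0, …, p_{k-1})`, and `ℋ = E_L ∘ ϱ₁` there. A curve in `𝒲₁` equals `s` of its projection, so a
vector tangent to a subset of `𝒲₁` is `Ts(X)`, with `X` its projection (`snd_eq_of_isTangentTo`).
For such a vector, (1) amounts to `X_i = q_{i+1}` for `i < k`, `X_z = L`, and `X(p_i) = ∂L/∂q_i -
p_{i-1} + (∂L/∂z) p_i` for `i < k`, with `p_{-1} = 0` (`unifiedEquations_iff`). If `X_i = q_{i+1}`
for `i < k` is already known, then (2) amounts to the remaining equations together with the rate
being `-∂L/∂z` (`lagrangianEquations_iff`). The structure `IsLagrangianVector` records the common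
conditions.

Two points remain in (a). First, (1) only gives the components `i < k` of holonomy, out of `i <
2k-1`. Nothing is missing if `k = 1`. If `L` is regular, then `∂p_{k-1-m}/∂q_{k+m} = ±∂²L/∂q_k∂q_k`,
while `X` and the total field `Γ` have the same derivative on `p_i` for `i ≥ 1`. Solving this
triangular system gives the missing components one at a time (`eq_totalField_of_regular`). Secondly,
pairing a solution of rate `-∂L/∂z` with a Reeb field of `η_L` shows that every admissible rate has
this value (`reebRate_eq`). On `𝒲₁`, every Reeb field of `η_𝒲` gives `R(ℋ) = -∂L/∂z` as well
(`reeb_hamiltonian`).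

For (b), `Ts ∘ X_L` is prescribed on `𝒲₁` and is extended smoothly to `𝒲` by a partition of unity
(`exists_lift`). This is where `Q` Hausdorff and second countable is used.

Since `J_β`, `Δ_β` and `j_k` are defined through preferred charts, the computation first requires
their naturality under changes of chart. It follows from viewing tangent vectors of jet spaces as
jets of variations of curves (`fderiv_prolong`): `J_β` multiplies a variation by `t^β`, and `Δ_β` is
the variation `t^β c'`. -/

namespace HigherOrderContact

/-! ### Derivatives of curves depending on a parameter -/

section ParametricDerivatives

variable {E F : Type*} [NormedAddCommGroup E] [NormedSpace ℝ E]
  [NormedAddCommGroup F] [NormedSpace ℝ F]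

theorem _root_.ContDiffAt.fderiv_top {f : E → F} {x : E} (hf : ContDiffAt ℝ ∞ f x) :
    ContDiffAt ℝ ∞ (fderiv ℝ f) x :=
  hf.fderiv_right (m := ∞) (by rfl)

theorem _root_.ContDiffAt.deriv_top {f : ℝ → F} {x : ℝ} (hf : ContDiffAt ℝ ∞ f x) :
    ContDiffAt ℝ ∞ (deriv f) x := by
  have h : deriv f = fun t => fderiv ℝ f t 1 := by
    funext t; simp
  rw [h]
  exact hf.fderiv_top.clm_apply contDiffAt_const

theorem _root_.ContDiffAt.differentiableAt_top {f : E → F} {x : E} (hf : ContDiffAt ℝ ∞ f x) :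
    DifferentiableAt ℝ f x :=
  hf.differentiableAt (by simp)

theorem _root_.ContDiffAt.isSymm_top {f : E → F} {x : E} (hf : ContDiffAt ℝ ∞ f x) (u v : E) :
    fderiv ℝ (fderiv ℝ f) x u v = fderiv ℝ (fderiv ℝ f) x v u :=
  (hf.isSymmSndFDerivAt (by
    rw [minSmoothness_of_isRCLikeNormedField]
    exact WithTop.coe_le_coe.2 le_top)).eq u v

/-- Mixed derivatives commute. Induction on `α` replaces `G` by `∂G/∂t`, and each step interchanges
one `t`-derivative with `∂/∂s` by symmetry of the second derivative. -/
theorem hasDerivAt_iteratedDeriv_param {G : ℝ × ℝ → E} {Ω : Set (ℝ × ℝ)} (hΩ : IsOpen Ω)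
    (hG : ContDiffOn ℝ ∞ G Ω) (α : ℕ) {s t : ℝ} (h : (s, t) ∈ Ω) :
    HasDerivAt (fun s => iteratedDeriv α (fun t => G (s, t)) t)
      (iteratedDeriv α (fun t => fderiv ℝ G (s, t) (1, 0)) t) s := by
  have hat : ∀ {H : ℝ × ℝ → E}, ContDiffOn ℝ ∞ H Ω → ∀ p ∈ Ω, ContDiffAt ℝ ∞ H p :=
    fun hH p hp => hH.contDiffAt (hΩ.mem_nhds hp)
  have hline : ∀ (H : ℝ × ℝ → E), ContDiffOn ℝ ∞ H Ω → ∀ s t, (s, t) ∈ Ω →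
      HasDerivAt (fun t => H (s, t)) (fderiv ℝ H (s, t) (0, 1)) t := fun H hH s t hp =>
    ((hat hH _ hp).differentiableAt_top.hasFDerivAt).comp_hasDerivAt t
      ((hasDerivAt_const t s).prodMk (hasDerivAt_id t))
  induction α generalizing G s t with
  | zero =>
    simp only [iteratedDeriv_zero]
    exact ((hat hG _ h).differentiableAt_top.hasFDerivAt).comp_hasDerivAt s
      ((hasDerivAt_id s).prodMk (hasDerivAt_const s t))
  | succ α ih =>
    set G' : ℝ × ℝ → E := fun p => fderiv ℝ G p (0, 1)
    have hG' : ContDiffOn ℝ ∞ G' Ω := fun p hp =>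
      ((hat hG p hp).fderiv_top.clm_apply contDiffAt_const).contDiffWithinAt
    have hev : ∀ s t, (s, t) ∈ Ω → ∀ᶠ t' in 𝓝 t, (s, t') ∈ Ω := fun s t hp =>
      (Continuous.continuousAt (f := fun t' : ℝ => (s, t')) (by fun_prop)).eventually_mem
        (hΩ.mem_nhds hp)
    have e1 : (fun s => iteratedDeriv (α + 1) (fun t => G (s, t)) t) =ᶠ[𝓝 s]
        fun s => iteratedDeriv α (fun t => G' (s, t)) t := by
      have : ∀ᶠ s' in 𝓝 s, (s', t) ∈ Ω :=
        (Continuous.continuousAt (f := fun s' : ℝ => (s', t)) (by fun_prop)).eventually_mem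
          (hΩ.mem_nhds h)
      filter_upwards [this] with s' hs'
      rw [iteratedDeriv_succ']
      apply EventuallyEq.iteratedDeriv_eq
      filter_upwards [hev s' t hs'] with t' ht'
      exact (hline G hG s' t' ht').deriv
    have e2 : iteratedDeriv (α + 1) (fun t => fderiv ℝ G (s, t) (1, 0)) t =
        iteratedDeriv α (fun t => fderiv ℝ G' (s, t) (1, 0)) t := by
      rw [iteratedDeriv_succ']
      apply EventuallyEq.iteratedDeriv_eq
      filter_upwards [hev s t h] with t' ht'
      have hH : ContDiffOn ℝ ∞ (fun p => fderiv ℝ G p (1, 0)) Ω := fun p hp =>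
        ((hat hG p hp).fderiv_top.clm_apply contDiffAt_const).contDiffWithinAt
      rw [(hline _ hH s t' ht').deriv]
      have hd := (hat hG _ ht').fderiv_top.differentiableAt_top
      have k : ∀ w : ℝ × ℝ, fderiv ℝ (fun p => fderiv ℝ G p w) (s, t') =
          (fderiv ℝ (fderiv ℝ G) (s, t')).flip w := fun w => by
        rw [fderiv_clm_apply hd (by fun_prop)]
        simp
      change fderiv ℝ (fun p => fderiv ℝ G p (1, 0)) (s, t') (0, 1) =
        fderiv ℝ (fun p => fderiv ℝ G p (0, 1)) (s, t') (1, 0)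
      rw [k, k]
      exact (hat hG _ ht').isSymm_top _ _
    rw [e2]
    exact (ih hG' h).congr_of_eventuallyEq e1

/-- In the Leibniz expansion at `0` only the terms that differentiate the factor `t` exactly once
survive. For `α = 0` the truncated index `α - 1` is harmless, being multiplied by `0`. Iteration
produces the descending factorials in the formulas for `J_β` and `Δ_β`. -/
theorem iteratedDeriv_id_smul {g : ℝ → E} (hg : ContDiffAt ℝ ∞ g 0) (α : ℕ) :
    iteratedDeriv α (fun t => t • g t) 0 = (α : ℝ) • iteratedDeriv (α - 1) g 0 := by
  induction α generalizing g with
  | zero => simp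
  | succ α ih =>
    have e : deriv (fun t => t • g t) =ᶠ[𝓝 0] fun t => g t + t • deriv g t := by
      have : ∀ᶠ t in 𝓝 (0 : ℝ), DifferentiableAt ℝ g t := by
        have h1 : ContDiffAt ℝ 1 g 0 := hg.of_le (WithTop.coe_le_coe.2 le_top)
        filter_upwards [h1.eventually (by simp)] with t ht
        exact ht.differentiableAt (by simp)
      filter_upwards [this] with t ht
      have h2 := (hasDerivAt_id t).smul ht.hasDerivAt
      have h3 : deriv (fun t => t • g t) t = _ := h2.deriv
      rw [h3]
      simp [add_comm]
    have hα : (α : WithTop ℕ∞) ≤ ∞ := by exact_mod_cast le_top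
    rw [iteratedDeriv_succ', e.iteratedDeriv_eq,
      iteratedDeriv_fun_add (hg.of_le hα) (ContDiffAt.of_le (f := fun t => t • deriv g t) (contDiffAt_id.smul hg.deriv_top) hα),
      ih hg.deriv_top, Nat.add_sub_cancel]
    cases α with
    | zero => simp
    | succ m =>
      rw [Nat.add_sub_cancel, ← iteratedDeriv_succ']
      push_cast
      module

theorem iteratedDeriv_pow_smul {g : ℝ → E} (hg : ContDiffAt ℝ ∞ g 0) (β α : ℕ) :
    iteratedDeriv α (fun t => t ^ β • g t) 0 =
      (α.descFactorial β : ℝ) • iteratedDeriv (α - β) g 0 := by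
  induction β generalizing α with
  | zero => simp
  | succ β ih =>
    have h : (fun t : ℝ => t ^ (β + 1) • g t) = fun t => t • (t ^ β • g t) := by
      funext t; rw [pow_succ', mul_smul]
    rw [h, iteratedDeriv_id_smul (g := fun t => t ^ β • g t)
      (ContDiffAt.smul (by fun_prop) hg), ih]
    cases α with
    | zero => simp
    | succ m =>
      rw [Nat.add_sub_cancel, Nat.succ_descFactorial_succ, Nat.succ_sub_succ]
      push_cast
      rw [mul_smul]

end ParametricDerivatives

/-! ### Prolongation of maps to jets, and its differential -/

section CurveJets

variable {n r : ℕ}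

/-- The derivatives of orders `0, …, r` at `0` of a curve in `ℝⁿ`. -/
noncomputable def curveJet (r : ℕ) (c : ℝ → Model n) : JetModel n r :=
  fun α => iteratedDeriv α c 0

theorem curveJet_polyCurve (a : JetModel n r) : curveJet r (polyCurve a) = a :=
  funext fun α => iteratedDeriv_polyCurve a α

/-- The prolongation of a map `ℝⁿ → ℝⁿ` to jets of order `r`. -/
noncomputable def prolong (r : ℕ) (φ : Model n → Model n) (a : JetModel n r) : JetModel n r :=
  curveJet r (φ ∘ polyCurve a)

theorem contDiffOn_prolong {φ : Model n → Model n} {S : Set (Model n)} (hS : IsOpen S)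
    (hφ : ContDiffOn ℝ ∞ φ S) : ContDiffOn ℝ ∞ (prolong r φ) {a | a 0 ∈ S} :=
  contDiffOn_iteratedDeriv_polyCurve hS hφ

/-- By the higher chain rule the jet of `φ ∘ c` depends only on the jet of `c`, so the polynomial
representative in `prolong` may be replaced by any smooth curve with the same jet. -/
theorem prolong_curveJet {φ : Model n → Model n} {S : Set (Model n)} (hS : IsOpen S)
    (hφ : ContDiffOn ℝ ∞ φ S) {c : ℝ → Model n} (hc : ContDiff ℝ ∞ c) (h0 : c 0 ∈ S) :
    prolong r φ (curveJet r c) = curveJet r (φ ∘ c) := by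
  funext α
  have hz : polyCurve (curveJet r c) 0 = c 0 := by
    rw [polyCurve_zero]; simp [curveJet]
  refine iteratedDeriv_comp_congr (r := r) (contDiff_polyCurve _).contDiffAt hc.contDiffAt ?_ ?_ α
    (Nat.le_of_lt_succ α.2)
  · rw [hz]; exact hφ.contDiffAt (hS.mem_nhds h0)
  · intro β hβ
    exact iteratedDeriv_polyCurve (curveJet r c) ⟨β, Nat.lt_succ_of_le hβ⟩

theorem curveJet_add_smul {c w : ℝ → Model n} (hc : ContDiff ℝ ∞ c) (hw : ContDiff ℝ ∞ w)
    (s : ℝ) : curveJet r (fun t => c t + s • w t) = curveJet r c + s • curveJet r w := by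
  funext α
  have hα : ((α : ℕ) : WithTop ℕ∞) ≤ ∞ := by exact_mod_cast le_top
  have h1 : ContDiffAt ℝ (α : ℕ) c 0 := hc.contDiffAt.of_le hα
  have h2 : ContDiffAt ℝ (α : ℕ) w 0 := hw.contDiffAt.of_le hα
  simp only [curveJet, Pi.add_apply, Pi.smul_apply]
  rw [iteratedDeriv_fun_add h1 (by fun_prop), iteratedDeriv_fun_const_smul]
  exact h2

/-- The jet of `c + s w` traces a line in the jet space. Differentiating the jet of `φ(c + s w)` in
`s`, under the `t`-derivatives, gives the formula. Naturality of the jet operations thereby reduces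
to properties of `Dφ(c(t))` for each single `t`. -/
theorem fderiv_prolong {φ : Model n → Model n} {S : Set (Model n)} (hS : IsOpen S)
    (hφ : ContDiffOn ℝ ∞ φ S) {c w : ℝ → Model n} (hc : ContDiff ℝ ∞ c) (hw : ContDiff ℝ ∞ w)
    (h0 : c 0 ∈ S) :
    fderiv ℝ (prolong r φ) (curveJet r c) (curveJet r w) =
      curveJet r (fun t => fderiv ℝ φ (c t) (w t)) := by
  have hd : DifferentiableAt ℝ (prolong r φ) (curveJet r c) := by
    refine ((contDiffOn_prolong hS hφ).contDiffAt ?_).differentiableAt_top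
    exact (hS.preimage (continuous_apply 0)).mem_nhds (by simpa [curveJet] using h0)
  have hl : HasDerivAt (fun s : ℝ => curveJet r c + s • curveJet r w) (curveJet r w) 0 := by
    simpa using ((hasDerivAt_id (0 : ℝ)).smul_const (curveJet r w)).const_add (curveJet r c)
  have h1 : HasDerivAt (fun s : ℝ => prolong r φ (curveJet r c + s • curveJet r w))
      (fderiv ℝ (prolong r φ) (curveJet r c) (curveJet r w)) 0 := by
    have hd' : HasFDerivAt (prolong r φ) (fderiv ℝ (prolong r φ) (curveJet r c))
        (curveJet r c + (0 : ℝ) • curveJet r w) := by simpa using hd.hasFDerivAt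
    exact hd'.comp_hasDerivAt (f := fun s : ℝ => curveJet r c + s • curveJet r w) 0 hl
  have hev : ∀ᶠ s in 𝓝 (0 : ℝ), c 0 + s • w 0 ∈ S := by
    refine (Continuous.continuousAt (f := fun s : ℝ => c 0 + s • w 0)
      (by fun_prop)).eventually_mem (hS.mem_nhds ?_)
    simpa using h0
  funext α
  let G : ℝ × ℝ → Model n := fun p => φ (c p.2 + p.1 • w p.2)
  have hin : ContDiff ℝ ∞ fun p : ℝ × ℝ => c p.2 + p.1 • w p.2 := by fun_prop
  have hΩ : IsOpen {p : ℝ × ℝ | c p.2 + p.1 • w p.2 ∈ S} := hS.preimage hin.continuous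
  have hG : ContDiffOn ℝ ∞ G {p : ℝ × ℝ | c p.2 + p.1 • w p.2 ∈ S} :=
    hφ.comp hin.contDiffOn fun p hp => hp
  have h2 := hasDerivAt_iteratedDeriv_param hΩ hG (α : ℕ) (s := 0) (t := 0) (by simpa using h0)
  have h3 : HasDerivAt (fun s : ℝ => prolong r φ (curveJet r c + s • curveJet r w) α)
      (iteratedDeriv α (fun t => fderiv ℝ G (0, t) (1, 0)) 0) 0 := by
    refine h2.congr_of_eventuallyEq ?_
    filter_upwards [hev] with s hs
    rw [← curveJet_add_smul hc hw, prolong_curveJet hS hφ (by fun_prop) hs]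
    rfl
  rw [((hasDerivAt_pi.1 h1 α)).unique h3]
  apply EventuallyEq.iteratedDeriv_eq
  have hev2 : ∀ᶠ t in 𝓝 (0 : ℝ), c t ∈ S :=
    hc.continuous.continuousAt.eventually_mem (hS.mem_nhds h0)
  filter_upwards [hev2] with t ht
  have h4 : HasFDerivAt φ (fderiv ℝ φ (c t)) (c t + (0 : ℝ) • w t) := by
    simpa using (hφ.contDiffAt (hS.mem_nhds ht)).differentiableAt_top.hasFDerivAt
  have h5 : HasDerivAt (fun s : ℝ => c t + s • w t) (w t) 0 := by
    simpa using ((hasDerivAt_id (0 : ℝ)).smul_const (w t)).const_add (c t)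
  have h6 := HasFDerivAt.comp_hasDerivAt (f := fun s : ℝ => c t + s • w t) 0 h4 h5
  have h7 : DifferentiableAt ℝ G (0, t) :=
    (hG.contDiffAt (hΩ.mem_nhds (by simpa using ht))).differentiableAt_top
  have h8 : HasDerivAt (fun s : ℝ => G (s, t)) (fderiv ℝ G (0, t) (1, 0)) 0 :=
    h7.hasFDerivAt.comp_hasDerivAt (f := fun s : ℝ => (s, t)) (0 : ℝ)
      ((hasDerivAt_id (0 : ℝ)).prodMk (hasDerivAt_const 0 t))
  exact h8.unique h6

/-- The vertical endomorphism `J_β` in natural coordinates. -/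
noncomputable def jetJ (r β : ℕ) : JetModel n r →L[ℝ] JetModel n r :=
  ContinuousLinearMap.pi fun α : Fin (r + 1) =>
    if β ≤ (α : ℕ) then ((α : ℕ).descFactorial β : ℝ) • ContinuousLinearMap.proj
      (R := ℝ) (φ := fun _ : Fin (r + 1) => Model n) ⟨(α : ℕ) - β, by omega⟩
    else 0

/-- The canonical vector field `Δ_β` in natural coordinates. -/
noncomputable def jetDelta (r β : ℕ) (a : JetModel n r) : JetModel n r := fun α =>
  if h : 1 ≤ β ∧ β ≤ (α : ℕ) then
    ((α : ℕ).descFactorial β : ℝ) • a ⟨(α : ℕ) - β + 1, by omega⟩ else 0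

/-- This gives `J_β` its intrinsic meaning, multiplication of a variation by `t^β`; the next lemma
does the same for `Δ_β`, the variation `t^β c'`. -/
theorem curveJet_pow_smul {g : ℝ → Model n} (hg : ContDiffAt ℝ ∞ g 0) (β : ℕ) :
    curveJet r (fun t => t ^ β • g t) = jetJ r β (curveJet r g) := by
  funext α
  simp only [curveJet, jetJ, ContinuousLinearMap.pi_apply]
  rw [iteratedDeriv_pow_smul hg]
  split_ifs with h
  · rfl
  · rw [Nat.descFactorial_of_lt (not_le.1 h)]; simp

theorem curveJet_pow_smul_deriv {g : ℝ → Model n} (hg : ContDiffAt ℝ ∞ g 0) {β : ℕ}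
    (hβ : 1 ≤ β) :
    curveJet r (fun t => t ^ β • deriv g t) = jetDelta r β (curveJet r g) := by
  funext α
  simp only [curveJet, jetDelta]
  rw [iteratedDeriv_pow_smul hg.deriv_top, ← iteratedDeriv_succ']
  split_ifs with h
  · rfl
  · rw [Nat.descFactorial_of_lt (by omega)]; simp

/-! ### Naturality of the vertical endomorphisms, the canonical fields and the shift -/

section Naturality

variable {φ : Model n → Model n} {S : Set (Model n)} {a : JetModel n r}

theorem contDiffAt_fderiv_polyCurve (hS : IsOpen S) (hφ : ContDiffOn ℝ ∞ φ S)
    (ha : a 0 ∈ S) {w : ℝ → Model n} (hw : ContDiff ℝ ∞ w) :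
    ContDiffAt ℝ ∞ (fun t => fderiv ℝ φ (polyCurve a t) (w t)) 0 := by
  have h : ContDiffAt ℝ ∞ (fderiv ℝ φ) (polyCurve a 0) := by
    rw [polyCurve_zero]; exact (hφ.contDiffAt (hS.mem_nhds ha)).fderiv_top
  exact (h.comp 0 (contDiff_polyCurve a).contDiffAt).clm_apply hw.contDiffAt

/-- `Dφ(c(t))` is linear for each `t`, so it commutes with multiplication of the variation by `t^β`.
-/
theorem fderiv_prolong_jetJ (hS : IsOpen S) (hφ : ContDiffOn ℝ ∞ φ S)
    (ha : a 0 ∈ S) (β : ℕ) (v : JetModel n r) :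
    fderiv ℝ (prolong r φ) a (jetJ r β v) = jetJ r β (fderiv ℝ (prolong r φ) a v) := by
  have ha' : polyCurve a 0 ∈ S := by rwa [polyCurve_zero]
  have hp := contDiff_polyCurve a
  have hv := contDiff_polyCurve v
  have h1 := fderiv_prolong (r := r) hS hφ hp
    (w := fun t => t ^ β • polyCurve v t) (by fun_prop) ha'
  have h2 := fderiv_prolong (r := r) hS hφ hp hv ha'
  rw [curveJet_pow_smul hv.contDiffAt, curveJet_polyCurve, curveJet_polyCurve] at h1
  rw [curveJet_polyCurve, curveJet_polyCurve] at h2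
  rw [h1, h2, ← curveJet_pow_smul (contDiffAt_fderiv_polyCurve hS hφ ha hv)]
  simp only [map_smul]

theorem deriv_comp_polyCurve (hS : IsOpen S) (hφ : ContDiffOn ℝ ∞ φ S)
    (ha : a 0 ∈ S) :
    deriv (φ ∘ polyCurve a) =ᶠ[𝓝 0]
      fun t => fderiv ℝ φ (polyCurve a t) (deriv (polyCurve a) t) := by
  have hp := contDiff_polyCurve a
  have hev : ∀ᶠ t in 𝓝 (0 : ℝ), polyCurve a t ∈ S :=
    hp.continuous.continuousAt.eventually_mem (hS.mem_nhds (by rwa [polyCurve_zero]))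
  filter_upwards [hev] with t ht
  exact ((hφ.contDiffAt (hS.mem_nhds ht)).differentiableAt_top.hasFDerivAt.comp_hasDerivAt t
    hp.contDiffAt.differentiableAt_top.hasDerivAt).deriv

/-- By the chain rule, `Dφ(c)` takes the variation `t^β c'` of `c` to the variation `t^β (φ ∘ c)'`
of `φ ∘ c`. -/
theorem fderiv_prolong_jetDelta (hS : IsOpen S) (hφ : ContDiffOn ℝ ∞ φ S)
    (ha : a 0 ∈ S) {β : ℕ} (hβ : 1 ≤ β) :
    fderiv ℝ (prolong r φ) a (jetDelta r β a) = jetDelta r β (prolong r φ a) := by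
  have ha' : polyCurve a 0 ∈ S := by rwa [polyCurve_zero]
  have hp := contDiff_polyCurve a
  have hdp : ContDiff ℝ ∞ (deriv (polyCurve a)) :=
    contDiff_iff_contDiffAt.2 fun t => hp.contDiffAt.deriv_top
  have h1 := fderiv_prolong (r := r) hS hφ hp
    (w := fun t => t ^ β • deriv (polyCurve a) t) (by fun_prop) ha'
  rw [curveJet_pow_smul_deriv hp.contDiffAt hβ, curveJet_polyCurve] at h1
  have h3 : ContDiffAt ℝ ∞ (φ ∘ polyCurve a) 0 :=
    (hφ.contDiffAt (hS.mem_nhds ha')).comp 0 hp.contDiffAt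
  rw [h1, prolong, ← curveJet_pow_smul_deriv h3 hβ]
  funext α
  apply EventuallyEq.iteratedDeriv_eq
  filter_upwards [deriv_comp_polyCurve hS hφ ha] with t ht
  rw [ht, map_smul]

/-- The shifted jet is the jet of the variation `c'`, which `Dφ(c)` takes to `(φ ∘ c)'`. This is the
naturality of the injection of `TʳQ` into the tangent bundle of a lower jet space. -/
theorem fderiv_prolong_shift (hS : IsOpen S) (hφ : ContDiffOn ℝ ∞ φ S)
    (ha : a 0 ∈ S) {s : ℕ} (h : s < r) (b : JetModel n s)
    (hb : b = fun α : Fin (s + 1) => a ⟨α, by omega⟩) :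
    fderiv ℝ (prolong s φ) b (fun α : Fin (s + 1) => a ⟨(α : ℕ) + 1, by omega⟩) =
      fun α : Fin (s + 1) => prolong r φ a ⟨(α : ℕ) + 1, by omega⟩ := by
  have ha' : polyCurve a 0 ∈ S := by rwa [polyCurve_zero]
  have hp := contDiff_polyCurve a
  have hdp : ContDiff ℝ ∞ (deriv (polyCurve a)) :=
    contDiff_iff_contDiffAt.2 fun t => hp.contDiffAt.deriv_top
  have h1 := fderiv_prolong (r := s) hS hφ hp hdp ha'
  have e1 : curveJet s (polyCurve a) = b := by
    rw [hb]; funext α; exact iteratedDeriv_polyCurve a ⟨α, by omega⟩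
  have e2 : curveJet s (deriv (polyCurve a)) = fun α : Fin (s + 1) => a ⟨(α : ℕ) + 1, by omega⟩ := by
    funext α
    rw [curveJet, ← iteratedDeriv_succ']
    exact iteratedDeriv_polyCurve a ⟨(α : ℕ) + 1, by omega⟩
  rw [e1, e2] at h1
  rw [h1]
  funext α
  change _ = iteratedDeriv ((α : ℕ) + 1) (φ ∘ polyCurve a) 0
  rw [iteratedDeriv_succ', curveJet]
  exact (deriv_comp_polyCurve hS hφ ha).symm.iteratedDeriv_eq _

end Naturality

end CurveJets

/-! ### The binomial identity behind the momenta -/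

section Combinatorics

/-- Induction on `γ` by Pascal's rule. The additional sum is `(γ+1+i).choose i` times the
alternating sum of row `γ + 1`, hence zero, and the other part is the previous case plus a vanishing
last term. -/
theorem sum_neg_one_pow_choose_mul_choose (i γ : ℕ) :
    ∑ j ∈ Finset.range (γ + 1),
      (-1 : ℤ) ^ j * ((γ + 1 + i).choose (i + 1 + j) * (i + j).choose i) = 1 := by
  induction γ with
  | zero => simp [Nat.add_comm]
  | succ γ ih =>
    have h1 : ∀ j, (γ + 1 + 1 + i).choose (i + 1 + j) =
        (γ + 1 + i).choose (i + j) + (γ + 1 + i).choose (i + 1 + j) := fun j => by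
      rw [show γ + 1 + 1 + i = (γ + 1 + i) + 1 by ring, show i + 1 + j = (i + j) + 1 by ring,
        Nat.choose_succ_succ]
    have h2 : ∀ j, (γ + 1 + i).choose (i + j) * (i + j).choose i =
        (γ + 1 + i).choose i * (γ + 1).choose j := fun j => by
      rcases le_or_gt (i + j) (γ + 1 + i) with h | h
      · rw [Nat.choose_mul (by omega)]
        congr 2 <;> omega
      · rw [Nat.choose_eq_zero_of_lt h, Nat.choose_eq_zero_of_lt (show γ + 1 < j by omega)]
        simp
    have h3 : ∑ j ∈ Finset.range (γ + 1 + 1),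
        (-1 : ℤ) ^ j * ((γ + 1 + i).choose (i + j) * (i + j).choose i) = 0 := by
      have : ∀ j, (-1 : ℤ) ^ j * ((γ + 1 + i).choose (i + j) * (i + j).choose i) =
          (γ + 1 + i).choose i * ((-1 : ℤ) ^ j * (γ + 1).choose j) := fun j => by
        have := h2 j
        zify at this
        rw [this]; ring
      simp_rw [this]
      rw [← Finset.mul_sum, Int.alternating_sum_range_choose_of_ne (by omega), mul_zero]
    simp_rw [h1]
    push_cast
    simp_rw [add_mul, mul_add]
    rw [Finset.sum_add_distrib, h3, zero_add, Finset.sum_range_succ]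
    rw [Nat.choose_eq_zero_of_lt (show γ + 1 + i < i + 1 + (γ + 1) by omega)]
    simpa using ih

variable {A : Type*} [AddCommGroup A] [Module ℝ A] (D : A →ₗ[ℝ] A)

/-- The operator `(f_γ) ↦ (D f_γ + f_{γ-1})`, by which a total derivative acts on the coefficients
of `∑ f_γ dq_γ`. -/
def seqD (f : ℕ → A) : ℕ → A
  | 0 => D (f 0)
  | γ + 1 => D (f (γ + 1)) + f γ

/-- `seqD` is the sum of `D`, applied to each term, and the index shift. These commute, so the
binomial theorem applies in the endomorphism ring of sequences. -/
theorem seqD_iterate (b : ℕ) (f : ℕ → A) (γ : ℕ) :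
    (seqD D)^[b] f γ = ∑ i ∈ Finset.range (b + 1), b.choose i •
      (if b - i ≤ γ then (D ^ i) (f (γ - (b - i))) else 0) := by
  let X : Module.End ℝ (ℕ → A) := LinearMap.pi fun γ => D ∘ₗ LinearMap.proj γ
  let Y : Module.End ℝ (ℕ → A) :=
    LinearMap.pi fun γ => if 1 ≤ γ then LinearMap.proj (γ - 1) else 0
  have hX : ∀ f γ, X f γ = D (f γ) := fun _ _ => rfl
  have hY : ∀ f γ, Y f γ = if 1 ≤ γ then f (γ - 1) else 0 := fun f γ => by
    change (if 1 ≤ γ then LinearMap.proj (γ - 1) else 0 : (ℕ → A) →ₗ[ℝ] A) f = _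
    split_ifs <;> rfl
  have hXY : ∀ f, seqD D f = (X + Y) f := fun f => by
    funext γ
    rw [LinearMap.add_apply, Pi.add_apply, hX, hY]
    cases γ <;> simp [seqD]
  have hcomm : Commute X Y := by
    refine LinearMap.ext fun f => funext fun γ => ?_
    change X (Y f) γ = Y (X f) γ
    rw [hX, hY, hY]
    split_ifs <;> simp [hX]
  have hXi : ∀ i f γ, (X ^ i) f γ = (D ^ i) (f γ) := fun i => by
    induction i with
    | zero => intro f γ; rfl
    | succ i ih => intro f γ; rw [pow_succ', pow_succ', Module.End.mul_apply, hX, ih]; rfl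
  have hYj : ∀ j f γ, (Y ^ j) f γ = if j ≤ γ then f (γ - j) else 0 := fun j => by
    induction j with
    | zero => intro f γ; simp
    | succ j ih =>
      intro f γ
      rw [pow_succ', Module.End.mul_apply, hY, ih]
      split_ifs <;> first | omega | rfl | skip
      congr 1; omega
  have hit : ∀ f, (seqD D)^[b] f = ((X + Y) ^ b) f := by
    intro f
    rw [Module.End.coe_pow, show seqD D = ⇑(X + Y) from funext hXY]
  rw [hit, hcomm.add_pow', LinearMap.sum_apply, Finset.sum_apply,
    Finset.Nat.sum_antidiagonal_eq_sum_range_succ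
      (fun i j => ((b.choose i • (X ^ i * Y ^ j) : Module.End ℝ (ℕ → A)) f γ))]
  refine Finset.sum_congr rfl fun i _ => ?_
  rw [LinearMap.smul_apply, Pi.smul_apply, Module.End.mul_apply, hXi, hYj]
  congr 1
  split_ifs <;> simp

/-- The momenta `p_γ = ∑_i (-1)^i D^i ℓ_{γ+1+i}`. -/
noncomputable def momentumSeq (k : ℕ) (ℓ : ℕ → A) (γ : ℕ) : A :=
  ∑ i ∈ Finset.range k, (-1 : ℝ) ^ i • (D ^ i) (ℓ (γ + 1 + i))

variable {k : ℕ} {ℓ : ℕ → A}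

theorem momentumSeq_of_le (hℓ : ∀ i, k < i → ℓ i = 0) {γ : ℕ} (h : k ≤ γ) :
    momentumSeq D k ℓ γ = 0 :=
  Finset.sum_eq_zero fun i _ => by rw [hℓ _ (by omega), map_zero, smul_zero]

/-- The terms `i ≥ 1` of `p_γ` are `-D` of the terms of `p_{γ+1}`. The one term of `p_{γ+1}` left
over contains `ℓ_{γ+1+k}`, which is zero. -/
theorem momentumSeq_eq (hk : 1 ≤ k) (hℓ : ∀ i, k < i → ℓ i = 0) (γ : ℕ) :
    momentumSeq D k ℓ γ = ℓ (γ + 1) - D (momentumSeq D k ℓ (γ + 1)) := by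
  obtain ⟨m, rfl⟩ : ∃ m, k = m + 1 := ⟨k - 1, by omega⟩
  rw [momentumSeq, Finset.sum_range_succ', momentumSeq, Finset.sum_range_succ, map_add, map_sum,
    hℓ (γ + 1 + 1 + m) (by omega)]
  have : ∀ i, (-1 : ℝ) ^ (i + 1) • (D ^ (i + 1)) (ℓ (γ + 1 + (i + 1))) =
      - D ((-1 : ℝ) ^ i • (D ^ i) (ℓ (γ + 1 + 1 + i))) := fun i => by
    rw [map_smul, pow_succ' D, Module.End.mul_apply, pow_succ, ← neg_smul,
      show γ + 1 + (i + 1) = γ + 1 + 1 + i by ring]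
    simp
  simp_rw [this]
  simp [sub_eq_neg_add]

/-- Expand each power by `seqD_iterate` and collect the coefficient of `D^i ℓ_{γ+1+i}`, writing `b =
i + j`. It is `(-1)^i` times the alternating sum of `sum_neg_one_pow_choose_mul_choose`. -/
theorem sum_seqD_iterate_eq_momentumSeq (hℓ : ∀ i, k < i → ℓ i = 0) (γ : ℕ) :
    ∑ b ∈ Finset.range k, ((-1 : ℝ) ^ b / (b + 1).factorial) •
      (seqD D)^[b] (fun γ => ((γ + (b + 1)).descFactorial (b + 1) : ℝ) • ℓ (γ + (b + 1))) γ =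
    momentumSeq D k ℓ γ := by
  let c : ℕ → ℕ → ℝ := fun i j =>
    (-1 : ℝ) ^ (i + j) * (((γ + 1 + i).choose (i + 1 + j) : ℝ) * ((i + j).choose i : ℝ))
  let g : ℕ → ℕ → A := fun i j => if j ≤ γ then c i j • (D ^ i) (ℓ (γ + 1 + i)) else 0
  have h1 : ∀ b ∈ Finset.range k, ((-1 : ℝ) ^ b / (b + 1).factorial) •
      (seqD D)^[b] (fun γ => ((γ + (b + 1)).descFactorial (b + 1) : ℝ) • ℓ (γ + (b + 1))) γ =
      ∑ i ∈ Finset.range (b + 1), g i (b - i) := by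
    intro b _
    rw [seqD_iterate, Finset.smul_sum]
    refine Finset.sum_congr rfl fun i hi => ?_
    have hib : i ≤ b := Nat.le_of_lt_succ (Finset.mem_range.1 hi)
    simp only [g]
    split_ifs with h
    · have e : γ - (b - i) + (b + 1) = γ + 1 + i := by omega
      rw [e, map_smul, ← Nat.cast_smul_eq_nsmul ℝ, smul_smul, smul_smul]
      congr 1
      -- Dividing the descending factorial by `(b + 1)!` leaves the binomial coefficient
      -- `(γ+1+i).choose (b+1)`.
      simp only [c]
      rw [show i + 1 + (b - i) = b + 1 by omega, show i + (b - i) = b by omega,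
        Nat.descFactorial_eq_factorial_mul_choose]
      have : ((b + 1).factorial : ℝ) ≠ 0 := by positivity
      push_cast
      field_simp
    · simp
  rw [Finset.sum_congr rfl h1, Finset.sum_range_diag_flip, momentumSeq]
  refine Finset.sum_congr rfl fun i hi => ?_
  rcases le_or_gt (γ + 1 + i) k with h | h
  -- In this case `γ + 1 ≤ k - i`, and the terms with `j > γ` are zero, so the sum runs exactly over
  -- `j ≤ γ`, as the identity requires.
  · have h2 : ∑ j ∈ Finset.range (k - i), g i j = ∑ j ∈ Finset.range (γ + 1), g i j := by
      symm
      refine Finset.sum_subset (Finset.range_mono (by omega)) fun j _ hj => ?_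
      rw [Finset.mem_range] at hj
      exact if_neg (by omega)
    have h3 : ∀ j ∈ Finset.range (γ + 1), g i j = c i j • (D ^ i) (ℓ (γ + 1 + i)) :=
      fun j hj => if_pos (Nat.le_of_lt_succ (Finset.mem_range.1 hj))
    rw [h2, Finset.sum_congr rfl h3, ← Finset.sum_smul]
    congr 1
    have h4 := congrArg (fun m : ℤ => (m : ℝ)) (sum_neg_one_pow_choose_mul_choose i γ)
    push_cast at h4
    simp only [c, pow_add, mul_assoc]
    rw [← Finset.mul_sum, h4, mul_one]
  · rw [hℓ _ h, map_zero, smul_zero]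
    refine Finset.sum_eq_zero fun j _ => ?_
    simp only [g]
    rw [hℓ _ h]
    simp

/-- Each application of `seqD` enlarges the support of a sequence by at most one index. -/
theorem seqD_iterate_of_le {m : ℕ} {f : ℕ → A} (hf : ∀ i, m ≤ i → f i = 0) (b : ℕ) :
    ∀ i, m + b ≤ i → (seqD D)^[b] f i = 0 := by
  induction b with
  | zero => exact fun i hi => hf i hi
  | succ b ih =>
    intro i hi
    rw [Function.iterate_succ_apply']
    cases i with
    | zero => omega
    | succ i => simp [seqD, ih i (by omega), ih (i + 1) (by omega)]

end Combinatorics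

/-! ### Truncation and shift of jet coordinates -/

section CoordinateMaps

variable {n : ℕ}

/-- The coordinate `q_i` of a jet, or `0` if `i > r`. -/
noncomputable def ev {r : ℕ} (i : ℕ) : JetModel n r →L[ℝ] Model n :=
  if h : i < r + 1 then ContinuousLinearMap.proj (R := ℝ) (φ := fun _ : Fin (r + 1) => Model n) ⟨i, h⟩
  else 0

theorem ev_of_lt {r i : ℕ} (h : i < r + 1) (a : JetModel n r) : ev i a = a ⟨i, h⟩ := by
  rw [ev, dif_pos h]; rfl

theorem ev_of_le {r i : ℕ} (h : r + 1 ≤ i) (a : JetModel n r) : ev i a = 0 := by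
  rw [ev, dif_neg (by omega)]; rfl

theorem ev_fin {r : ℕ} (a : JetModel n r) (α : Fin (r + 1)) : ev (α : ℕ) a = a α :=
  ev_of_lt α.2 a

/-- Truncation of jets, or their extension by zero. -/
noncomputable def tr (r s : ℕ) : JetModel n r →L[ℝ] JetModel n s :=
  ContinuousLinearMap.pi fun α : Fin (s + 1) => ev (α : ℕ)

/-- The shift `q_i ↦ q_{i+1}`. -/
noncomputable def sh (r s : ℕ) : JetModel n r →L[ℝ] JetModel n s :=
  ContinuousLinearMap.pi fun α : Fin (s + 1) => ev ((α : ℕ) + 1)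

theorem tr_apply (r s : ℕ) (a : JetModel n r) (α : Fin (s + 1)) : tr r s a α = ev (α : ℕ) a := rfl

theorem sh_apply (r s : ℕ) (a : JetModel n r) (α : Fin (s + 1)) :
    sh r s a α = ev ((α : ℕ) + 1) a := rfl

theorem ev_tr {r s i : ℕ} (h : i ≤ s) (a : JetModel n r) : ev i (tr r s a) = ev i a := by
  rw [ev_of_lt (Nat.lt_succ_of_le h)]; rfl

theorem ev_sh {r s i : ℕ} (h : i ≤ s) (a : JetModel n r) : ev i (sh r s a) = ev (i + 1) a := by
  rw [ev_of_lt (Nat.lt_succ_of_le h)]; rfl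

theorem jet_ext {r : ℕ} {a b : JetModel n r} (h : ∀ i ≤ r, ev i a = ev i b) : a = b := by
  funext α
  rw [← ev_fin a, ← ev_fin b]
  exact h _ (Nat.le_of_lt_succ α.2)

/-- The inclusion of the `i`-th coordinate. -/
noncomputable def jetSingle (r i : ℕ) : Model n →L[ℝ] JetModel n r :=
  ContinuousLinearMap.pi fun α : Fin (r + 1) =>
    if (α : ℕ) = i then ContinuousLinearMap.id ℝ (Model n) else 0

theorem ev_jetSingle {r i j : ℕ} (hj : j ≤ r) (u : Model n) :
    ev j (jetSingle r i u) = if j = i then u else 0 := by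
  rw [ev_of_lt (Nat.lt_succ_of_le hj), jetSingle, ContinuousLinearMap.pi_apply]
  split_ifs <;> rfl

theorem sum_jetSingle_ev {r : ℕ} (a : JetModel n r) :
    ∑ i ∈ Finset.range (r + 1), jetSingle r i (ev i a) = a := by
  refine jet_ext fun j hj => ?_
  rw [map_sum, Finset.sum_congr rfl fun i _ => ev_jetSingle hj _]
  simp [Nat.lt_succ_of_le hj]

end CoordinateMaps

/-- The model space of `TʳQ × ℝ`. -/
abbrev ExtModel (n r : ℕ) := JetModel n r × ℝ

/-! ### Smooth functions on an open set as a vector space -/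

section SmoothFunctions

variable {E G : Type*} [NormedAddCommGroup E] [NormedSpace ℝ E]
  [NormedAddCommGroup G] [NormedSpace ℝ G]

/-- The functions that are smooth on `O` and vanish outside `O`. -/
def smoothFun (O : Set E) (G : Type*) [NormedAddCommGroup G] [NormedSpace ℝ G] :
    Submodule ℝ (E → G) where
  carrier := {f | ContDiffOn ℝ ∞ f O ∧ ∀ x ∉ O, f x = 0}
  add_mem' hf hg := ⟨hf.1.add hg.1, fun x hx => by simp [hf.2 x hx, hg.2 x hx]⟩
  zero_mem' := ⟨contDiffOn_const, fun _ _ => rfl⟩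
  smul_mem' c f hf := ⟨contDiffOn_const.smul hf.1, fun x hx => by simp [hf.2 x hx]⟩

variable {O : Set E}

open Classical in
/-- The extension by zero of a function that is smooth on `O`. -/
noncomputable def smoothFun.mk (f : E → G) (hf : ContDiffOn ℝ ∞ f O) : smoothFun O G :=
  ⟨O.indicator f, hf.congr fun _ hx => indicator_of_mem hx f,
    fun _ hx => indicator_of_notMem hx f⟩

theorem smoothFun.mk_apply {f : E → G} (hf : ContDiffOn ℝ ∞ f O) {x : E} (hx : x ∈ O) :
    (smoothFun.mk f hf).1 x = f x := indicator_of_mem hx f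

theorem smoothFun.ext {f g : smoothFun O G} (h : ∀ x ∈ O, f.1 x = g.1 x) : f = g := by
  refine Subtype.ext (funext fun x => ?_)
  by_cases hx : x ∈ O
  · exact h x hx
  · rw [f.2.2 x hx, g.2.2 x hx]

theorem smoothFun.contDiffAt (hO : IsOpen O) (f : smoothFun O G) {x : E} (hx : x ∈ O) :
    ContDiffAt ℝ ∞ f.1 x := f.2.1.contDiffAt (hO.mem_nhds hx)

theorem smoothFun.hasFDerivAt (hO : IsOpen O) (f : smoothFun O G) {x : E} (hx : x ∈ O) :
    HasFDerivAt f.1 (fderiv ℝ f.1 x) x := (smoothFun.contDiffAt hO f hx).differentiableAt_top.hasFDerivAt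

theorem smoothFun.contDiffOn_fderiv (hO : IsOpen O) (f : smoothFun O G) :
    ContDiffOn ℝ ∞ (fderiv ℝ f.1) O := fun _ hx =>
  (smoothFun.contDiffAt hO f hx).fderiv_top.contDiffWithinAt

theorem smoothFun.coe_sum {ι : Type*} (s : Finset ι) (f : ι → smoothFun O G) (x : E) :
    (∑ i ∈ s, f i).1 x = ∑ i ∈ s, (f i).1 x := by
  rw [AddSubmonoidClass.coe_finsetSum, Finset.sum_apply]

theorem hasDerivAt_line {f : E → G} {x : E} (hf : DifferentiableAt ℝ f x) (v : E) :
    HasDerivAt (fun t : ℝ => f (x + t • v)) (fderiv ℝ f x v) 0 := by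
  have h1 : HasDerivAt (fun t : ℝ => x + t • v) v 0 := by
    simpa using ((hasDerivAt_id (0 : ℝ)).smul_const v).const_add x
  have h2 : HasFDerivAt f (fderiv ℝ f x) (x + (0 : ℝ) • v) := by simpa using hf.hasFDerivAt
  exact h2.comp_hasDerivAt (f := fun t : ℝ => x + t • v) 0 h1

theorem fderiv_apply_eq_of_hasDerivAt_line {f : E → G} {x : E} (hf : DifferentiableAt ℝ f x)
    {v : E} {g : ℝ → G} {g' : G} (hg : HasDerivAt g g' 0)
    (h : (fun t : ℝ => f (x + t • v)) =ᶠ[𝓝 0] g) : fderiv ℝ f x v = g' :=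
  (hasDerivAt_line hf v).unique (hg.congr_of_eventuallyEq h)

end SmoothFunctions

/-! ### Functions of jets of bounded order -/

section Dependence

variable {n N : ℕ} {G : Type*}

/-- The coordinates `q_0, …, q_s, z` of `x` and `y` agree. -/
def AgreeUpTo (s : ℕ) (x y : ExtModel n N) : Prop :=
  (∀ i ≤ s, ev i x.1 = ev i y.1) ∧ x.2 = y.2

/-- The function `f` depends only on the coordinates `q_0, …, q_s, z`. -/
def DependsUpTo (s : ℕ) (f : ExtModel n N → G) : Prop :=
  ∀ x y, AgreeUpTo s x y → f x = f y

theorem AgreeUpTo.mono {s t : ℕ} (h : s ≤ t) {x y : ExtModel n N} (hxy : AgreeUpTo t x y) :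
    AgreeUpTo s x y := ⟨fun i hi => hxy.1 i (hi.trans h), hxy.2⟩

theorem AgreeUpTo.add {s : ℕ} {x y u v : ExtModel n N} (h : AgreeUpTo s x y)
    (h' : AgreeUpTo s u v) : AgreeUpTo s (x + u) (y + v) :=
  ⟨fun i hi => by simp [h.1 i hi, h'.1 i hi], by simp [h.2, h'.2]⟩

theorem AgreeUpTo.smul {s : ℕ} {x y : ExtModel n N} (h : AgreeUpTo s x y) (c : ℝ) :
    AgreeUpTo s (c • x) (c • y) :=
  ⟨fun i hi => by simp [h.1 i hi], by simp [h.2]⟩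

theorem AgreeUpTo.refl (s : ℕ) (x : ExtModel n N) : AgreeUpTo s x x := ⟨fun _ _ => rfl, rfl⟩

variable [NormedAddCommGroup G] [NormedSpace ℝ G]

/-- Such an `f` is invariant under translation by `y - x`, and therefore so is its derivative. -/
theorem DependsUpTo.fderiv_point {s : ℕ} {f : ExtModel n N → G} (hf : DependsUpTo s f)
    {x y : ExtModel n N} (h : AgreeUpTo s x y) : fderiv ℝ f x = fderiv ℝ f y := by
  have : (fun w => f (w + (y - x))) = f := funext fun w => hf _ _ <| by
    have h2 : AgreeUpTo s (w + (y - x)) (w + 0) :=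
      (AgreeUpTo.refl s w).add ⟨fun i hi => by simp [h.1 i hi], by simp [h.2]⟩
    simpa using h2
  conv_lhs => rw [← this]
  rw [fderiv_comp_add_right]
  simp

theorem DependsUpTo.fderiv_dir {s : ℕ} {f : ExtModel n N → G} (hf : DependsUpTo s f)
    (x : ExtModel n N) {v w : ExtModel n N} (h : AgreeUpTo s v w) :
    fderiv ℝ f x v = fderiv ℝ f x w := by
  by_cases hd : DifferentiableAt ℝ f x
  · refine fderiv_apply_eq_of_hasDerivAt_line hd (hasDerivAt_line hd w) (.of_forall fun t => ?_)
    exact hf _ _ ((AgreeUpTo.refl s x).add (h.smul t))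
  · rw [fderiv_zero_of_not_differentiableAt hd]; rfl

/-- The jets whose base point lies in `T`. -/
def jetDomain (n N : ℕ) (T : Set (Model n)) : Set (ExtModel n N) := {x | x.1 0 ∈ T}

theorem isOpen_jetDomain {T : Set (Model n)} (hT : IsOpen T) : IsOpen (jetDomain n N T) :=
  hT.preimage ((continuous_apply 0).comp continuous_fst)

theorem ev_zero (a : JetModel n N) : ev 0 a = a 0 := ev_of_lt (Nat.succ_pos N) a

theorem AgreeUpTo.mem_jetDomain_iff {s : ℕ} {x y : ExtModel n N} (h : AgreeUpTo s x y)
    (T : Set (Model n)) : x ∈ jetDomain n N T ↔ y ∈ jetDomain n N T := by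
  have := h.1 0 (Nat.zero_le _)
  rw [ev_zero, ev_zero] at this
  change x.1 0 ∈ T ↔ y.1 0 ∈ T
  rw [this]

theorem DependsUpTo.smoothFun_mk {T : Set (Model n)} {s : ℕ} {f : ExtModel n N → G}
    {hf : ContDiffOn ℝ ∞ f (jetDomain n N T)} (h : DependsUpTo s f) :
    DependsUpTo s (smoothFun.mk f hf).1 := by
  intro x y hxy
  by_cases hx : x ∈ jetDomain n N T
  · rw [smoothFun.mk_apply hf hx, smoothFun.mk_apply hf ((hxy.mem_jetDomain_iff T).1 hx), h x y hxy]
  · rw [(smoothFun.mk f hf).2.2 x hx,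
      (smoothFun.mk f hf).2.2 y fun hy => hx ((hxy.mem_jetDomain_iff T).2 hy)]

end Dependence

/-! ### The Lagrangian total derivative in coordinates -/

section TotalDerivative

variable {n N : ℕ} {T : Set (Model n)} (hT : IsOpen T) (Λ : smoothFun (jetDomain n N T) ℝ)
  {G : Type*} [NormedAddCommGroup G] [NormedSpace ℝ G]

/-- The vector `q₁ ∂/∂q₀ + … + q_N ∂/∂q_{N-1} + Λ ∂/∂z`. -/
noncomputable def totalField (x : ExtModel n N) : ExtModel n N := (sh N N x.1, Λ.1 x)

/-- `∂Λ/∂z`. -/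
noncomputable def dzCoord (x : ExtModel n N) : ℝ := fderiv ℝ Λ.1 x (0, 1)

theorem contDiffOn_totalField : ContDiffOn ℝ ∞ (totalField Λ) (jetDomain n N T) :=
  ((sh N N).contDiff.comp contDiff_fst).contDiffOn.prodMk Λ.2.1

theorem contDiffOn_dzCoord (hT : IsOpen T) (Λ : smoothFun (jetDomain n N T) ℝ) :
    ContDiffOn ℝ ∞ (dzCoord Λ) (jetDomain n N T) :=
  (smoothFun.contDiffOn_fderiv (isOpen_jetDomain hT) Λ).clm_apply contDiffOn_const

theorem contDiffOn_totalD (hT : IsOpen T) (Λ : smoothFun (jetDomain n N T) ℝ)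
    (f : smoothFun (jetDomain n N T) G) :
    ContDiffOn ℝ ∞ (fun x => fderiv ℝ f.1 x (totalField Λ x) - dzCoord Λ x • f.1 x)
      (jetDomain n N T) :=
  ((smoothFun.contDiffOn_fderiv (isOpen_jetDomain hT) f).clm_apply (contDiffOn_totalField Λ)).sub
    ((contDiffOn_dzCoord hT Λ).smul f.2.1)

/-- The Lagrangian total derivative in natural coordinates. -/
noncomputable def totalD : smoothFun (jetDomain n N T) G →ₗ[ℝ] smoothFun (jetDomain n N T) G where
  toFun f := smoothFun.mk _ (contDiffOn_totalD hT Λ f)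
  map_add' f g := smoothFun.ext fun x hx => by
    have hf := smoothFun.hasFDerivAt (isOpen_jetDomain hT) f hx
    have hg := smoothFun.hasFDerivAt (isOpen_jetDomain hT) g hx
    have e : (f + g).1 = f.1 + g.1 := rfl
    change _ = (smoothFun.mk _ (contDiffOn_totalD hT Λ f)).1 x +
      (smoothFun.mk _ (contDiffOn_totalD hT Λ g)).1 x
    rw [smoothFun.mk_apply _ hx, smoothFun.mk_apply _ hx, smoothFun.mk_apply _ hx, e,
      (hf.add hg).fderiv]
    simp only [add_apply, Pi.add_apply, smul_add]
    abel
  map_smul' c f := smoothFun.ext fun x hx => by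
    have hf := smoothFun.hasFDerivAt (isOpen_jetDomain hT) f hx
    have e : (c • f).1 = c • f.1 := rfl
    change _ = c • (smoothFun.mk _ (contDiffOn_totalD hT Λ f)).1 x
    rw [smoothFun.mk_apply _ hx, smoothFun.mk_apply _ hx, e, (hf.const_smul c).fderiv, smul_sub,
      smul_comm c]
    rfl

theorem totalD_apply (f : smoothFun (jetDomain n N T) G) {x : ExtModel n N}
    (hx : x ∈ jetDomain n N T) : (totalD hT Λ f).1 x =
      fderiv ℝ f.1 x (totalField Λ x) - dzCoord Λ x • f.1 x :=
  smoothFun.mk_apply (contDiffOn_totalD hT Λ f) hx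

theorem AgreeUpTo.totalField {s k : ℕ} (hΛ : DependsUpTo k Λ.1) (hks : k ≤ s + 1)
    {x y : ExtModel n N} (h : AgreeUpTo (s + 1) x y) :
    AgreeUpTo s (totalField Λ x) (totalField Λ y) := by
  refine ⟨fun i hi => ?_, hΛ x y (h.mono hks)⟩
  rcases le_or_gt i N with hN | hN
  · change ev i (sh N N x.1) = ev i (sh N N y.1)
    rw [ev_sh hN, ev_sh hN, h.1 (i + 1) (by omega)]
  · rw [ev_of_le hN, ev_of_le hN]

/-- The differential of a function of order `s` sees the total field only through `q_1, …, q_{s+1}`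
and `Λ`, and `Λ` has order `k ≤ s + 1`. This bookkeeping of orders allows `D` to be an endomorphism
of one fixed space of functions of `(q_0, …, q_N, z)`. -/
theorem DependsUpTo.totalD {s k : ℕ} (hΛ : DependsUpTo k Λ.1) (hks : k ≤ s + 1)
    {f : smoothFun (jetDomain n N T) G} (hf : DependsUpTo s f.1) :
    DependsUpTo (s + 1) (totalD hT Λ f).1 := by
  refine DependsUpTo.smoothFun_mk (hf := contDiffOn_totalD hT Λ f) fun x y h => ?_
  have h1 := hf.fderiv_point (h.mono s.le_succ)
  have h2 : dzCoord Λ x = dzCoord Λ y := by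
    rw [dzCoord, dzCoord, hΛ.fderiv_point (h.mono hks)]
  beta_reduce
  rw [h1, hf.fderiv_dir y (h.totalField Λ hΛ hks), h2, hf x y (h.mono s.le_succ)]

/-- The partial derivative `∂f/∂q_i`. -/
noncomputable def partialQ (hT : IsOpen T) (f : smoothFun (jetDomain n N T) ℝ) (i : ℕ) :
    smoothFun (jetDomain n N T) (Model n →L[ℝ] ℝ) :=
  smoothFun.mk (fun x => (fderiv ℝ f.1 x).comp
    ((ContinuousLinearMap.inl ℝ (JetModel n N) ℝ).comp (jetSingle N i)))
    ((smoothFun.contDiffOn_fderiv (isOpen_jetDomain hT) f).clm_comp contDiffOn_const)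

theorem partialQ_apply (f : smoothFun (jetDomain n N T) ℝ) (i : ℕ) {x : ExtModel n N}
    (hx : x ∈ jetDomain n N T) (u : Model n) :
    (partialQ hT f i).1 x u = fderiv ℝ f.1 x (jetSingle N i u, 0) := by
  rw [partialQ, smoothFun.mk_apply _ hx]; rfl

theorem agreeUpTo_jetSingle {s i : ℕ} (h : s < i) (u : Model n) :
    AgreeUpTo s ((jetSingle N i u, 0) : ExtModel n N) 0 := by
  refine ⟨fun j hj => ?_, rfl⟩
  rcases le_or_gt j N with hN | hN
  · rw [ev_jetSingle hN, if_neg (by omega)]; simp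
  · rw [ev_of_le hN, ev_of_le hN]

theorem partialQ_eq_zero {k : ℕ} (hΛ : DependsUpTo k Λ.1) {i : ℕ} (hi : k < i) :
    partialQ hT Λ i = 0 :=
  smoothFun.ext fun x hx => ContinuousLinearMap.ext fun u => by
    rw [partialQ_apply hT Λ i hx, hΛ.fderiv_dir x (agreeUpTo_jetSingle hi u), map_zero]
    rfl

theorem DependsUpTo.partialQ {k : ℕ} (hΛ : DependsUpTo k Λ.1) (i : ℕ) :
    DependsUpTo k (partialQ hT Λ i).1 :=
  DependsUpTo.smoothFun_mk fun x y h => by rw [hΛ.fderiv_point h]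

theorem fderiv_eq_sum_partialQ {k : ℕ} (hkN : k ≤ N) (hΛ : DependsUpTo k Λ.1) {x : ExtModel n N}
    (hx : x ∈ jetDomain n N T) (v : ExtModel n N) :
    fderiv ℝ Λ.1 x v =
      ∑ i ∈ Finset.range (k + 1), (partialQ hT Λ i).1 x (ev i v.1) + dzCoord Λ x * v.2 := by
  have h1 : v = (v.1, 0) + v.2 • ((0, 1) : ExtModel n N) := by ext1 <;> simp
  have h2 : ((v.1, 0) : ExtModel n N) =
      ∑ i ∈ Finset.range (N + 1), (jetSingle N i (ev i v.1), 0) := by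
    ext1
    · rw [Prod.fst_sum]; exact (sum_jetSingle_ev v.1).symm
    · rw [Prod.snd_sum]; simp
  conv_lhs => rw [h1]
  rw [map_add, map_smul, h2, map_sum, smul_eq_mul, mul_comm]
  congr 1
  symm
  refine (Finset.sum_subset (Finset.range_mono (Nat.succ_le_succ hkN)) fun i _ hi => ?_).trans
    (Finset.sum_congr rfl fun i _ => partialQ_apply hT Λ i hx _)
  rw [Finset.mem_range, not_lt] at hi
  rw [partialQ_eq_zero hT Λ hΛ (by omega)]
  rfl

end TotalDerivative

/-! ### The generalized momenta and their triangular dependence on the top coordinates -/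

section Momenta

variable {n N k : ℕ} {T : Set (Model n)} (hT : IsOpen T) (Λ : smoothFun (jetDomain n N T) ℝ)

/-- The generalized momenta `p_i = ∑_j (-1)^j D^j (∂Λ/∂q_{i+1+j})`. -/
noncomputable def momentum (k : ℕ) (i : ℕ) : smoothFun (jetDomain n N T) (Model n →L[ℝ] ℝ) :=
  momentumSeq (totalD hT Λ) k (partialQ hT Λ) i

theorem momentum_of_le (hΛ : DependsUpTo k Λ.1) {i : ℕ} (h : k ≤ i) : momentum hT Λ k i = 0 :=
  momentumSeq_of_le _ (fun _ hi => partialQ_eq_zero hT Λ hΛ hi) h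

theorem momentum_eq (hk : 1 ≤ k) (hΛ : DependsUpTo k Λ.1) (i : ℕ) :
    momentum hT Λ k i = partialQ hT Λ (i + 1) - totalD hT Λ (momentum hT Λ k (i + 1)) :=
  momentumSeq_eq _ hk (fun _ hi => partialQ_eq_zero hT Λ hΛ hi) i

theorem momentum_last (hk : 1 ≤ k) (hΛ : DependsUpTo k Λ.1) :
    momentum hT Λ k (k - 1) = partialQ hT Λ k := by
  rw [momentum_eq hT Λ hk hΛ, momentum_of_le hT Λ hΛ (by omega), LinearMap.map_zero,
    Nat.sub_add_cancel hk]
  exact sub_zero (partialQ hT Λ k)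

theorem dependsUpTo_momentum (hk : 1 ≤ k) (hΛ : DependsUpTo k Λ.1) (m : ℕ) :
    ∀ i, i + m = k - 1 → DependsUpTo (k + m) (momentum hT Λ k i).1 := by
  induction m with
  | zero =>
    intro i hi
    obtain rfl : i = k - 1 := by omega
    rw [momentum_last hT Λ hk hΛ]
    exact hΛ.partialQ hT Λ k
  | succ m ih =>
    intro i hi x y h
    rw [momentum_eq hT Λ hk hΛ]
    have h1 := (hΛ.partialQ hT Λ (i + 1)) x y (h.mono (by omega))
    have h2 := (DependsUpTo.totalD hT Λ hΛ (by omega) (ih (i + 1) (by omega))) x y h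
    change (partialQ hT Λ (i + 1)).1 x - _ = (partialQ hT Λ (i + 1)).1 y - _
    rw [h1, h2]

/-- `D f` is affine in `q_{s+1}`: this coordinate enters only as the `q_s`-component of the total
field, with coefficient `∂f/∂q_s`. The bound `s < N` ensures that `q_{s+1}` is among the
coordinates. -/
theorem fderiv_totalD_top {G : Type*} [NormedAddCommGroup G] [NormedSpace ℝ G] {s : ℕ}
    (hΛ : DependsUpTo k Λ.1) (hks : k ≤ s) (hsN : s < N) {f : smoothFun (jetDomain n N T) G}
    (hf : DependsUpTo s f.1) {x : ExtModel n N} (hx : x ∈ jetDomain n N T) (u : Model n) :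
    fderiv ℝ (totalD hT Λ f).1 x (jetSingle N (s + 1) u, 0) =
      fderiv ℝ f.1 x (jetSingle N s u, 0) := by
  have hO := isOpen_jetDomain (N := N) hT
  set w : ExtModel n N := (jetSingle N (s + 1) u, 0)
  have hw : AgreeUpTo s w 0 := agreeUpTo_jetSingle s.lt_succ_self u
  have hline : ∀ t : ℝ, AgreeUpTo s (x + t • w) x := fun t => by
    simpa using (AgreeUpTo.refl s x).add (hw.smul t)
  have hshift : ∀ t : ℝ, totalField Λ (x + t • w) =
      totalField Λ x + t • ((jetSingle N s u, 0) : ExtModel n N) := fun t => by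
    have h1 : Λ.1 (x + t • w) = Λ.1 x := hΛ _ _ ((hline t).mono hks)
    have h2 : sh N N (jetSingle N (s + 1) u) = jetSingle N s u := by
      refine jet_ext fun i hi => ?_
      rw [ev_sh hi, ev_jetSingle hi]
      rcases Nat.lt_or_ge i N with h | h
      · rw [ev_jetSingle h]; simp
      · rw [ev_of_le (by omega), if_neg (by omega)]
    ext1
    · simp [totalField, w, h2]
    · simp [totalField, h1]
  have hval : ∀ t : ℝ, (totalD hT Λ f).1 (x + t • w) =
      (totalD hT Λ f).1 x + t • fderiv ℝ f.1 x (jetSingle N s u, 0) := fun t => by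
    have hm : x + t • w ∈ jetDomain n N T := ((hline t).mem_jetDomain_iff T).2 hx
    have h3 : dzCoord Λ (x + t • w) = dzCoord Λ x := by
      rw [dzCoord, dzCoord, hΛ.fderiv_point ((hline t).mono hks)]
    rw [totalD_apply hT Λ f hm, totalD_apply hT Λ f hx, hf.fderiv_point (hline t), hshift, h3,
      hf _ _ (hline t), map_add, map_smul]
    abel
  refine fderiv_apply_eq_of_hasDerivAt_line
    (smoothFun.contDiffAt hO _ hx).differentiableAt_top ?_ (.of_forall hval)
  simpa using ((hasDerivAt_id (0 : ℝ)).smul_const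
    (fderiv ℝ f.1 x (jetSingle N s u, 0))).const_add ((totalD hT Λ f).1 x)

/-- Each step `p_i = ∂Λ/∂q_{i+1} - D p_{i+1}` raises the top order by one and changes the sign of
the top derivative, starting from `p_{k-1} = ∂Λ/∂q_k`. Hence the derivative of `p_{k-1-m}` in
`q_{k+m}` is the Hessian up to sign, which makes regularity usable. -/
theorem fderiv_momentum_top (hk : 1 ≤ k) (hN : N + 1 = 2 * k) (hΛ : DependsUpTo k Λ.1)
    {x : ExtModel n N} (hx : x ∈ jetDomain n N T) (u : Model n) (m : ℕ) :
    ∀ i, i + m = k - 1 → fderiv ℝ (momentum hT Λ k i).1 x (jetSingle N (k + m) u, 0) =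
      (-1 : ℝ) ^ m • fderiv ℝ (partialQ hT Λ k).1 x (jetSingle N k u, 0) := by
  have hO := isOpen_jetDomain (N := N) hT
  induction m with
  | zero =>
    intro i hi
    obtain rfl : i = k - 1 := by omega
    rw [momentum_last hT Λ hk hΛ]; simp
  | succ m ih =>
    intro i hi
    have e : (momentum hT Λ k i).1 =
        (partialQ hT Λ (i + 1)).1 - (totalD hT Λ (momentum hT Λ k (i + 1))).1 := by
      rw [momentum_eq hT Λ hk hΛ]; rfl
    rw [e, ((smoothFun.hasFDerivAt hO _ hx).sub (smoothFun.hasFDerivAt hO _ hx)).fderiv,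
      sub_apply, ← add_assoc,
      fderiv_totalD_top hT Λ hΛ (s := k + m) (by omega) (by omega)
        (dependsUpTo_momentum hT Λ hk hΛ m (i + 1) (by omega)) hx,
      ih (i + 1) (by omega),
      (hΛ.partialQ hT Λ (i + 1)).fderiv_dir x (agreeUpTo_jetSingle (by omega) u),
      map_zero, zero_sub, pow_succ, mul_neg_one]
    exact (neg_smul _ _).symm

end Momenta

/-! ### Exterior derivatives of forms `f(dg)` -/

section ExteriorDerivative

variable {E H M E' H' M' E'' H'' M'' V : Type*}
  [NormedAddCommGroup E] [NormedSpace ℝ E] [TopologicalSpace H]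
  {I : ModelWithCorners ℝ E H} [TopologicalSpace M] [ChartedSpace H M]
  [NormedAddCommGroup E'] [NormedSpace ℝ E'] [TopologicalSpace H']
  {I' : ModelWithCorners ℝ E' H'} [TopologicalSpace M'] [ChartedSpace H' M']
  [NormedAddCommGroup E''] [NormedSpace ℝ E''] [TopologicalSpace H'']
  {I'' : ModelWithCorners ℝ E'' H''} [TopologicalSpace M''] [ChartedSpace H'' M'']
  [NormedAddCommGroup V] [NormedSpace ℝ V]

/-- The differential of a map of manifolds, read in the model spaces. -/
noncomputable def tmap (I : ModelWithCorners ℝ E H) (I' : ModelWithCorners ℝ E' H') (f : M → M')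
    (x : M) : E →L[ℝ] E' := mfderiv I I' f x

/-- The value at a point of a 1-form, read in the model space. -/
def formAt (ξ : OneForm I M) (x : M) : E →L[ℝ] ℝ := ξ x

/-- The exterior derivative at a point, read in the model space. -/
noncomputable def extDAt (ξ : OneForm I M) (x : M) : E →L[ℝ] E →L[ℝ] ℝ := extD ξ x

theorem tmap_comp {f : M → M'} {g : M' → M''} {x : M} (hg : MDifferentiableAt I' I'' g (f x))
    (hf : MDifferentiableAt I I' f x) (v : E) :
    tmap I I'' (g ∘ f) x v = tmap I' I'' g (f x) (tmap I I' f x v) :=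
  congrArg (fun l : E →L[ℝ] E'' => l v) (mfderiv_comp x hg hf)

theorem tmap_congr {f g : M → M'} {x : M} (h : f =ᶠ[𝓝 x] g) : tmap I I' f x = tmap I I' g x :=
  h.mfderiv_eq

theorem tmap_eq_fderiv {f : E → V} {x : E} : tmap 𝓘(ℝ, E) 𝓘(ℝ, V) f x = fderiv ℝ f x :=
  mfderiv_eq_fderiv

theorem tmap_extChartAt_self [IsManifold I 1 M] (x : M) (v : E) :
    tmap I 𝓘(ℝ, E) (extChartAt I x) x v = v :=
  congrArg (fun l : E →L[ℝ] E => l v) (mfderiv_extChartAt_self (I := I) (x := x))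

theorem tmap_fst_comp {f : M → V × E'} {x : M}
    (hf : MDifferentiableAt I 𝓘(ℝ, V × E') f x) (v : E) :
    tmap I 𝓘(ℝ, V) (fun y => (f y).1) x v = (tmap I 𝓘(ℝ, V × E') f x v).1 := by
  have h : MDifferentiableAt 𝓘(ℝ, V × E') 𝓘(ℝ, V) Prod.fst (f x) :=
    contDiff_fst.contMDiff.mdifferentiable (n := 1) (by simp) _
  rw [show (fun y => (f y).1) = Prod.fst ∘ f from rfl, tmap_comp h hf, tmap_eq_fderiv, fderiv_fst]
  rfl

variable [I.Boundaryless]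

theorem contDiffAt_comp_extChartAt_symm {f : M → V} {x : M}
    (hf : ContMDiffAt I 𝓘(ℝ, V) ∞ f x) :
    ContDiffAt ℝ ∞ (f ∘ (extChartAt I x).symm) (extChartAt I x x) := by
  have h := (contMDiffAt_iff.1 hf).2
  rw [I.range_eq_univ] at h
  exact h

theorem tmap_eq_fderiv_comp_extChartAt_symm {f : M → V} {x : M}
    (hf : ContMDiffAt I 𝓘(ℝ, V) ∞ f x) :
    tmap I 𝓘(ℝ, V) f x = fderiv ℝ (f ∘ (extChartAt I x).symm) (extChartAt I x x) := by
  have hd : MDifferentiableAt I 𝓘(ℝ, V) f x := hf.mdifferentiableAt (by simp)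
  rw [tmap, hd.mfderiv, I.range_eq_univ, fderivWithin_univ]
  rfl

/-- In the chart at `x` the derivative of `f(dg)` has two terms. The one containing the second
derivative of `g` is symmetric and cancels on antisymmetrization. With `g` the natural coordinates
of any chart, this computes `dξ` without returning to the preferred chart. -/
theorem extD_eq [IsManifold I ∞ M] {ξ : OneForm I M} {x : M} {f : M → V →L[ℝ] ℝ} {g : M → V}
    (hf : ContMDiffAt I 𝓘(ℝ, V →L[ℝ] ℝ) ∞ f x) (hg : ContMDiffAt I 𝓘(ℝ, V) ∞ g x)
    (h : ∀ᶠ y in 𝓝 x, ∀ v, formAt ξ y v = f y (tmap I 𝓘(ℝ, V) g y v)) (u v : E) :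
    extDAt ξ x u v =
      tmap I 𝓘(ℝ, V →L[ℝ] ℝ) f x u (tmap I 𝓘(ℝ, V) g x v) -
      tmap I 𝓘(ℝ, V →L[ℝ] ℝ) f x v (tmap I 𝓘(ℝ, V) g x u) := by
  set φ := extChartAt I x
  have hf' := contDiffAt_comp_extChartAt_symm hf
  have hg' := contDiffAt_comp_extChartAt_symm hg
  have hcont : ContinuousAt φ.symm (φ x) := continuousAt_extChartAt_symm x
  have hφx : φ.symm (φ x) = x := extChartAt_to_inv x
  have hg1 : ContMDiffAt I 𝓘(ℝ, V) 1 g x := hg.of_le (WithTop.coe_le_coe.2 le_top)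
  have hgn : ∀ᶠ y in 𝓝 x, ContMDiffAt I 𝓘(ℝ, V) 1 g y := (contMDiffAt_iff_contMDiffAt_nhds (by simp)).1 hg1
  have hform : formInChart ξ x =ᶠ[𝓝 (φ x)] fun y =>
      ((f ∘ φ.symm) y).comp (fderiv ℝ (g ∘ φ.symm) y) := by
    have ht : ∀ᶠ y in 𝓝 (φ x), y ∈ φ.target := extChartAt_target_mem_nhds x
    have h0 : ∀ᶠ y in 𝓝 (φ.symm (φ x)), (∀ v, formAt ξ y v = f y (tmap I 𝓘(ℝ, V) g y v)) ∧
        ContMDiffAt I 𝓘(ℝ, V) 1 g y := by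
      rw [hφx]; exact h.and hgn
    have h1 := hcont.eventually h0
    filter_upwards [ht, h1] with y hy hy1
    refine ContinuousLinearMap.ext fun w => ?_
    have hsymm : MDifferentiableAt 𝓘(ℝ, E) I φ.symm y := by
      have := mdifferentiableWithinAt_extChartAt_symm (I := I) hy
      rwa [I.range_eq_univ, mdifferentiableWithinAt_univ] at this
    have hcomp := tmap_comp (I'' := 𝓘(ℝ, V)) (hy1.2.mdifferentiableAt (by simp)) hsymm w
    rw [tmap_eq_fderiv] at hcomp
    change formAt ξ (φ.symm y) (tmap 𝓘(ℝ, E) I φ.symm y w) =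
      (f (φ.symm y)) (fderiv ℝ (g ∘ φ.symm) y w)
    rw [hy1.1, hcomp]
  have hD : fderiv ℝ (formInChart ξ x) (φ x) = _ := hform.fderiv_eq
  have hd := (hf'.differentiableAt_top.hasFDerivAt.clm_comp
    hg'.fderiv_top.differentiableAt_top.hasFDerivAt).fderiv
  have key : ∀ a b : E, fderiv ℝ (formInChart ξ x) (φ x) a b =
      (f ∘ φ.symm) (φ x) (fderiv ℝ (fderiv ℝ (g ∘ φ.symm)) (φ x) a b) +
      (fderiv ℝ (f ∘ φ.symm) (φ x) a) (fderiv ℝ (g ∘ φ.symm) (φ x) b) := fun a b => by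
    rw [hD, hd]; rfl
  have e : extDAt ξ x u v = fderiv ℝ (formInChart ξ x) (φ x) u v -
    fderiv ℝ (formInChart ξ x) (φ x) v u := rfl
  rw [e, key, key, tmap_eq_fderiv_comp_extChartAt_symm hf,
    tmap_eq_fderiv_comp_extChartAt_symm hg, hg'.isSymm_top, add_sub_add_left_eq_sub]

end ExteriorDerivative

/-! ### Tangent vectors in the natural coordinates of an arbitrary chart -/

section NaturalCoordinates

variable {n r s : ℕ} {Q : Type*} [TopologicalSpace Q] [ChartedSpace (Model n) Q]
  {e : OpenPartialHomeomorph Q (Model n)}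

/-- The natural coordinates `(q, z)` of a point of `TʳQ × ℝ`, for the chart `e` of `Q`. -/
noncomputable def extCoord (e : OpenPartialHomeomorph Q (Model n)) (y : ExtJet n r Q) :
    ExtModel n r := (y.1.coord e, y.2)

theorem ev_coord_proj (he : e ∈ atlas (Model n) Q) (h : r ≤ s) (x : Jet n s Q)
    (hx : x.base ∈ e.source) : (x.proj h).coord e = tr s r (x.coord e) := by
  rw [Jet.coord_proj he h x hx]
  funext α
  rw [tr_apply, ev_of_lt (by omega)]
  rfl

theorem extCoord_extProj (he : e ∈ atlas (Model n) Q) (h : r ≤ s) {y : ExtJet n s Q}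
    (hy : y.1.base ∈ e.source) :
    extCoord e (extProj h y) = (tr s r).prodMap (ContinuousLinearMap.id ℝ ℝ) (extCoord e y) :=
  Prod.ext (ev_coord_proj he h y.1 hy) rfl

theorem base_extProj (h : r ≤ s) (y : ExtJet n s Q) : (extProj h y).1.base = y.1.base :=
  Jet.base_proj h y.1

variable [IsManifold 𝓘(ℝ, Model n) ∞ Q]

theorem coord_mem_target (he : e ∈ atlas (Model n) Q) {x : Jet n r Q} (hx : x.base ∈ e.source) :
    x.coord e 0 ∈ e.target := (jetChart r he).map_source hx

theorem extCoord_mem_jetDomain (he : e ∈ atlas (Model n) Q) {y : ExtJet n r Q}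
    (hy : y.1.base ∈ e.source) : extCoord e y ∈ jetDomain n r e.target :=
  coord_mem_target he hy

theorem ofCoord_coord (he : e ∈ atlas (Model n) Q) {x : Jet n r Q} (hx : x.base ∈ e.source) :
    Jet.ofCoord e (x.coord e) = x := (jetChart r he).left_inv hx

theorem coord_ofCoord_self (he : e ∈ atlas (Model n) Q) {a : JetModel n r} (ha : a 0 ∈ e.target) :
    (Jet.ofCoord e a).coord e = a := (jetChart r he).right_inv ha

theorem coord_eq_prolong {e' : OpenPartialHomeomorph Q (Model n)} (he : e ∈ atlas (Model n) Q)
    (he' : e' ∈ atlas (Model n) Q) {x : Jet n r Q} (hx : x.base ∈ e.source)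
    (hx' : x.base ∈ e'.source) : x.coord e = prolong r (e ∘ e'.symm) (x.coord e') := by
  have h0 : e'.symm (x.coord e' 0) = x.base := by
    rw [Jet.coord_zero he' x hx', e'.left_inv hx']
  conv_lhs => rw [← ofCoord_coord he' hx']
  rw [Jet.coord_ofCoord he' he (coord_mem_target he' hx') (by rwa [h0])]
  rfl

/-- The natural chart of `TʳQ` induced by a chart of `Q`. -/
noncomputable def jetOpenChart (r : ℕ) (he : e ∈ atlas (Model n) Q) :
    OpenPartialHomeomorph (Jet n r Q) (JetModel n r) :=
  (jetCore n r Q).openPartialHomeomorph (jetChart r he) ⟨e, he, rfl⟩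

theorem jetOpenChart_mem_atlas (he : e ∈ atlas (Model n) Q) :
    jetOpenChart r he ∈ atlas (JetModel n r) (Jet n r Q) := by
  change _ ∈ ⋃ (e : PartialEquiv (Jet n r Q) (JetModel n r)) (he : e ∈ (jetCore n r Q).atlas),
    {(jetCore n r Q).openPartialHomeomorph e he}
  simp only [mem_iUnion, mem_singleton_iff]
  exact ⟨_, ⟨e, he, rfl⟩, rfl⟩

theorem isOpen_base_preimage (he : e ∈ atlas (Model n) Q) :
    IsOpen {x : Jet n r Q | x.base ∈ e.source} := (jetOpenChart r he).open_source

theorem contMDiffOn_coord (he : e ∈ atlas (Model n) Q) :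
    ContMDiffOn 𝓘(ℝ, JetModel n r) 𝓘(ℝ, JetModel n r) ∞ (Jet.coord e)
      {x : Jet n r Q | x.base ∈ e.source} :=
  contMDiffOn_of_mem_maximalAtlas (e := jetOpenChart r he)
    (IsManifold.subset_maximalAtlas (jetOpenChart_mem_atlas he))

theorem contMDiffOn_ofCoord (he : e ∈ atlas (Model n) Q) :
    ContMDiffOn 𝓘(ℝ, JetModel n r) 𝓘(ℝ, JetModel n r) ∞ (Jet.ofCoord (Q := Q) (r := r) e)
      {a | a 0 ∈ e.target} :=
  contMDiffOn_symm_of_mem_maximalAtlas (e := jetOpenChart r he)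
    (IsManifold.subset_maximalAtlas (jetOpenChart_mem_atlas he))

theorem isOpen_extDomain (he : e ∈ atlas (Model n) Q) :
    IsOpen {y : ExtJet n r Q | y.1.base ∈ e.source} :=
  (isOpen_base_preimage he).preimage continuous_fst

theorem contMDiffOn_extCoord (he : e ∈ atlas (Model n) Q) :
    ContMDiffOn (extModel n r) 𝓘(ℝ, ExtModel n r) ∞ (extCoord e)
      {y : ExtJet n r Q | y.1.base ∈ e.source} :=
  ((contMDiffOn_coord he).comp contMDiffOn_fst fun _ hy => hy).prodMk_space contMDiffOn_snd

theorem contMDiffAt_extCoord (he : e ∈ atlas (Model n) Q) {y : ExtJet n r Q}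
    (hy : y.1.base ∈ e.source) : ContMDiffAt (extModel n r) 𝓘(ℝ, ExtModel n r) ∞ (extCoord e) y :=
  (contMDiffOn_extCoord he).contMDiffAt ((isOpen_extDomain he).mem_nhds hy)

/-- The inverse of `extCoord`. -/
noncomputable def extOfCoord (e : OpenPartialHomeomorph Q (Model n)) (a : ExtModel n r) :
    ExtJet n r Q := (Jet.ofCoord e a.1, a.2)

theorem contMDiffOn_extOfCoord (he : e ∈ atlas (Model n) Q) :
    ContMDiffOn 𝓘(ℝ, ExtModel n r) (extModel n r) ∞ (extOfCoord (Q := Q) (r := r) e)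
      (jetDomain n r e.target) := by
  have h1 : ContMDiffOn 𝓘(ℝ, ExtModel n r) 𝓘(ℝ, JetModel n r) ∞ (Prod.fst : ExtModel n r → _)
      (jetDomain n r e.target) := contDiff_fst.contMDiff.contMDiffOn
  have h2 : ContMDiffOn 𝓘(ℝ, ExtModel n r) 𝓘(ℝ, ℝ) ∞ (Prod.snd : ExtModel n r → _)
      (jetDomain n r e.target) := contDiff_snd.contMDiff.contMDiffOn
  exact ((contMDiffOn_ofCoord he).comp h1 fun _ hy => hy).prodMk h2

theorem extOfCoord_extCoord (he : e ∈ atlas (Model n) Q) {y : ExtJet n r Q}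
    (hy : y.1.base ∈ e.source) : extOfCoord e (extCoord e y) = y :=
  Prod.ext (ofCoord_coord he hy) rfl

theorem extCoord_extOfCoord (he : e ∈ atlas (Model n) Q) {a : ExtModel n r}
    (ha : a ∈ jetDomain n r e.target) : extCoord e (extOfCoord (Q := Q) e a) = a :=
  Prod.ext (coord_ofCoord_self he ha) rfl

/-- The differential of the natural coordinates. -/
noncomputable def extDeriv (e : OpenPartialHomeomorph Q (Model n)) (y : ExtJet n r Q) :
    ExtModel n r →L[ℝ] ExtModel n r :=
  tmap (extModel n r) 𝓘(ℝ, ExtModel n r) (extCoord e) y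

theorem q_zero_mem {x : Jet n r Q} (hx : x.base ∈ e.source) :
    x.q 0 ∈ ((chartAt (Model n) x.base).symm.trans e).source := by
  have he' := chart_mem_atlas (Model n) x.base
  have hx' := mem_chart_source (Model n) x.base
  refine ⟨coord_mem_target he' hx', ?_⟩
  change (chartAt (Model n) x.base).symm (x.coord (chartAt (Model n) x.base) 0) ∈ e.source
  rw [Jet.coord_zero he' x hx', (chartAt (Model n) x.base).left_inv hx']
  exact hx

/-- The tangent space at `y` is identified with the model by the preferred chart at `y`. The
differential of the coordinates of `e` is thus that of the transition map, which on jets is a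
prolongation. -/
theorem extDeriv_apply (he : e ∈ atlas (Model n) Q) {y : ExtJet n r Q} (hy : y.1.base ∈ e.source)
    (v : ExtModel n r) :
    extDeriv e y v =
      (fderiv ℝ (prolong r (e ∘ (chartAt (Model n) y.1.base).symm)) y.1.q v.1, v.2) := by
  set e' := chartAt (Model n) y.1.base
  have he' : e' ∈ atlas (Model n) Q := chart_mem_atlas _ _
  have hS := (e'.symm.trans e).open_source
  have hφ := contDiffOn_chart_change he' he
  have h0 : y.1.q 0 ∈ (e'.symm.trans e).source := q_zero_mem hy
  rw [extDeriv, tmap_eq_fderiv_comp_extChartAt_symm (contMDiffAt_extCoord he hy)]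
  have hev : (extCoord e ∘ (extChartAt (extModel n r) y).symm) =ᶠ[𝓝 (y.1.q, y.2)]
      fun a : ExtModel n r => (prolong r (e ∘ e'.symm) a.1, a.2) := by
    have h1 : ∀ᶠ a : ExtModel n r in 𝓝 (y.1.q, y.2), a.1 0 ∈ (e'.symm.trans e).source :=
      (Continuous.continuousAt (f := fun a : ExtModel n r => a.1 0) (by fun_prop)).eventually_mem
        (hS.mem_nhds h0)
    filter_upwards [h1] with a ha
    have h2 : (Jet.ofCoord e' a.1).coord e = prolong r (e ∘ e'.symm) a.1 :=
      Jet.coord_ofCoord he' he ha.1 ha.2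
    exact Prod.ext h2 rfl
  have hd : DifferentiableAt ℝ (prolong r (e ∘ e'.symm)) y.1.q :=
    ((contDiffOn_prolong hS hφ).contDiffAt
      ((hS.preimage (continuous_apply 0)).mem_nhds h0)).differentiableAt_top
  have hfd : HasFDerivAt (fun a : ExtModel n r => (prolong r (e ∘ e'.symm) a.1, a.2))
      ((fderiv ℝ (prolong r (e ∘ e'.symm)) y.1.q).prodMap (ContinuousLinearMap.id ℝ ℝ))
      (y.1.q, y.2) := hd.hasFDerivAt.prodMap (y.1.q, y.2) (hasFDerivAt_id y.2)
  have hpt : extChartAt (extModel n r) y y = (y.1.q, y.2) := rfl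
  rw [hpt, hev.fderiv_eq, hfd.fderiv]
  rfl

theorem extDeriv_self (y : ExtJet n r Q) (v : ExtModel n r) :
    extDeriv (chartAt (Model n) y.1.base) y v = v :=
  tmap_extChartAt_self (I := extModel n r) y v

theorem extDeriv_extJ (he : e ∈ atlas (Model n) Q) {y : ExtJet n r Q} (hy : y.1.base ∈ e.source)
    (β : ℕ) (v : ExtModel n r) :
    extDeriv e y (extJ β y v) = (jetJ r β (extDeriv e y v).1, 0) := by
  rw [extDeriv_apply he hy v]
  refine (extDeriv_apply he hy _).trans (Prod.ext ?_ rfl)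
  exact fderiv_prolong_jetJ (((chartAt (Model n) y.1.base).symm.trans e).open_source)
    (contDiffOn_chart_change (chart_mem_atlas _ _) he) (q_zero_mem hy) β v.1

theorem coord_eq_prolong_q (he : e ∈ atlas (Model n) Q) {x : Jet n r Q} (hx : x.base ∈ e.source) :
    x.coord e = prolong r (e ∘ (chartAt (Model n) x.base).symm) x.q :=
  coord_eq_prolong he (chart_mem_atlas _ _) hx (mem_chart_source _ _)

theorem extDeriv_extDelta (he : e ∈ atlas (Model n) Q) {y : ExtJet n r Q}
    (hy : y.1.base ∈ e.source) {β : ℕ} (hβ : 1 ≤ β) :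
    extDeriv e y (extDelta β y) = (jetDelta r β (y.1.coord e), 0) := by
  rw [coord_eq_prolong_q he hy]
  refine (extDeriv_apply he hy _).trans (Prod.ext ?_ rfl)
  exact fderiv_prolong_jetDelta (((chartAt (Model n) y.1.base).symm.trans e).open_source)
    (contDiffOn_chart_change (chart_mem_atlas _ _) he) (q_zero_mem hy) hβ

theorem fderiv_prolong_inj (he : e ∈ atlas (Model n) Q) (h : r < s) {x : Jet n s Q}
    (hx : x.base ∈ e.source) :
    fderiv ℝ (prolong r (e ∘ (chartAt (Model n) (x.proj h.le).base).symm)) (x.proj h.le).q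
      (x.inj h) = sh s r (x.coord e) := by
  have hb : (x.proj h.le).base = x.base := Jet.base_proj h.le x
  have hq : (x.proj h.le).q = fun α : Fin (r + 1) => x.q ⟨α, by omega⟩ := by
    rw [Jet.q, hb, Jet.coord_proj (chart_mem_atlas _ _) h.le x (mem_chart_source _ _)]
    rfl
  rw [hb, coord_eq_prolong_q he hx]
  refine (fderiv_prolong_shift (((chartAt (Model n) x.base).symm.trans e).open_source)
    (contDiffOn_chart_change (chart_mem_atlas _ _) he) (q_zero_mem hx) h _ hq).trans ?_
  funext α
  rw [sh_apply, ev_of_lt (by omega)]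

theorem extDeriv_inj (he : e ∈ atlas (Model n) Q) (h : r < s) {y : ExtJet n s Q}
    (hy : y.1.base ∈ e.source) (c : ℝ) :
    extDeriv e (extProj h.le y) ((show JetModel n r from y.1.inj h), c) =
      (sh s r (y.1.coord e), c) :=
  (extDeriv_apply he (by rwa [base_extProj]) _).trans (Prod.ext (fderiv_prolong_inj he h hy) rfl)

theorem contMDiff_extProj (h : r ≤ s) :
    ContMDiff (extModel n s) (extModel n r) ∞ (extProj (n := n) (Q := Q) h) :=
  ((Jet.contMDiff_proj h).comp contMDiff_fst).prodMk contMDiff_snd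

theorem tmap_clm_comp {E H M V W : Type*} [NormedAddCommGroup E] [NormedSpace ℝ E]
    [TopologicalSpace H] {I : ModelWithCorners ℝ E H} [TopologicalSpace M] [ChartedSpace H M]
    [NormedAddCommGroup V] [NormedSpace ℝ V] [NormedAddCommGroup W] [NormedSpace ℝ W]
    (l : V →L[ℝ] W) {f : M → V} {x : M} (hf : MDifferentiableAt I 𝓘(ℝ, V) f x) (v : E) :
    tmap I 𝓘(ℝ, W) (fun y => l (f y)) x v = l (tmap I 𝓘(ℝ, V) f x v) := by
  rw [show (fun y => l (f y)) = l ∘ f from rfl,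
    tmap_comp (I' := 𝓘(ℝ, V)) (l.contMDiff (n := 1) |>.mdifferentiable (by simp) _) hf,
    tmap_eq_fderiv, l.fderiv]

theorem extDeriv_extProj (he : e ∈ atlas (Model n) Q) (h : r ≤ s) {y : ExtJet n s Q}
    (hy : y.1.base ∈ e.source) (v : ExtModel n s) :
    extDeriv e (extProj h y) (tmap (extModel n s) (extModel n r) (extProj h) y v) =
      (tr s r).prodMap (ContinuousLinearMap.id ℝ ℝ) (extDeriv e y v) := by
  have hy' : (extProj h y).1.base ∈ e.source := by rwa [base_extProj]
  rw [extDeriv, extDeriv, ← tmap_comp ((contMDiffAt_extCoord he hy').mdifferentiableAt (by simp))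
    ((contMDiff_extProj h).mdifferentiable (by simp) y), ← tmap_clm_comp _
      ((contMDiffAt_extCoord he hy).mdifferentiableAt (by simp))]
  congr 1
  apply tmap_congr
  filter_upwards [(isOpen_extDomain he).mem_nhds hy] with z hz
  exact extCoord_extProj he h hz

theorem tmap_eq_of_extCoord {V : Type*} [NormedAddCommGroup V] [NormedSpace ℝ V]
    (he : e ∈ atlas (Model n) Q) {y : ExtJet n r Q} (hy : y.1.base ∈ e.source)
    {F : ExtJet n r Q → V} {f : ExtModel n r → V} (hf : DifferentiableAt ℝ f (extCoord e y))
    (hF : ∀ z : ExtJet n r Q, z.1.base ∈ e.source → F z = f (extCoord e z)) (v : ExtModel n r) :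
    tmap (extModel n r) 𝓘(ℝ, V) F y v = fderiv ℝ f (extCoord e y) (extDeriv e y v) := by
  have h : F =ᶠ[𝓝 y] f ∘ extCoord e := by
    filter_upwards [(isOpen_extDomain he).mem_nhds hy] with z hz
    exact hF z hz
  rw [tmap_congr h, tmap_comp hf.mdifferentiableAt
    ((contMDiffAt_extCoord he hy).mdifferentiableAt (by simp)), tmap_eq_fderiv]
  rfl

end NaturalCoordinates

/-! ### Comparison of jets of different orders, and index shifts -/

section Padding

variable {n r s N : ℕ}

/-- Truncation of `(q, z)`, or extension by zero. -/
noncomputable def pad (r s : ℕ) : ExtModel n r →L[ℝ] ExtModel n s :=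
  (tr r s).prodMap (ContinuousLinearMap.id ℝ ℝ)

theorem pad_fst (a : ExtModel n r) : (pad r s a).1 = tr r s a.1 := rfl

theorem pad_snd (a : ExtModel n r) : (pad r s a).2 = a.2 := rfl

theorem pad_self (a : ExtModel n r) : pad r r a = a :=
  Prod.ext (jet_ext fun _ hi => ev_tr hi _) rfl

theorem tr_tr {t : ℕ} (h : t ≤ s) (a : JetModel n r) : tr s t (tr r s a) = tr r t a :=
  jet_ext fun i hi => by rw [ev_tr hi, ev_tr (hi.trans h), ev_tr hi]

theorem pad_pad {t : ℕ} (h : t ≤ s) (a : ExtModel n r) : pad s t (pad r s a) = pad r t a :=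
  Prod.ext (tr_tr h a.1) rfl

theorem agreeUpTo_pad_pad (hsN : s ≤ N) (a : ExtModel n r) :
    AgreeUpTo s (pad s N (pad r s a)) (pad r N a) := by
  refine ⟨fun i hi => ?_, rfl⟩
  simp only [pad_fst]
  rw [ev_tr (hi.trans hsN), ev_tr hi, ev_tr (hi.trans hsN)]

theorem pad_mem_jetDomain {T : Set (Model n)} {a : ExtModel n r} :
    pad r s a ∈ jetDomain n s T ↔ a ∈ jetDomain n r T := by
  change tr r s a.1 0 ∈ T ↔ a.1 0 ∈ T
  rw [← ev_zero (tr r s a.1), ← ev_zero a.1, ev_tr (Nat.zero_le s)]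

theorem ev_jetJ {β i : ℕ} (hi : i ≤ r) (a : JetModel n r) :
    ev i (jetJ r β a) = if β ≤ i then (i.descFactorial β : ℝ) • ev (i - β) a else 0 := by
  rw [ev_of_lt (Nat.lt_succ_of_le hi), jetJ, ContinuousLinearMap.pi_apply]
  split_ifs with h
  · rw [ev_of_lt (show i - β < r + 1 by omega)]; rfl
  · rfl

theorem ev_jetDelta {β i : ℕ} (hβ : 1 ≤ β) (hi : i ≤ r) (a : JetModel n r) :
    ev i (jetDelta r β a) =
      if β ≤ i then (i.descFactorial β : ℝ) • ev (i - β + 1) a else 0 := by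
  rw [ev_of_lt (Nat.lt_succ_of_le hi), jetDelta]
  by_cases h : β ≤ i
  · rw [dif_pos ⟨hβ, h⟩, if_pos h, ev_of_lt (show i - β + 1 < r + 1 by omega)]
  · rw [dif_neg fun h' => h h'.2, if_neg h]

theorem sum_range_shift {A : Type*} [AddCommMonoid A] {k β : ℕ} (hβ : 1 ≤ β) {g : ℕ → A}
    (hg : ∀ i, k < i → g i = 0) :
    ∑ i ∈ Finset.range (k + 1), (if β ≤ i then g i else 0) =
      ∑ γ ∈ Finset.range k, g (γ + β) := by
  have h1 : ∑ γ ∈ Finset.range k, g (γ + β) = ∑ γ ∈ Finset.range (k + 1 - β), g (γ + β) := by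
    symm
    refine Finset.sum_subset (Finset.range_mono (by omega)) fun j _ hj => hg _ ?_
    rw [Finset.mem_range] at hj
    omega
  rw [h1]
  rcases le_or_gt β (k + 1) with h | h
  · conv_lhs => rw [← Nat.add_sub_cancel' h]
    rw [Finset.sum_range_add, Finset.sum_eq_zero, zero_add]
    · exact Finset.sum_congr rfl fun i _ => by rw [if_pos (by omega), Nat.add_comm]
    · intro i hi
      rw [Finset.mem_range] at hi
      exact if_neg (by omega)
  · rw [show k + 1 - β = 0 by omega]
    refine Finset.sum_eq_zero fun i hi => ?_
    rw [Finset.mem_range] at hi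
    exact if_neg (by omega)

theorem sum_range_succ_of_last {A : Type*} [AddCommMonoid A] {k : ℕ} (hk : 1 ≤ k) (g : ℕ → A)
    (hg : g (k - 1) = 0) (g' : ℕ → A) (h0 : g' 0 = 0) (hs : ∀ i, g' (i + 1) = g i) :
    ∑ i ∈ Finset.range k, g i = ∑ i ∈ Finset.range k, g' i := by
  obtain ⟨m, rfl⟩ : ∃ m, k = m + 1 := ⟨k - 1, by omega⟩
  rw [Finset.sum_range_succ, Finset.sum_range_succ', h0]
  simp only [Nat.add_sub_cancel] at hg
  simp [hg, hs]

end Padding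

/-! ### Coordinate representatives of functions -/

section LocalLagrangian

variable {n k r s N : ℕ} {Q : Type*} [TopologicalSpace Q] [ChartedSpace (Model n) Q]
  [IsManifold 𝓘(ℝ, Model n) ∞ Q] {e : OpenPartialHomeomorph Q (Model n)}
  {L : ExtJet n k Q → ℝ}

theorem contDiffOn_localLagrangian (he : e ∈ atlas (Model n) Q)
    (hL : ContMDiff (extModel n k) 𝓘(ℝ, ℝ) ∞ L) (N : ℕ) :
    ContDiffOn ℝ ∞ (fun x : ExtModel n N => L (extOfCoord e (pad N k x)))
      (jetDomain n N e.target) := by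
  rw [← contMDiffOn_iff_contDiffOn]
  exact hL.comp_contMDiffOn ((contMDiffOn_extOfCoord he).comp
    ((pad N k).contMDiff.contMDiffOn) fun x hx => pad_mem_jetDomain.2 hx)

/-- The Lagrangian in natural coordinates, as a function of `(q_0, …, q_N, z)`. -/
noncomputable def localLagrangian (he : e ∈ atlas (Model n) Q)
    (hL : ContMDiff (extModel n k) 𝓘(ℝ, ℝ) ∞ L) (N : ℕ) :
    smoothFun (jetDomain n N e.target) ℝ :=
  smoothFun.mk _ (contDiffOn_localLagrangian he hL N)

theorem dependsUpTo_localLagrangian (he : e ∈ atlas (Model n) Q)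
    (hL : ContMDiff (extModel n k) 𝓘(ℝ, ℝ) ∞ L) (N : ℕ) :
    DependsUpTo k (localLagrangian he hL N).1 := by
  refine DependsUpTo.smoothFun_mk (hf := contDiffOn_localLagrangian he hL N) fun x y h => ?_
  have : pad N k x = pad N k y := Prod.ext (jet_ext fun i hi => by
    rw [pad_fst, pad_fst, ev_tr hi, ev_tr hi, h.1 i hi]) h.2
  beta_reduce
  rw [this]

/-- The function `F` on `TʳQ × ℝ` is given by `f` in natural coordinates. -/
def IsLocalRep {G : Type*} [NormedAddCommGroup G] [NormedSpace ℝ G]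
    (e : OpenPartialHomeomorph Q (Model n)) (F : ExtJet n r Q → G)
    (f : smoothFun (jetDomain n N e.target) G) : Prop :=
  ∀ y : ExtJet n r Q, y.1.base ∈ e.source → F y = f.1 (pad r N (extCoord e y))

theorem pad_extCoord_mem (he : e ∈ atlas (Model n) Q) {y : ExtJet n r Q}
    (hy : y.1.base ∈ e.source) : pad r N (extCoord e y) ∈ jetDomain n N e.target :=
  pad_mem_jetDomain.2 (extCoord_mem_jetDomain he hy)

theorem IsLocalRep.tmap_eq {G : Type*} [NormedAddCommGroup G] [NormedSpace ℝ G]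
    (he : e ∈ atlas (Model n) Q) {F : ExtJet n r Q → G}
    {f : smoothFun (jetDomain n N e.target) G} (h : IsLocalRep e F f) {y : ExtJet n r Q}
    (hy : y.1.base ∈ e.source) (v : ExtModel n r) :
    tmap (extModel n r) 𝓘(ℝ, G) F y v =
      fderiv ℝ f.1 (pad r N (extCoord e y)) (pad r N (extDeriv e y v)) := by
  have hf := smoothFun.hasFDerivAt (isOpen_jetDomain e.open_target) f
    (pad_extCoord_mem (N := N) he hy)
  have hfp := hf.comp (extCoord e y) (pad r N).hasFDerivAt
  rw [tmap_eq_of_extCoord he hy hfp.differentiableAt h, hfp.fderiv]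
  rfl

theorem IsLocalRep.contMDiffAt {G : Type*} [NormedAddCommGroup G] [NormedSpace ℝ G]
    (he : e ∈ atlas (Model n) Q) {F : ExtJet n r Q → G}
    {f : smoothFun (jetDomain n N e.target) G} (h : IsLocalRep e F f) {y : ExtJet n r Q}
    (hy : y.1.base ∈ e.source) : ContMDiffAt (extModel n r) 𝓘(ℝ, G) ∞ F y := by
  have hf := smoothFun.contDiffAt (isOpen_jetDomain e.open_target) f
    (pad_extCoord_mem (N := N) he hy)
  have h1 : ContMDiffAt (extModel n r) 𝓘(ℝ, ExtModel n N) ∞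
      (fun y => pad r N (extCoord e y)) y :=
    (pad r N).contMDiff.contMDiffAt.comp y (contMDiffAt_extCoord he hy)
  refine (hf.contMDiffAt.comp y h1).congr_of_eventuallyEq ?_
  filter_upwards [(isOpen_extDomain he).mem_nhds hy] with z hz
  exact h z hz

theorem IsLocalRep.comp_extProj {G : Type*} [NormedAddCommGroup G] [NormedSpace ℝ G]
    (he : e ∈ atlas (Model n) Q) {F : ExtJet n r Q → G}
    {f : smoothFun (jetDomain n N e.target) G} (h : IsLocalRep e F f) (hrN : r ≤ N)
    (hf : DependsUpTo r f.1) (hrs : r ≤ s) : IsLocalRep e (fun y => F (extProj hrs y)) f := by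
  intro y hy
  beta_reduce
  rw [h _ (by rwa [base_extProj]), extCoord_extProj he hrs hy]
  exact hf _ _ (agreeUpTo_pad_pad hrN _)

theorem isLocalRep_lagrangian (he : e ∈ atlas (Model n) Q)
    (hL : ContMDiff (extModel n k) 𝓘(ℝ, ℝ) ∞ L) (hkN : k ≤ N) :
    IsLocalRep e L (localLagrangian he hL N) := by
  intro y hy
  rw [localLagrangian, smoothFun.mk_apply _ (pad_extCoord_mem he hy), pad_pad hkN, pad_self,
    extOfCoord_extCoord he hy]

theorem extDeriv_dz (he : e ∈ atlas (Model n) Q) {y : ExtJet n r Q} (hy : y.1.base ∈ e.source) :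
    extDeriv e y (0, 1) = (0, 1) := by
  rw [extDeriv_apply he hy]
  exact Prod.ext (map_zero _) rfl

theorem isLocalRep_dLdz (he : e ∈ atlas (Model n) Q)
    (hL : ContMDiff (extModel n k) 𝓘(ℝ, ℝ) ∞ L) (hkN : k ≤ N) :
    IsLocalRep e (dLdz L) (smoothFun.mk (O := jetDomain n N e.target) _
      (contDiffOn_dzCoord e.open_target (localLagrangian he hL N))) := by
  intro y hy
  rw [smoothFun.mk_apply _ (pad_extCoord_mem he hy)]
  refine ((isLocalRep_lagrangian he hL hkN).tmap_eq he hy (0, 1)).trans ?_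
  rw [extDeriv_dz he hy, dzCoord]
  congr 1
  exact Prod.ext (map_zero (tr k N)) rfl

end LocalLagrangian

/-! ### Total derivatives of functions and of coefficient sequences -/

section TotalDerivativeRep

variable {n k r s N : ℕ} {Q : Type*} [TopologicalSpace Q] [ChartedSpace (Model n) Q]
  [IsManifold 𝓘(ℝ, Model n) ∞ Q] {e : OpenPartialHomeomorph Q (Model n)}
  {L : ExtJet n k Q → ℝ} (he : e ∈ atlas (Model n) Q)
  (hL : ContMDiff (extModel n k) 𝓘(ℝ, ℝ) ∞ L)

theorem extDeriv_totalVector (he : e ∈ atlas (Model n) Q) (h : k ≤ r) {y : ExtJet n (r + 1) Q}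
    (hy : y.1.base ∈ e.source) :
    extDeriv e (extProj r.le_succ y) (totalVector L h y) =
      (sh (r + 1) r (y.1.coord e), L (extProj (h.trans r.le_succ) y)) :=
  extDeriv_inj he r.lt_succ_self hy _

/-- The coordinate field on the larger space of order `N` differs from `Tτ(Γ)` only in components of
order above `r`, which functions of order `r` do not see. -/
theorem agreeUpTo_totalVector (hkr : k ≤ r) (hrN : r + 1 ≤ N) {y : ExtJet n (r + 1) Q}
    (hy : y.1.base ∈ e.source) :
    AgreeUpTo r (pad r N (extDeriv e (extProj r.le_succ y) (totalVector L hkr y)))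
      (totalField (localLagrangian he hL N) (pad (r + 1) N (extCoord e y))) := by
  rw [extDeriv_totalVector he hkr hy]
  refine ⟨fun i hi => ?_, ?_⟩
  · simp only [pad_fst, totalField]
    rw [ev_tr (by omega), ev_sh hi, ev_sh (by omega), ev_tr (by omega)]
    rfl
  · exact (isLocalRep_lagrangian he hL (by omega)).comp_extProj he (by omega)
      (dependsUpTo_localLagrangian he hL N) (hkr.trans r.le_succ) y hy

theorem agreeUpTo_extProj (he : e ∈ atlas (Model n) Q) (hrN : r ≤ N) (hrs : r ≤ s)
    {y : ExtJet n s Q} (hy : y.1.base ∈ e.source) :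
    AgreeUpTo r (pad r N (extCoord e (extProj hrs y))) (pad s N (extCoord e y)) := by
  rw [extCoord_extProj he hrs hy]
  exact agreeUpTo_pad_pad hrN _

theorem dLdz_extProj_eq (hkN : k ≤ N) (hks : k ≤ s) {y : ExtJet n s Q}
    (hy : y.1.base ∈ e.source) :
    dLdz L (extProj hks y) = dzCoord (localLagrangian he hL N) (pad s N (extCoord e y)) := by
  rw [isLocalRep_dLdz he hL hkN _ (by rwa [base_extProj]),
    smoothFun.mk_apply _ (pad_extCoord_mem he (by rwa [base_extProj])), dzCoord, dzCoord,
    (dependsUpTo_localLagrangian he hL N).fderiv_point (agreeUpTo_extProj he hkN hks hy)]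

theorem IsLocalRep.DL (hkr : k ≤ r) (hrN : r + 1 ≤ N) {F : ExtJet n r Q → ℝ}
    {f : smoothFun (jetDomain n N e.target) ℝ} (h : IsLocalRep e F f) (hf : DependsUpTo r f.1) :
    IsLocalRep e (DL L hkr F) (totalD e.open_target (localLagrangian he hL N) f) := by
  intro y hy
  have hy' : (extProj r.le_succ y).1.base ∈ e.source := by rwa [base_extProj]
  rw [totalD_apply _ _ _ (pad_extCoord_mem he hy)]
  have h1 : dL L hkr F y = fderiv ℝ f.1 (pad (r + 1) N (extCoord e y))
      (totalField (localLagrangian he hL N) (pad (r + 1) N (extCoord e y))) := by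
    refine (h.tmap_eq he hy' _).trans ?_
    rw [hf.fderiv_dir _ (agreeUpTo_totalVector he hL hkr hrN hy),
      hf.fderiv_point (agreeUpTo_extProj he (by omega) r.le_succ hy)]
  rw [HigherOrderContact.DL, h1, dLdz_extProj_eq he hL (N := N) (by omega) _ hy, h _ hy',
    hf _ _ (agreeUpTo_extProj he (by omega) r.le_succ hy), smul_eq_mul]

/-- The 1-form `ξ` is `∑_{i<k} f_i dq_i` in natural coordinates. -/
def IsFormRep (k : ℕ) (e : OpenPartialHomeomorph Q (Model n))
    (ξ : OneForm (extModel n r) (ExtJet n r Q))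
    (f : ℕ → smoothFun (jetDomain n N e.target) (Model n →L[ℝ] ℝ)) : Prop :=
  ∀ y : ExtJet n r Q, y.1.base ∈ e.source → ∀ v : ExtModel n r, formAt ξ y v =
    ∑ i ∈ Finset.range k, (f i).1 (pad r N (extCoord e y)) (ev i (extDeriv e y v).1)

/-- The covector `∑_{i<k} f_i dq_i` at a point. -/
noncomputable def covec {T : Set (Model n)} (k r : ℕ)
    (f : ℕ → smoothFun (jetDomain n N T) (Model n →L[ℝ] ℝ)) (x : ExtModel n N) :
    JetModel n r →L[ℝ] ℝ :=
  ∑ i ∈ Finset.range k, ((f i).1 x).comp (ev i)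

theorem covec_apply {T : Set (Model n)}
    (f : ℕ → smoothFun (jetDomain n N T) (Model n →L[ℝ] ℝ)) (x : ExtModel n N)
    (a : JetModel n r) :
    covec k r f x a = ∑ i ∈ Finset.range k, (f i).1 x (ev i a) := by
  simp [covec]

theorem contDiffOn_covec {T : Set (Model n)}
    (f : ℕ → smoothFun (jetDomain n N T) (Model n →L[ℝ] ℝ)) :
    ContDiffOn ℝ ∞ (covec k r f) (jetDomain n N T) :=
  ContDiffOn.sum fun i _ => (f i).2.1.clm_comp contDiffOn_const

theorem fderiv_covec {T : Set (Model n)} (hT : IsOpen T)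
    (f : ℕ → smoothFun (jetDomain n N T) (Model n →L[ℝ] ℝ)) {x : ExtModel n N}
    (hx : x ∈ jetDomain n N T) (u : ExtModel n N) (a : JetModel n r) :
    fderiv ℝ (covec k r f) x u a = ∑ i ∈ Finset.range k, fderiv ℝ (f i).1 x u (ev i a) := by
  have h : HasFDerivAt (covec k r f) (∑ i ∈ Finset.range k,
      ((ContinuousLinearMap.compL ℝ (JetModel n r) (Model n) ℝ).flip (ev i)).comp
        (fderiv ℝ (f i).1 x)) x := by
    refine HasFDerivAt.fun_sum (A := fun i x => ((f i).1 x).comp (ev i)) fun i _ => ?_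
    exact ((ContinuousLinearMap.compL ℝ (JetModel n r) (Model n) ℝ).flip (ev i)).hasFDerivAt.comp x
      (smoothFun.hasFDerivAt (isOpen_jetDomain hT) (f i) hx)
  rw [h.fderiv]
  simp

theorem contDiffOn_contr {T : Set (Model n)} (k : ℕ)
    (f : ℕ → smoothFun (jetDomain n N T) (Model n →L[ℝ] ℝ)) :
    ContDiffOn ℝ ∞ (fun x : ExtModel n N => ∑ i ∈ Finset.range k, (f i).1 x (ev (i + 1) x.1))
      (jetDomain n N T) :=
  ContDiffOn.sum fun i _ => (f i).2.1.clm_apply ((ev (i + 1)).contDiff.comp contDiff_fst).contDiffOn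

/-- The contraction `∑_{i<k} f_i(q_{i+1})`. -/
noncomputable def contr {T : Set (Model n)} (k : ℕ)
    (f : ℕ → smoothFun (jetDomain n N T) (Model n →L[ℝ] ℝ)) : smoothFun (jetDomain n N T) ℝ :=
  smoothFun.mk _ (contDiffOn_contr k f)

theorem contr_apply {T : Set (Model n)}
    (f : ℕ → smoothFun (jetDomain n N T) (Model n →L[ℝ] ℝ)) {x : ExtModel n N}
    (hx : x ∈ jetDomain n N T) :
    (contr k f).1 x = ∑ i ∈ Finset.range k, (f i).1 x (ev (i + 1) x.1) :=
  smoothFun.mk_apply (contDiffOn_contr k f) hx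

theorem fderiv_contr {T : Set (Model n)} (hT : IsOpen T)
    (f : ℕ → smoothFun (jetDomain n N T) (Model n →L[ℝ] ℝ)) {x : ExtModel n N}
    (hx : x ∈ jetDomain n N T) (u : ExtModel n N) :
    fderiv ℝ (contr k f).1 x u = ∑ i ∈ Finset.range k,
      (fderiv ℝ (f i).1 x u (ev (i + 1) x.1) + (f i).1 x (ev (i + 1) u.1)) := by
  have hO := isOpen_jetDomain (N := N) hT
  have h : HasFDerivAt (fun x : ExtModel n N => ∑ i ∈ Finset.range k, (f i).1 x (ev (i + 1) x.1))
      (∑ i ∈ Finset.range k, (((f i).1 x).comp ((ev (i + 1)).comp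
        (ContinuousLinearMap.fst ℝ (JetModel n N) ℝ)) +
        (fderiv ℝ (f i).1 x).flip (ev (i + 1) x.1))) x := by
    refine HasFDerivAt.fun_sum fun i _ => ?_
    exact (smoothFun.hasFDerivAt hO (f i) hx).clm_apply
      ((ev (i + 1)).comp (ContinuousLinearMap.fst ℝ (JetModel n N) ℝ)).hasFDerivAt
  have hev : (contr k f).1 =ᶠ[𝓝 x]
      fun x : ExtModel n N => ∑ i ∈ Finset.range k, (f i).1 x (ev (i + 1) x.1) := by
    filter_upwards [hO.mem_nhds hx] with z hz
    exact contr_apply f hz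
  rw [hev.fderiv_eq, h.fderiv]
  simp [add_comm]

theorem DependsUpTo.contr {T : Set (Model n)}
    {f : ℕ → smoothFun (jetDomain n N T) (Model n →L[ℝ] ℝ)} (hkr : k ≤ r)
    (hf : ∀ i, DependsUpTo r (f i).1) : DependsUpTo r (contr k f).1 := by
  refine DependsUpTo.smoothFun_mk (hf := contDiffOn_contr k f) fun x y h => ?_
  refine Finset.sum_congr rfl fun i hi => ?_
  rw [Finset.mem_range] at hi
  rw [hf i x y h, h.1 (i + 1) (by omega)]

section SeqD

variable {T : Set (Model n)} (hT : IsOpen T) (Λ : smoothFun (jetDomain n N T) ℝ)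
  {f : ℕ → smoothFun (jetDomain n N T) (Model n →L[ℝ] ℝ)}

/-- The shifted part `f_{i-1}(a_i)` is reindexed to `f_i(a_{i+1})`. There is no boundary term
because `f_{k-1} = 0`. -/
theorem sum_seqD_apply (hk : 1 ≤ k) (hlast : f (k - 1) = 0) {x : ExtModel n N}
    (hx : x ∈ jetDomain n N T) (a : ℕ → Model n) :
    ∑ i ∈ Finset.range k, (seqD (totalD hT Λ) f i).1 x (a i) =
      ∑ i ∈ Finset.range k, (fderiv ℝ (f i).1 x (totalField Λ x) (a i) -
        dzCoord Λ x * (f i).1 x (a i) + (f i).1 x (a (i + 1))) := by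
  let g : ℕ → ℝ := fun i => (f i).1 x (a (i + 1))
  let g' : ℕ → ℝ := fun i => match i with
    | 0 => 0
    | i + 1 => g i
  have h1 := sum_range_succ_of_last hk g (by simp only [g]; rw [hlast]; rfl) g' rfl fun _ => rfl
  rw [Finset.sum_add_distrib, h1, ← Finset.sum_add_distrib]
  refine Finset.sum_congr rfl fun i _ => ?_
  cases i with
  | zero =>
    rw [seqD, totalD_apply hT Λ (f 0) hx]
    simp only [g', add_zero]
    rfl
  | succ i =>
    rw [seqD]
    change ((totalD hT Λ (f (i + 1))).1 x + (f i).1 x) (a (i + 1)) = _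
    rw [totalD_apply hT Λ (f (i + 1)) hx]
    rfl

/-- Contraction with the total field commutes with the total derivative, since the total field sends
`q_{i+1}` to `q_{i+2}`. The energy can therefore be read off from the Cartan form. -/
theorem totalD_contr (hk : 1 ≤ k) (hkN : k ≤ N) (hlast : f (k - 1) = 0) :
    totalD hT Λ (contr k f) = contr k (seqD (totalD hT Λ) f) := by
  refine smoothFun.ext fun x hx => ?_
  rw [totalD_apply hT Λ _ hx, contr_apply _ hx, contr_apply _ hx, fderiv_contr hT f hx,
    sum_seqD_apply hT Λ hk hlast hx fun i => ev (i + 1) x.1, smul_eq_mul, Finset.mul_sum,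
    ← Finset.sum_sub_distrib]
  refine Finset.sum_congr rfl fun i hi => ?_
  rw [Finset.mem_range] at hi
  have : ev (i + 1) (totalField Λ x).1 = ev (i + 1 + 1) x.1 := ev_sh (by omega) _
  rw [this]
  ring

theorem DependsUpTo.seqD (hΛ : DependsUpTo k Λ.1) (hkr : k ≤ r)
    (hf : ∀ i, DependsUpTo r (f i).1) (i : ℕ) :
    DependsUpTo (r + 1) (HigherOrderContact.seqD (HigherOrderContact.totalD hT Λ) f i).1 := by
  cases i with
  | zero => exact DependsUpTo.totalD hT Λ hΛ (by omega) (hf 0)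
  | succ i =>
    intro x y h
    have h1 := DependsUpTo.totalD hT Λ hΛ (show k ≤ r + 1 by omega) (hf (i + 1)) x y h
    have h2 := hf i x y (h.mono r.le_succ)
    exact congrArg₂ (· + ·) h1 h2

end SeqD

end TotalDerivativeRep

/-! ### Cartan form and energy in coordinates -/

section CartanForm

variable {n k r s N : ℕ} {Q : Type*} [TopologicalSpace Q] [ChartedSpace (Model n) Q]
  [IsManifold 𝓘(ℝ, Model n) ∞ Q] {e : OpenPartialHomeomorph Q (Model n)}
  {L : ExtJet n k Q → ℝ} (he : e ∈ atlas (Model n) Q)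
  (hL : ContMDiff (extModel n k) 𝓘(ℝ, ℝ) ∞ L)

theorem tmap_coord (he : e ∈ atlas (Model n) Q) {y : ExtJet n r Q} (hy : y.1.base ∈ e.source)
    (v : ExtModel n r) :
    tmap (extModel n r) 𝓘(ℝ, JetModel n r) (fun z : ExtJet n r Q => z.1.coord e) y v =
      (extDeriv e y v).1 :=
  tmap_fst_comp (f := extCoord e) ((contMDiffAt_extCoord he hy).mdifferentiableAt (by simp)) v

theorem contMDiffAt_coord_fst (he : e ∈ atlas (Model n) Q) {y : ExtJet n r Q}
    (hy : y.1.base ∈ e.source) :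
    ContMDiffAt (extModel n r) 𝓘(ℝ, JetModel n r) ∞ (fun z : ExtJet n r Q => z.1.coord e) y :=
  contDiff_fst.contMDiff.contMDiffAt.comp y (contMDiffAt_extCoord he hy)

theorem isLocalRep_covec (f : ℕ → smoothFun (jetDomain n N e.target) (Model n →L[ℝ] ℝ))
    (he : e ∈ atlas (Model n) Q) :
    IsLocalRep e (fun y : ExtJet n r Q => covec k s f (pad r N (extCoord e y)))
      (smoothFun.mk (covec k s f) (contDiffOn_covec f)) := fun _ hy =>
  (smoothFun.mk_apply (contDiffOn_covec f) (pad_extCoord_mem he hy)).symm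

theorem smoothFun.fderiv_mk {E G : Type*} [NormedAddCommGroup E] [NormedSpace ℝ E]
    [NormedAddCommGroup G] [NormedSpace ℝ G] {O : Set E} (hO : IsOpen O) {f : E → G}
    (hf : ContDiffOn ℝ ∞ f O) {x : E} (hx : x ∈ O) :
    fderiv ℝ (smoothFun.mk f hf).1 x = fderiv ℝ f x := by
  refine EventuallyEq.fderiv_eq ?_
  filter_upwards [hO.mem_nhds hx] with z hz
  exact smoothFun.mk_apply hf hz

theorem IsFormRep.extD (he : e ∈ atlas (Model n) Q) {ξ : OneForm (extModel n r) (ExtJet n r Q)}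
    {f : ℕ → smoothFun (jetDomain n N e.target) (Model n →L[ℝ] ℝ)} (h : IsFormRep k e ξ f)
    {y : ExtJet n r Q} (hy : y.1.base ∈ e.source) (u v : ExtModel n r) :
    extDAt ξ y u v = ∑ i ∈ Finset.range k,
      (fderiv ℝ (f i).1 (pad r N (extCoord e y)) (pad r N (extDeriv e y u))
          (ev i (extDeriv e y v).1) -
        fderiv ℝ (f i).1 (pad r N (extCoord e y)) (pad r N (extDeriv e y v))
          (ev i (extDeriv e y u).1)) := by
  have hrep := isLocalRep_covec (k := k) (r := r) (s := r) f he
  rw [extD_eq (hrep.contMDiffAt he hy) (contMDiffAt_coord_fst he hy), tmap_coord he hy,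
    tmap_coord he hy, hrep.tmap_eq he hy, hrep.tmap_eq he hy,
    smoothFun.fderiv_mk (isOpen_jetDomain e.open_target) _ (pad_extCoord_mem he hy),
    fderiv_covec e.open_target f (pad_extCoord_mem he hy),
    fderiv_covec e.open_target f (pad_extCoord_mem he hy), Finset.sum_sub_distrib]
  filter_upwards [(isOpen_extDomain he).mem_nhds hy] with z hz v
  rw [h z hz v, covec_apply, tmap_coord he hz]

theorem ev_extDeriv_extProj (he : e ∈ atlas (Model n) Q) (hrs : r ≤ s) {y : ExtJet n s Q}
    (hy : y.1.base ∈ e.source) (v : ExtModel n s) {i : ℕ} (hi : i ≤ r) :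
    ev i (extDeriv e (extProj hrs y) (tmap (extModel n s) (extModel n r) (extProj hrs) y v)).1 =
      ev i (extDeriv e y v).1 := by
  rw [extDeriv_extProj he hrs hy]
  exact ev_tr hi _

theorem agreeUpTo_extDeriv_extProj (he : e ∈ atlas (Model n) Q) (hrN : r ≤ N) (hrs : r ≤ s)
    {y : ExtJet n s Q} (hy : y.1.base ∈ e.source) (v : ExtModel n s) :
    AgreeUpTo r (pad r N (extDeriv e (extProj hrs y)
      (tmap (extModel n s) (extModel n r) (extProj hrs) y v))) (pad s N (extDeriv e y v)) := by
  rw [extDeriv_extProj he hrs hy]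
  exact agreeUpTo_pad_pad hrN _

theorem IsFormRep.pullForm (he : e ∈ atlas (Model n) Q)
    {ξ : OneForm (extModel n r) (ExtJet n r Q)}
    {f : ℕ → smoothFun (jetDomain n N e.target) (Model n →L[ℝ] ℝ)} (h : IsFormRep k e ξ f)
    (hkr : k ≤ r) (hrN : r ≤ N) (hf : ∀ i, DependsUpTo r (f i).1) (hrs : r ≤ s) :
    IsFormRep k e (pullForm hrs ξ) f := by
  intro y hy v
  have hy' : (extProj hrs y).1.base ∈ e.source := by rwa [base_extProj]
  refine (h _ hy' (tmap (extModel n s) (extModel n r) (extProj hrs) y v)).trans ?_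
  refine Finset.sum_congr rfl fun i hi => ?_
  rw [Finset.mem_range] at hi
  rw [hf i _ _ (agreeUpTo_extProj he hrN hrs hy), ev_extDeriv_extProj he hrs hy v (by omega)]

/-- By Cartan's formula, `i(Γ)dξ` contributes `Γ(f_i)(v_i) - v(f_i)(q_{i+1})` and `d(i(Γ)ξ)`
contributes `v(f_i)(q_{i+1}) + f_i(v_{i+1})`. The middle terms cancel and leave `D` plus the shift
on coefficients. The condition `f_{k-1} = 0` prevents a term in `dq_k`. -/
theorem IsFormRep.DLForm (hk : 1 ≤ k) (hkr : k ≤ r) (hrN : r + 1 ≤ N)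
    {ξ : OneForm (extModel n r) (ExtJet n r Q)}
    {f : ℕ → smoothFun (jetDomain n N e.target) (Model n →L[ℝ] ℝ)} (h : IsFormRep k e ξ f)
    (hf : ∀ i, DependsUpTo r (f i).1) (hlast : f (k - 1) = 0) :
    IsFormRep k e (DLForm L hkr ξ)
      (seqD (totalD e.open_target (localLagrangian he hL N)) f) := by
  intro y hy v
  have hrN' : r ≤ N := by omega
  have hy' : (extProj r.le_succ y).1.base ∈ e.source := by rwa [base_extProj]
  set x := pad (r + 1) N (extCoord e y)
  have hx : x ∈ jetDomain n N e.target := pad_extCoord_mem he hy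
  set w := pad (r + 1) N (extDeriv e y v)
  have hpt := agreeUpTo_extProj he hrN' r.le_succ hy
  have hΓ := agreeUpTo_totalVector (r := r) he hL hkr hrN hy
  have hw := agreeUpTo_extDeriv_extProj he hrN' r.le_succ hy v
  set Λ := localLagrangian he hL N
  set tv : ExtModel n (r + 1) → ExtModel n r :=
    fun v => tmap (extModel n (r + 1)) (extModel n r) (extProj r.le_succ) y v
  have hwv : ∀ i, i ≤ r + 1 → ev i w.1 = ev i (extDeriv e y v).1 := fun i hi => by
    change ev i (tr _ _ _) = _
    rw [ev_tr (by omega)]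
    rfl
  have h1 : extDAt ξ (extProj r.le_succ y) (totalVector L hkr y) (tv v) =
      ∑ i ∈ Finset.range k, (fderiv ℝ (f i).1 x (totalField Λ x) (ev i w.1) -
        fderiv ℝ (f i).1 x w (ev (i + 1) x.1)) := by
    refine (h.extD he hy' _ _).trans (Finset.sum_congr rfl fun i hi => ?_)
    rw [Finset.mem_range] at hi
    have e1 : ev i (extDeriv e (extProj r.le_succ y) (totalVector L hkr y)).1 =
        ev (i + 1) x.1 := by
      rw [extDeriv_totalVector he hkr hy, ev_sh (by omega)]
      exact (ev_tr (by omega) _).symm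
    rw [e1, (hf i).fderiv_point hpt, (hf i).fderiv_dir x hΓ, (hf i).fderiv_dir x hw,
      ev_extDeriv_extProj he r.le_succ hy v (by omega), hwv i (by omega)]
  have h2 : tmap (extModel n (r + 1)) 𝓘(ℝ, ℝ)
      (fun y => formAt ξ (extProj r.le_succ y) (totalVector L hkr y)) y v =
      ∑ i ∈ Finset.range k, (fderiv ℝ (f i).1 x w (ev (i + 1) x.1) +
        (f i).1 x (ev (i + 1) w.1)) := by
    have hrep : IsLocalRep e
        (fun y => formAt ξ (extProj r.le_succ y) (totalVector L hkr y)) (contr k f) := by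
      intro z hz
      have hz' : (extProj r.le_succ z).1.base ∈ e.source := by rwa [base_extProj]
      rw [contr_apply f (pad_extCoord_mem he hz)]
      refine (h _ hz' _).trans (Finset.sum_congr rfl fun i hi => ?_)
      rw [Finset.mem_range] at hi
      rw [hf i _ _ (agreeUpTo_extProj he hrN' r.le_succ hz), extDeriv_totalVector he hkr hz,
        ev_sh (by omega)]
      congr 1
      exact (ev_tr (by omega) _).symm
    rw [hrep.tmap_eq he hy, fderiv_contr e.open_target f hx]
  have h3 : formAt (HigherOrderContact.pullForm r.le_succ ξ) y v =
      ∑ i ∈ Finset.range k, (f i).1 x (ev i w.1) := by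
    rw [h.pullForm he hkr hrN' hf r.le_succ y hy v]
    refine Finset.sum_congr rfl fun i hi => ?_
    rw [Finset.mem_range] at hi
    rw [hwv i (by omega)]
  have h4 : formAt (HigherOrderContact.DLForm L hkr ξ) y v =
      extDAt ξ (extProj r.le_succ y) (totalVector L hkr y) (tv v) +
      tmap (extModel n (r + 1)) 𝓘(ℝ, ℝ)
        (fun y => formAt ξ (extProj r.le_succ y) (totalVector L hkr y)) y v -
      dLdz L (extProj (hkr.trans r.le_succ) y) *
        formAt (HigherOrderContact.pullForm r.le_succ ξ) y v := rfl
  rw [h4, h1, h2, h3, dLdz_extProj_eq he hL (N := N) (by omega) _ hy, Finset.mul_sum,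
    ← Finset.sum_add_distrib, ← Finset.sum_sub_distrib]
  refine Eq.trans ?_ ((sum_seqD_apply e.open_target Λ hk hlast hx fun i => ev i w.1).symm.trans ?_)
  · refine Finset.sum_congr rfl fun i _ => ?_
    ring
  · refine Finset.sum_congr rfl fun i hi => ?_
    rw [Finset.mem_range] at hi
    rw [hwv i (by omega)]

/-- The coefficients of `i(J_β) dL`. -/
noncomputable def verticalCoeff {T : Set (Model n)} (hT : IsOpen T)
    (Λ : smoothFun (jetDomain n N T) ℝ) (β γ : ℕ) :
    smoothFun (jetDomain n N T) (Model n →L[ℝ] ℝ) :=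
  ((γ + β).descFactorial β : ℝ) • partialQ hT Λ (γ + β)

theorem verticalCoeff_eq_zero {T : Set (Model n)} (hT : IsOpen T)
    (Λ : smoothFun (jetDomain n N T) ℝ) (hΛ : DependsUpTo k Λ.1) {β γ : ℕ} (h : k < γ + β) :
    verticalCoeff hT Λ β γ = 0 := by
  refine Subtype.ext (funext fun x => ?_)
  change ((γ + β).descFactorial β : ℝ) • (partialQ hT Λ (γ + β)).1 x = 0
  rw [partialQ_eq_zero hT Λ hΛ h]
  exact smul_zero ((γ + β).descFactorial β : ℝ)

theorem dependsUpTo_verticalCoeff {T : Set (Model n)} (hT : IsOpen T)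
    (Λ : smoothFun (jetDomain n N T) ℝ) (hΛ : DependsUpTo k Λ.1) (β γ : ℕ) :
    DependsUpTo k (verticalCoeff hT Λ β γ).1 := fun x y h =>
  congrArg (((γ + β).descFactorial β : ℝ) • ·) (hΛ.partialQ hT Λ (γ + β) x y h)

/-- Expand `dL` in partial derivatives and reindex by `i = γ + β`; the partial derivatives with
index above `k` vanish. -/
theorem isFormRep_extJ (hkN : k ≤ N) {β : ℕ} (hβ : 1 ≤ β) :
    IsFormRep k e (fun y => (dfun (extModel n k) L y).comp (extJ β y))
      (verticalCoeff e.open_target (localLagrangian he hL N) β) := by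
  intro y hy v
  set Λ := localLagrangian he hL N
  have hΛ : DependsUpTo k Λ.1 := dependsUpTo_localLagrangian he hL N
  have hx : pad k N (extCoord e y) ∈ jetDomain n N e.target := pad_extCoord_mem he hy
  refine ((isLocalRep_lagrangian he hL hkN).tmap_eq he hy (extJ β y v)).trans ?_
  rw [extDeriv_extJ he hy, fderiv_eq_sum_partialQ e.open_target Λ hkN hΛ hx]
  simp only [pad_snd, pad_fst, mul_zero, add_zero]
  refine Eq.trans ?_ ((sum_range_shift hβ (k := k) (g := fun i => (i.descFactorial β : ℝ) •
    (partialQ e.open_target Λ i).1 (pad k N (extCoord e y)) (ev (i - β) (extDeriv e y v).1))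
    ?_).trans ?_)
  · refine Finset.sum_congr rfl fun i hi => ?_
    rw [Finset.mem_range] at hi
    rw [ev_tr (by omega), ev_jetJ (by omega)]
    split_ifs
    · rw [map_smul]
    · rw [map_zero]
  · intro i hi
    rw [partialQ_eq_zero e.open_target Λ hΛ hi]
    exact smul_zero _
  · refine Finset.sum_congr rfl fun γ _ => ?_
    rw [Nat.add_sub_cancel]
    rfl

/-- `Δ_β` arises from the components of `J_β` on replacing each `dq_γ` by `q_{γ+1}`, so `Δ_β(L)` is
the contraction of `i(J_β)dL` with the total field. -/
theorem isLocalRep_extDelta (hkN : k ≤ N) {β : ℕ} (hβ : 1 ≤ β) :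
    IsLocalRep e (fun y => dfun (extModel n k) L y (extDelta β y))
      (contr k (verticalCoeff e.open_target (localLagrangian he hL N) β)) := by
  intro y hy
  set Λ := localLagrangian he hL N
  have hΛ : DependsUpTo k Λ.1 := dependsUpTo_localLagrangian he hL N
  have hx : pad k N (extCoord e y) ∈ jetDomain n N e.target := pad_extCoord_mem he hy
  refine ((isLocalRep_lagrangian he hL hkN).tmap_eq he hy (extDelta β y)).trans ?_
  rw [extDeriv_extDelta he hy hβ, fderiv_eq_sum_partialQ e.open_target Λ hkN hΛ hx,
    contr_apply _ hx]
  simp only [pad_snd, pad_fst, mul_zero, add_zero]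
  refine Eq.trans ?_ ((sum_range_shift hβ (k := k) (g := fun i => (i.descFactorial β : ℝ) •
    (partialQ e.open_target Λ i).1 (pad k N (extCoord e y)) (ev (i - β + 1) (y.1.coord e)))
    ?_).trans ?_)
  · refine Finset.sum_congr rfl fun i hi => ?_
    rw [Finset.mem_range] at hi
    rw [ev_tr (by omega), ev_jetDelta hβ (by omega)]
    split_ifs
    · rw [map_smul]
    · rw [map_zero]
  · intro i hi
    rw [partialQ_eq_zero e.open_target Λ hΛ hi]
    exact smul_zero _
  · refine Finset.sum_congr rfl fun γ hγ => ?_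
    rw [Finset.mem_range] at hγ
    rw [Nat.add_sub_cancel, ev_tr (by omega)]
    rfl

/-- The coefficients of `D_L^m i(J_β) dL`. -/
noncomputable def verticalCoeffIter {T : Set (Model n)} (hT : IsOpen T)
    (Λ : smoothFun (jetDomain n N T) ℝ) (β m : ℕ) :
    ℕ → smoothFun (jetDomain n N T) (Model n →L[ℝ] ℝ) :=
  (seqD (totalD hT Λ))^[m] (verticalCoeff hT Λ β)

theorem verticalCoeffIter_succ {T : Set (Model n)} (hT : IsOpen T)
    (Λ : smoothFun (jetDomain n N T) ℝ) (β m : ℕ) :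
    verticalCoeffIter hT Λ β (m + 1) = seqD (totalD hT Λ) (verticalCoeffIter hT Λ β m) :=
  Function.iterate_succ_apply' _ _ _

theorem dependsUpTo_verticalCoeffIter {T : Set (Model n)} (hT : IsOpen T)
    (Λ : smoothFun (jetDomain n N T) ℝ) (hΛ : DependsUpTo k Λ.1) (β m : ℕ) :
    ∀ γ, DependsUpTo (k + m) (verticalCoeffIter hT Λ β m γ).1 := by
  induction m with
  | zero => exact dependsUpTo_verticalCoeff hT Λ hΛ β
  | succ m ih =>
    rw [verticalCoeffIter_succ]
    exact DependsUpTo.seqD hT Λ hΛ (Nat.le_add_right k m) ih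

/-- The coefficients of `i(J_β)dL` stop at index `k - β`, and `m` derivatives move the end to at
most `k - β + m`, which is below `k - 1` when `m + 2 ≤ β`. Thus each of the `β - 1` derivatives
taken in the Cartan form starts from a form with no `dq_{k-1}` term. -/
theorem verticalCoeffIter_last {T : Set (Model n)} (hT : IsOpen T)
    (Λ : smoothFun (jetDomain n N T) ℝ) (hΛ : DependsUpTo k Λ.1) {β m : ℕ} (hβk : β ≤ k)
    (h : m + 2 ≤ β) : verticalCoeffIter hT Λ β m (k - 1) = 0 := by
  unfold verticalCoeffIter
  exact seqD_iterate_of_le (m := k + 1 - β) (f := verticalCoeff hT Λ β) (totalD hT Λ)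
    (fun i hi => verticalCoeff_eq_zero hT Λ hΛ (show k < i + β by omega)) m (k - 1) (by omega)

theorem isFormRep_DLFormIter (hk : 1 ≤ k) {β : ℕ} (hβk : β ≤ k) (m : ℕ)
    (hmβ : m + 1 ≤ β) (hmN : k + m ≤ N) :
    IsFormRep k e (DLFormIter L (fun y => (dfun (extModel n k) L y).comp (extJ β y)) m)
      (verticalCoeffIter e.open_target (localLagrangian he hL N) β m) := by
  induction m with
  | zero => exact isFormRep_extJ he hL (by omega) (by omega)
  | succ m ih =>
    rw [verticalCoeffIter_succ]
    exact (ih (by omega) (by omega)).DLForm he hL hk (Nat.le_add_right k m) (by omega)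
      (dependsUpTo_verticalCoeffIter _ _ (dependsUpTo_localLagrangian he hL N) β m)
      (verticalCoeffIter_last _ _ (dependsUpTo_localLagrangian he hL N) hβk (by omega))

/-- By `totalD_contr`, contraction passes through each total derivative, so every term of the energy
is the contraction of the corresponding term of `θ_L`. -/
theorem isLocalRep_DLIter (hk : 1 ≤ k) {β : ℕ} (hβk : β ≤ k) (m : ℕ)
    (hmβ : m + 1 ≤ β) (hmN : k + m ≤ N) :
    IsLocalRep e (DLIter L (fun y => dfun (extModel n k) L y (extDelta β y)) m)
      (contr k (verticalCoeffIter e.open_target (localLagrangian he hL N) β m)) := by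
  have hΛ := dependsUpTo_localLagrangian he hL N
  induction m with
  | zero => exact isLocalRep_extDelta he hL (by omega) (by omega)
  | succ m ih =>
    rw [verticalCoeffIter_succ, ← totalD_contr e.open_target _ hk (by omega)
      (verticalCoeffIter_last _ _ hΛ hβk (by omega))]
    exact (ih (by omega) (by omega)).DL he hL (Nat.le_add_right k m) (by omega)
      (DependsUpTo.contr (Nat.le_add_right k m) (dependsUpTo_verticalCoeffIter _ _ hΛ β m))

theorem sum_verticalCoeffIter {T : Set (Model n)} (hT : IsOpen T)
    (Λ : smoothFun (jetDomain n N T) ℝ) (hΛ : DependsUpTo k Λ.1) (γ : ℕ) :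
    ∑ b ∈ Finset.range k, ((-1 : ℝ) ^ b / (b + 1).factorial) •
      verticalCoeffIter hT Λ (b + 1) b γ = momentum hT Λ k γ := by
  have h := sum_seqD_iterate_eq_momentumSeq (k := k) (totalD hT Λ) (ℓ := partialQ hT Λ)
    (fun _ hi => partialQ_eq_zero hT Λ hΛ hi) γ
  unfold momentum
  rw [← h]
  refine Finset.sum_congr rfl fun b _ => ?_
  unfold verticalCoeffIter
  congr 1

theorem isFormRep_cartanForm (hk : 1 ≤ k) :
    IsFormRep k e (cartanForm L)
      (momentum e.open_target (localLagrangian he hL (2 * k - 1)) k) := by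
  intro y hy v
  set Λ := localLagrangian he hL (2 * k - 1)
  have hΛ : DependsUpTo k Λ.1 := dependsUpTo_localLagrangian he hL _
  set x := pad (2 * k - 1) (2 * k - 1) (extCoord e y)
  have h1 : formAt (cartanForm L) y v = ∑ b : Fin k,
      ((-1 : ℝ) ^ (b : ℕ) / ((b : ℕ) + 1).factorial) *
        ∑ i ∈ Finset.range k, (verticalCoeffIter e.open_target Λ ((b : ℕ) + 1) b i).1 x
          (ev i (extDeriv e y v).1) := by
    have : formAt (cartanForm L) y = ∑ b : Fin k,
      ((-1 : ℝ) ^ (b : ℕ) / ((b : ℕ) + 1).factorial) • formAt (pullForm (by omega)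
        (DLFormIter L (fun y => (dfun (extModel n k) L y).comp (extJ ((b : ℕ) + 1) y)) b)) y := rfl
    rw [this, sum_apply]
    refine Finset.sum_congr rfl fun b _ => ?_
    rw [smul_apply, smul_eq_mul]
    congr 1
    exact (isFormRep_DLFormIter (N := 2 * k - 1) he hL hk (by omega) b (by omega)
      (by omega)).pullForm he (Nat.le_add_right k b) (by omega)
      (dependsUpTo_verticalCoeffIter _ _ hΛ _ b) (by omega) y hy v
  rw [h1, Fin.sum_univ_eq_sum_range (fun b => ((-1 : ℝ) ^ b / (b + 1).factorial) *
        ∑ i ∈ Finset.range k, (verticalCoeffIter e.open_target Λ (b + 1) b i).1 x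
          (ev i (extDeriv e y v).1))]
  simp_rw [Finset.mul_sum]
  rw [Finset.sum_comm]
  refine Finset.sum_congr rfl fun i _ => ?_
  rw [← sum_verticalCoeffIter e.open_target Λ hΛ, smoothFun.coe_sum, sum_apply]
  rfl

/-- The energy in natural coordinates. -/
noncomputable def localEnergy {T : Set (Model n)} (hT : IsOpen T) (k : ℕ)
    (Λ : smoothFun (jetDomain n N T) ℝ) : smoothFun (jetDomain n N T) ℝ :=
  contr k (momentum hT Λ k) - Λ

theorem isLocalRep_energy (hk : 1 ≤ k) :
    IsLocalRep e (energy hk L)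
      (localEnergy e.open_target k (localLagrangian he hL (2 * k - 1))) := by
  intro y hy
  set Λ := localLagrangian he hL (2 * k - 1)
  have hΛ : DependsUpTo k Λ.1 := dependsUpTo_localLagrangian he hL _
  set x := pad (2 * k - 1) (2 * k - 1) (extCoord e y)
  have hx : x ∈ jetDomain n (2 * k - 1) e.target := pad_extCoord_mem he hy
  have h0 : L (extProj (by omega) y) = Λ.1 x :=
    (isLocalRep_lagrangian he hL (by omega)).comp_extProj he (by omega) hΛ (by omega) y hy
  have h1 : ∀ b : Fin k, DLIter L (fun y => dfun (extModel n k) L y (extDelta ((b : ℕ) + 1) y)) b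
      (extProj (by omega) y) = ∑ i ∈ Finset.range k,
        (verticalCoeffIter e.open_target Λ ((b : ℕ) + 1) b i).1 x (ev (i + 1) x.1) := fun b => by
    rw [← contr_apply _ hx]
    exact (isLocalRep_DLIter (N := 2 * k - 1) he hL hk (by omega) b (by omega)
      (by omega)).comp_extProj he (by omega) (DependsUpTo.contr (Nat.le_add_right k b)
        (dependsUpTo_verticalCoeffIter _ _ hΛ _ b)) (by omega) y hy
  rw [energy, h0]
  simp_rw [h1]
  rw [Fin.sum_univ_eq_sum_range (fun b => ((-1 : ℝ) ^ b / (b + 1).factorial) *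
        ∑ i ∈ Finset.range k, (verticalCoeffIter e.open_target Λ (b + 1) b i).1 x
          (ev (i + 1) x.1))]
  change _ = (contr k (momentum e.open_target Λ k)).1 x - Λ.1 x
  rw [contr_apply _ hx]
  congr 1
  simp_rw [Finset.mul_sum]
  rw [Finset.sum_comm]
  refine Finset.sum_congr rfl fun i _ => ?_
  rw [← sum_verticalCoeffIter e.open_target Λ hΛ, smoothFun.coe_sum, sum_apply]
  rfl

end CartanForm

/-! ### The two systems of equations in coordinates -/

section CoordinateEquations

variable {n N k : ℕ} {T : Set (Model n)} (hT : IsOpen T) (Λ : smoothFun (jetDomain n N T) ℝ)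

/-- The coordinate expression of the equations `X(p_i) = ∂Λ/∂q_i - p_{i-1} + (∂Λ/∂z) p_i`. -/
def MomentumEquations (k : ℕ) (x X : ExtModel n N) : Prop :=
  ∀ i < k, ∀ u : Model n, fderiv ℝ (momentum hT Λ k i).1 x X u =
    (partialQ hT Λ i).1 x u - (if i = 0 then 0 else (momentum hT Λ k (i - 1)).1 x u) +
      dzCoord Λ x * (momentum hT Λ k i).1 x u

variable {hT Λ}

/-- After shifting the index, the top term `p_{k-1}(v_k)` cancels `∂Λ/∂q_k (v_k)`, because `p_{k-1}
= ∂Λ/∂q_k`. Only directions in `q_0, …, q_{k-1}` and `z` remain, so neither system imposes further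
conditions in the higher directions. -/
theorem sum_momentum_sub_fderiv (hk : 1 ≤ k) (hkN : k ≤ N) (hΛ : DependsUpTo k Λ.1)
    {x : ExtModel n N} (hx : x ∈ jetDomain n N T) (v : ExtModel n N) :
    ∑ i ∈ Finset.range k, (momentum hT Λ k i).1 x (ev (i + 1) v.1) - fderiv ℝ Λ.1 x v =
      ∑ i ∈ Finset.range k, ((if i = 0 then 0 else (momentum hT Λ k (i - 1)).1 x (ev i v.1)) -
        (partialQ hT Λ i).1 x (ev i v.1)) - dzCoord Λ x * v.2 := by
  have h1 := Finset.sum_range_succ'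
    (fun i => if i = 0 then 0 else (momentum hT Λ k (i - 1)).1 x (ev i v.1)) k
  rw [Finset.sum_range_succ, if_neg (by omega), momentum_last hT Λ hk hΛ] at h1
  simp only [Nat.add_eq_zero_iff, one_ne_zero, and_false, if_false, if_true, add_zero,
    Nat.add_sub_cancel] at h1
  rw [fderiv_eq_sum_partialQ hT Λ hkN hΛ hx v, ← h1, Finset.sum_range_succ,
    Finset.sum_sub_distrib]
  ring

theorem fderiv_localEnergy (hk : 1 ≤ k) (hkN : k ≤ N) (hΛ : DependsUpTo k Λ.1)
    {x : ExtModel n N} (hx : x ∈ jetDomain n N T) (v : ExtModel n N) :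
    fderiv ℝ (localEnergy hT k Λ).1 x v =
      ∑ i ∈ Finset.range k, fderiv ℝ (momentum hT Λ k i).1 x v (ev (i + 1) x.1) +
      (∑ i ∈ Finset.range k, ((if i = 0 then 0 else (momentum hT Λ k (i - 1)).1 x (ev i v.1)) -
        (partialQ hT Λ i).1 x (ev i v.1)) - dzCoord Λ x * v.2) := by
  have h1 : (localEnergy hT k Λ).1 = (contr k (momentum hT Λ k)).1 - Λ.1 := rfl
  have hO := isOpen_jetDomain (N := N) hT
  rw [h1, ((smoothFun.hasFDerivAt hO _ hx).sub (smoothFun.hasFDerivAt hO Λ hx)).fderiv, sub_apply,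
    fderiv_contr hT _ hx, Finset.sum_add_distrib, ← sum_momentum_sub_fderiv hk hkN hΛ hx]
  ring

theorem sum_apply_jetSingle {f : ℕ → Model n →L[ℝ] ℝ} {j : ℕ} (hj : j < k) (hkN : k ≤ N + 1)
    (u : Model n) :
    ∑ i ∈ Finset.range k, f i (ev i (jetSingle N j u)) = f j u := by
  rw [Finset.sum_eq_single j]
  · rw [ev_jetSingle (by omega), if_pos rfl]
  · intro i hi hij
    rw [Finset.mem_range] at hi
    rw [ev_jetSingle (by omega), if_neg hij, map_zero]
  · intro h
    exact absurd (Finset.mem_range.2 hj) h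

/-- Since `X_i = q_{i+1}` for `i < k`, the terms `v(p_i)(X_i)` of `dη_L` match the terms
`v(p_i)(q_{i+1})` of `dE_L`. What is left is linear in `v_0, …, v_{k-1}` and `v_z`: the `z`
direction gives the rate, the others the momentum equations. -/
theorem lagrangianEquations_iff (hk : 1 ≤ k) (hkN : k ≤ N) (hΛ : DependsUpTo k Λ.1)
    {x : ExtModel n N} (hx : x ∈ jetDomain n N T) {X : ExtModel n N}
    (hX : ∀ i < k, ev i X.1 = ev (i + 1) x.1) (ρ : ℝ) :
    (∀ v : ExtModel n N, -∑ i ∈ Finset.range k, (fderiv ℝ (momentum hT Λ k i).1 x X (ev i v.1) -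
        fderiv ℝ (momentum hT Λ k i).1 x v (ev i X.1)) =
      fderiv ℝ (localEnergy hT k Λ).1 x v -
        ρ * (v.2 - ∑ i ∈ Finset.range k, (momentum hT Λ k i).1 x (ev i v.1))) ↔
    ρ = -dzCoord Λ x ∧ MomentumEquations hT Λ k x X := by
  have key : ∀ v : ExtModel n N,
      (-∑ i ∈ Finset.range k, (fderiv ℝ (momentum hT Λ k i).1 x X (ev i v.1) -
        fderiv ℝ (momentum hT Λ k i).1 x v (ev i X.1)) =
      fderiv ℝ (localEnergy hT k Λ).1 x v -
        ρ * (v.2 - ∑ i ∈ Finset.range k, (momentum hT Λ k i).1 x (ev i v.1))) ↔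
      ∑ i ∈ Finset.range k, (fderiv ℝ (momentum hT Λ k i).1 x X (ev i v.1) +
        (if i = 0 then 0 else (momentum hT Λ k (i - 1)).1 x (ev i v.1)) -
        (partialQ hT Λ i).1 x (ev i v.1) + ρ * (momentum hT Λ k i).1 x (ev i v.1)) =
      (dzCoord Λ x + ρ) * v.2 := by
    intro v
    have h1 : ∑ i ∈ Finset.range k, fderiv ℝ (momentum hT Λ k i).1 x v (ev i X.1) =
        ∑ i ∈ Finset.range k, fderiv ℝ (momentum hT Λ k i).1 x v (ev (i + 1) x.1) :=
      Finset.sum_congr rfl fun i hi => by rw [hX i (Finset.mem_range.1 hi)]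
    rw [fderiv_localEnergy hk hkN hΛ hx, Finset.sum_sub_distrib, h1]
    simp only [Finset.sum_add_distrib, Finset.sum_sub_distrib, ← Finset.mul_sum]
    constructor <;> intro h <;> linarith
  simp only [key]
  constructor
  · intro h
    have h0 : ρ = -dzCoord Λ x := by
      -- The direction `∂/∂z` isolates the rate.
      have := h (0, 1)
      simp only [map_zero, mul_zero, ite_self, add_zero, sub_zero, Finset.sum_const_zero] at this
      linarith
    refine ⟨h0, fun j hj u => ?_⟩
    have h2 := h (jetSingle N j u, 0)
    rw [mul_zero] at h2
    have h3 := sum_apply_jetSingle (N := N) (f := fun i => fderiv ℝ (momentum hT Λ k i).1 x X +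
        (if i = 0 then 0 else (momentum hT Λ k (i - 1)).1 x) -
        (partialQ hT Λ i).1 x + ρ • (momentum hT Λ k i).1 x) hj (by omega) u
    have h4 : ∀ i (w : Model n), (if i = 0 then (0 : Model n →L[ℝ] ℝ)
        else (momentum hT Λ k (i - 1)).1 x) w =
        if i = 0 then 0 else (momentum hT Λ k (i - 1)).1 x w := fun i w => by
      split_ifs <;> rfl
    simp only [add_apply, sub_apply, smul_apply, smul_eq_mul, h4] at h3
    rw [h2] at h3
    rw [h0] at h3
    linarith
  · rintro ⟨rfl, h⟩ v
    rw [add_neg_cancel, zero_mul]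
    refine Finset.sum_eq_zero fun i hi => ?_
    rw [h i (Finset.mem_range.1 hi)]
    ring

/-- Covector directions give `X_i = q_{i+1}`, and the directions `∂/∂q_j` with `j < k` give the
momentum equations. The remaining directions are automatic on the graph, by
`sum_momentum_sub_fderiv` and the rate `-∂Λ/∂z`. -/
theorem unifiedEquations_iff (hk : 1 ≤ k) (hkN : k ≤ N) (hΛ : DependsUpTo k Λ.1)
    {x : ExtModel n N} (hx : x ∈ jetDomain n N T) {X : ExtModel n N} :
    (∀ v : ExtModel n N × (JetModel n (k - 1) →L[ℝ] ℝ),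
      -(fderiv ℝ (covec k (k - 1) (momentum hT Λ k)) x X (tr N (k - 1) v.1.1) -
          v.2 (tr N (k - 1) X.1)) =
        (v.2 (sh N (k - 1) x.1) + covec k (k - 1) (momentum hT Λ k) x (sh N (k - 1) v.1.1) -
          fderiv ℝ Λ.1 x v.1) +
        dzCoord Λ x * (v.1.2 - covec k (k - 1) (momentum hT Λ k) x (tr N (k - 1) v.1.1))) ↔
    (∀ i < k, ev i X.1 = ev (i + 1) x.1) ∧ MomentumEquations hT Λ k x X := by
  have key : ∀ v : ExtModel n N,
      covec k (k - 1) (momentum hT Λ k) x (sh N (k - 1) v.1) - fderiv ℝ Λ.1 x v =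
      ∑ i ∈ Finset.range k, ((if i = 0 then 0 else (momentum hT Λ k (i - 1)).1 x (ev i v.1)) -
        (partialQ hT Λ i).1 x (ev i v.1)) - dzCoord Λ x * v.2 := by
    intro v
    rw [← sum_momentum_sub_fderiv hk hkN hΛ hx, covec_apply]
    congr 1
    refine Finset.sum_congr rfl fun i hi => ?_
    rw [Finset.mem_range] at hi
    rw [ev_sh (by omega)]
  have htr : ∀ (v : JetModel n N), covec k (k - 1) (momentum hT Λ k) x (tr N (k - 1) v) =
      ∑ i ∈ Finset.range k, (momentum hT Λ k i).1 x (ev i v) := by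
    intro v
    rw [covec_apply]
    refine Finset.sum_congr rfl fun i hi => ?_
    rw [Finset.mem_range] at hi
    rw [ev_tr (by omega)]
  have hdtr : ∀ (v : JetModel n N),
      fderiv ℝ (covec k (k - 1) (momentum hT Λ k)) x X (tr N (k - 1) v) =
      ∑ i ∈ Finset.range k, fderiv ℝ (momentum hT Λ k i).1 x X (ev i v) := by
    intro v
    rw [fderiv_covec hT _ hx]
    refine Finset.sum_congr rfl fun i hi => ?_
    rw [Finset.mem_range] at hi
    rw [ev_tr (by omega)]
  have heq : (∀ i < k, ev i X.1 = ev (i + 1) x.1) ↔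
      tr N (k - 1) X.1 = sh N (k - 1) x.1 := by
    constructor
    · intro h
      refine jet_ext fun i hi => ?_
      rw [ev_tr hi, ev_sh hi, h i (by omega)]
    · intro h i hi
      rw [← ev_tr (show i ≤ k - 1 by omega), h, ev_sh (by omega)]
  rw [heq]
  constructor
  · intro h
    have h0 : tr N (k - 1) X.1 = sh N (k - 1) x.1 := by
      funext α
      refine ext_inner_left ℝ fun u => ?_
      -- Covectors of the form `⟨u, ·⟩` on a single coordinate suffice to separate jets.
      have := h (0, (innerSL ℝ u).comp
        (ContinuousLinearMap.proj (R := ℝ) (φ := fun _ : Fin (k - 1 + 1) => Model n) α))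
      simpa using this
    refine ⟨h0, fun j hj u => ?_⟩
    have h2 := h ((jetSingle N j u, 0), 0)
    have h5 := key (jetSingle N j u, 0)
    simp only [hdtr, htr, zero_apply, sub_zero, zero_add, zero_sub, mul_zero] at h2 h5
    rw [h5, sum_apply_jetSingle hj (by omega), sum_apply_jetSingle hj (by omega)] at h2
    have h3 := sum_apply_jetSingle (N := N) (f := fun i =>
        (if i = 0 then 0 else (momentum hT Λ k (i - 1)).1 x) -
        (partialQ hT Λ i).1 x) hj (by omega) u
    have h4 : ∀ i (w : Model n), (if i = 0 then (0 : Model n →L[ℝ] ℝ)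
        else (momentum hT Λ k (i - 1)).1 x) w =
        if i = 0 then 0 else (momentum hT Λ k (i - 1)).1 x w := fun i w => by
      split_ifs <;> rfl
    simp only [sub_apply, h4] at h3
    rw [h3] at h2
    linarith
  · rintro ⟨h0, h⟩ v
    have h5 := key v.1
    rw [hdtr, htr, h0, Finset.sum_congr rfl fun i hi => h i (Finset.mem_range.1 hi) (ev i v.1.1)]
    simp only [Finset.sum_add_distrib, Finset.sum_sub_distrib, ← Finset.mul_sum] at h5 ⊢
    linarith

/-- This is the recursion for the momenta solved for `D p_i`. The total field thus satisfies every
momentum equation with `i ≥ 1` identically. -/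
theorem fderiv_momentum_totalField (hk : 1 ≤ k) (hΛ : DependsUpTo k Λ.1)
    {x : ExtModel n N} (hx : x ∈ jetDomain n N T) {i : ℕ} (hi : 1 ≤ i) (u : Model n) :
    fderiv ℝ (momentum hT Λ k i).1 x (totalField Λ x) u =
      (partialQ hT Λ i).1 x u - (momentum hT Λ k (i - 1)).1 x u +
        dzCoord Λ x * (momentum hT Λ k i).1 x u := by
  have h := momentum_eq hT Λ hk hΛ (i - 1)
  rw [Nat.sub_add_cancel hi] at h
  have h1 : (momentum hT Λ k (i - 1)).1 x u = (partialQ hT Λ i).1 x u -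
      (totalD hT Λ (momentum hT Λ k i)).1 x u := by
    rw [h]; rfl
  rw [h1, totalD_apply hT Λ _ hx, sub_apply, smul_apply, smul_eq_mul]
  ring

/-- Induction on the number of components already known. Once `X` agrees with the total field below
`q_{k+m}`, both have the same derivative on `p_{k-1-m}`, which sees the next component of their
difference only through the Hessian. -/
theorem eq_totalField_of_regular (hk : 1 ≤ k) (hN : N + 1 = 2 * k) (hΛ : DependsUpTo k Λ.1)
    {x : ExtModel n N} (hx : x ∈ jetDomain n N T)
    (hreg : ∀ u : Model n,
      (∀ v, fderiv ℝ (partialQ hT Λ k).1 x (jetSingle N k u, 0) v = 0) → u = 0)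
    {X : ExtModel n N} (hX : ∀ i < k, ev i X.1 = ev (i + 1) x.1) (hz : X.2 = Λ.1 x)
    (h : MomentumEquations hT Λ k x X) : ∀ i < N, ev i X.1 = ev (i + 1) x.1 := by
  have hΓ : ∀ i ≤ N, ev i (totalField Λ x).1 = ev (i + 1) x.1 := fun i hi => ev_sh hi _
  suffices H : ∀ m, m ≤ k - 1 → ∀ i < k + m, ev i X.1 = ev (i + 1) x.1 by
    intro i hi
    exact H (k - 1) le_rfl i (by omega)
  intro m
  induction m with
  | zero => exact fun _ => hX
  | succ m ih =>
    intro hm i hi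
    specialize ih (by omega)
    rcases Nat.lt_or_ge i (k + m) with h' | h'
    · exact ih i h'
    obtain rfl : i = k + m := by omega
    rw [← hΓ _ (by omega), ← sub_eq_zero, ← map_sub]
    -- `p_j` has order at most `k + m`, and its derivative in `q_{k+m}` is the Hessian up to sign.
    -- Moreover `m + 1 ≤ k - 1` gives `j ≥ 1`, so that the total field satisfies the equation for
    -- `p_j`.
    set j := k - 1 - m
    have hj : j + m = k - 1 := by omega
    refine hreg _ fun v => ?_
    have h1 : AgreeUpTo (k + m) (X - totalField Λ x)
        (jetSingle N (k + m) (ev (k + m) (X.1 - (totalField Λ x).1)), 0) := by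
      refine ⟨fun i hi => ?_, ?_⟩
      · rw [ev_jetSingle (by omega)]
        split_ifs with hik
        · rw [hik]; rfl
        · change ev i (X.1 - (totalField Λ x).1) = 0
          rw [map_sub, hΓ i (by omega), ih i (by omega), sub_self]
      · change X.2 - Λ.1 x = 0
        rw [hz, sub_self]
    have h2 := (dependsUpTo_momentum hT Λ hk hΛ m j hj).fderiv_dir x h1
    rw [fderiv_momentum_top hT Λ hk hN hΛ hx _ m j hj, map_sub] at h2
    have h3 := congrArg (fun l => l v) h2
    rw [sub_apply, h j (by omega) v, fderiv_momentum_totalField hk hΛ hx (by omega),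
      if_neg (by omega), sub_self, smul_apply] at h3
    exact (smul_eq_zero.1 h3.symm).resolve_left (by simp)

end CoordinateEquations

/-! ### Antisymmetry of the exterior derivative -/

section AntiSymmetry

variable {E H M : Type*} [NormedAddCommGroup E] [NormedSpace ℝ E] [TopologicalSpace H]
  {I : ModelWithCorners ℝ E H} [TopologicalSpace M] [ChartedSpace H M]

theorem extDAt_swap (ξ : OneForm I M) (x : M) (u v : E) :
    extDAt ξ x u v = -extDAt ξ x v u := by
  simp only [extDAt, extD]
  change (_ - _ : ℝ) = -(_ - _ : ℝ)
  rw [neg_sub]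
  rfl

end AntiSymmetry

/-! ### The contact Lagrangian equations at a point -/

section LagrangianSide

variable {n k r s N : ℕ} {Q : Type*} [TopologicalSpace Q] [ChartedSpace (Model n) Q]
  [IsManifold 𝓘(ℝ, Model n) ∞ Q] {e : OpenPartialHomeomorph Q (Model n)}
  {L : ExtJet n k Q → ℝ} (he : e ∈ atlas (Model n) Q)
  (hL : ContMDiff (extModel n k) 𝓘(ℝ, ℝ) ∞ L)

theorem formAt_contactForm (hk : 1 ≤ k) {y : ExtJet n (2 * k - 1) Q}
    (hy : y.1.base ∈ e.source) (v : ExtModel n (2 * k - 1)) :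
    formAt (contactForm L) y v = (extDeriv e y v).2 - ∑ i ∈ Finset.range k,
      (momentum e.open_target (localLagrangian he hL (2 * k - 1)) k i).1 (extCoord e y)
        (ev i (extDeriv e y v).1) := by
  have h1 : formAt (contactForm L) y v =
      tmap (extModel n (2 * k - 1)) 𝓘(ℝ, ℝ) Prod.snd y v - formAt (cartanForm L) y v := rfl
  rw [h1, isFormRep_cartanForm he hL hk y hy v, pad_self]
  congr 1
  exact tmap_clm_comp (ContinuousLinearMap.snd ℝ (JetModel n (2 * k - 1)) ℝ)
    ((contMDiffAt_extCoord he hy).mdifferentiableAt (by simp)) v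

theorem extDAt_contactForm (hk : 1 ≤ k) {y : ExtJet n (2 * k - 1) Q}
    (hy : y.1.base ∈ e.source) (u v : ExtModel n (2 * k - 1)) :
    extDAt (contactForm L) y u v = -∑ i ∈ Finset.range k,
      (fderiv ℝ (momentum e.open_target (localLagrangian he hL (2 * k - 1)) k i).1 (extCoord e y)
          (extDeriv e y u) (ev i (extDeriv e y v).1) -
        fderiv ℝ (momentum e.open_target (localLagrangian he hL (2 * k - 1)) k i).1 (extCoord e y)
          (extDeriv e y v) (ev i (extDeriv e y u).1)) := by
  set p := momentum e.open_target (localLagrangian he hL (2 * k - 1)) k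
  let l : (JetModel n (2 * k - 1) →L[ℝ] ℝ) →L[ℝ] (ExtModel n (2 * k - 1) →L[ℝ] ℝ) :=
    (ContinuousLinearMap.compL ℝ (ExtModel n (2 * k - 1)) (JetModel n (2 * k - 1)) ℝ).flip
      (ContinuousLinearMap.fst ℝ _ _)
  have hrep := isLocalRep_covec (k := k) (r := 2 * k - 1) (s := 2 * k - 1) p he
  have hc := hrep.contMDiffAt he hy
  have hf : ContMDiffAt (extModel n (2 * k - 1)) 𝓘(ℝ, ExtModel n (2 * k - 1) →L[ℝ] ℝ) ∞
      (fun z : ExtJet n (2 * k - 1) Q => ContinuousLinearMap.snd ℝ (JetModel n (2 * k - 1)) ℝ -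
        l (covec k (2 * k - 1) p (pad _ (2 * k - 1) (extCoord e z)))) y :=
    contMDiffAt_const.sub (l.contDiff.contMDiff.contMDiffAt.comp y hc)
  have hd : ∀ u v, tmap (extModel n (2 * k - 1)) 𝓘(ℝ, ExtModel n (2 * k - 1) →L[ℝ] ℝ)
      (fun z : ExtJet n (2 * k - 1) Q => ContinuousLinearMap.snd ℝ (JetModel n (2 * k - 1)) ℝ -
        l (covec k (2 * k - 1) p (pad _ (2 * k - 1) (extCoord e z)))) y u v =
      -∑ i ∈ Finset.range k, fderiv ℝ (p i).1 (extCoord e y) (extDeriv e y u) (ev i v.1) := by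
    intro u v
    let c : (JetModel n (2 * k - 1) →L[ℝ] ℝ) → (ExtModel n (2 * k - 1) →L[ℝ] ℝ) := fun a =>
      ContinuousLinearMap.snd ℝ (JetModel n (2 * k - 1)) ℝ - l a
    have hc' : HasFDerivAt c (-l) (covec k (2 * k - 1) p (pad _ (2 * k - 1) (extCoord e y))) :=
      l.hasFDerivAt.const_sub _
    have := tmap_comp (I := extModel n (2 * k - 1)) (g := c)
      (I'' := 𝓘(ℝ, ExtModel n (2 * k - 1) →L[ℝ] ℝ))
      (f := fun z : ExtJet n (2 * k - 1) Q => covec k (2 * k - 1) p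
        (pad _ (2 * k - 1) (extCoord e z))) (x := y)
      hc'.differentiableAt.mdifferentiableAt (hc.mdifferentiableAt (by simp)) u
    rw [tmap_eq_fderiv, hc'.fderiv, hrep.tmap_eq he hy, pad_self, pad_self] at this
    refine (congrArg (fun l => l v) this).trans ?_
    rw [smoothFun.fderiv_mk (isOpen_jetDomain e.open_target) _ (extCoord_mem_jetDomain he hy),
      ← fderiv_covec e.open_target p (extCoord_mem_jetDomain he hy)]
    rfl
  rw [extD_eq hf (contMDiffAt_extCoord he hy) ?_ u v, hd, hd, Finset.sum_sub_distrib]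
  · simp only [extDeriv]
    ring
  · filter_upwards [(isOpen_extDomain he).mem_nhds hy] with z hz v
    rw [formAt_contactForm he hL hk hz, sub_apply, pad_self]
    congr 1
    exact (covec_apply p _ _).symm

theorem tmap_energy (hk : 1 ≤ k) {y : ExtJet n (2 * k - 1) Q}
    (hy : y.1.base ∈ e.source) (v : ExtModel n (2 * k - 1)) :
    tmap (extModel n (2 * k - 1)) 𝓘(ℝ, ℝ) (energy hk L) y v =
      fderiv ℝ (localEnergy e.open_target k (localLagrangian he hL (2 * k - 1))).1
        (extCoord e y) (extDeriv e y v) := by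
  rw [(isLocalRep_energy he hL hk).tmap_eq he hy, pad_self, pad_self]

theorem energy_eq (hk : 1 ≤ k) {y : ExtJet n (2 * k - 1) Q} (hy : y.1.base ∈ e.source) :
    energy hk L y = ∑ i ∈ Finset.range k,
      (momentum e.open_target (localLagrangian he hL (2 * k - 1)) k i).1 (extCoord e y)
        (ev (i + 1) (extCoord e y).1) -
      (localLagrangian he hL (2 * k - 1)).1 (extCoord e y) := by
  rw [← contr_apply _ (extCoord_mem_jetDomain he hy), isLocalRep_energy he hL hk y hy, pad_self]
  rfl

/-- The hypothesis `hT` says that `e` induces the identification of the tangent space at `y` with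
the model; it holds for the preferred chart of the base point. -/
theorem contactLagrangianEq_iff (hk : 1 ≤ k) {y : ExtJet n (2 * k - 1) Q}
    (hy : y.1.base ∈ e.source) (hT : ∀ v, extDeriv e y v = v) {X : ExtModel n (2 * k - 1)}
    (hX : ∀ i < k, ev i X.1 = ev (i + 1) (extCoord e y).1) (ρ : ℝ) :
    (∀ v : ExtModel n (2 * k - 1), extDAt (contactForm L) y X v =
      tmap (extModel n (2 * k - 1)) 𝓘(ℝ, ℝ) (energy hk L) y v -
        ρ * formAt (contactForm L) y v) ↔
    ρ = -dzCoord (localLagrangian he hL (2 * k - 1)) (extCoord e y) ∧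
      MomentumEquations e.open_target (localLagrangian he hL (2 * k - 1)) k (extCoord e y) X := by
  rw [← lagrangianEquations_iff hk (by omega) (dependsUpTo_localLagrangian he hL _)
    (extCoord_mem_jetDomain he hy) hX]
  refine forall_congr' fun v => ?_
  rw [extDAt_contactForm he hL hk hy, tmap_energy he hL hk hy, formAt_contactForm he hL hk hy,
    hT, hT]

/-- Under `X_i = q_{i+1}` for `i < k`, the sum `∑ p_i q_{i+1}` occurs in both `η_L(X)` and `-E_L`
and cancels. -/
theorem formAt_contactForm_eq_neg_energy_iff (hk : 1 ≤ k) {y : ExtJet n (2 * k - 1) Q}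
    (hy : y.1.base ∈ e.source) (hT : ∀ v, extDeriv e y v = v) {X : ExtModel n (2 * k - 1)}
    (hX : ∀ i < k, ev i X.1 = ev (i + 1) (extCoord e y).1) :
    formAt (contactForm L) y X = -energy hk L y ↔
      X.2 = (localLagrangian he hL (2 * k - 1)).1 (extCoord e y) := by
  have h1 : ∑ i ∈ Finset.range k, (momentum e.open_target (localLagrangian he hL (2 * k - 1)) k i).1
        (extCoord e y) (ev i X.1) = ∑ i ∈ Finset.range k,
      (momentum e.open_target (localLagrangian he hL (2 * k - 1)) k i).1 (extCoord e y)
        (ev (i + 1) (extCoord e y).1) :=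
    Finset.sum_congr rfl fun i hi => by rw [hX i (Finset.mem_range.1 hi)]
  rw [formAt_contactForm he hL hk hy, energy_eq he hL hk hy, hT, h1]
  constructor <;> intro h <;> linarith

/-- The component of index `i + 1` of `J₁(X) = Δ₁` is the wanted equation multiplied by `i + 1 ≠ 0`,
and the component of index `0` is trivial. -/
theorem isHolonomicVector_iff {y : ExtJet n r Q} (he : e ∈ atlas (Model n) Q)
    (hy : y.1.base ∈ e.source) (hT : ∀ v, extDeriv e y v = v) (X : ExtModel n r) :
    IsHolonomicVector y X ↔ ∀ i < r, ev i X.1 = ev (i + 1) (extCoord e y).1 := by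
  have h1 := (hT (extJ 1 y X)).symm.trans (extDeriv_extJ he hy 1 X)
  have h2 := (hT (extDelta 1 y)).symm.trans (extDeriv_extDelta (r := r) he hy (le_refl 1))
  rw [hT] at h1
  have h3 : IsHolonomicVector y X ↔
      ((jetJ r 1 X.1, 0) : ExtModel n r) = (jetDelta r 1 (y.1.coord e), 0) :=
    ⟨fun h => h1.symm.trans (h.trans h2), fun h => h1.trans (h.trans h2.symm)⟩
  rw [h3, Prod.mk.injEq]
  simp only [and_true]
  constructor
  · intro h i hi
    have h4 := congrArg (ev (i + 1)) h
    rw [ev_jetJ (by omega), ev_jetDelta le_rfl (by omega), if_pos (by omega), if_pos (by omega),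
      Nat.descFactorial_one, Nat.add_sub_cancel] at h4
    exact smul_right_injective _ (by positivity : ((i + 1 : ℕ) : ℝ) ≠ 0) h4
  · intro h
    refine jet_ext fun i hi => ?_
    rw [ev_jetJ hi, ev_jetDelta le_rfl hi]
    split_ifs with h1
    · rw [h _ (by omega)]
      rfl
    · rfl

/-- Evaluate the equation on the Reeb vector `R` itself: `dη_L(X, R) = 0` by antisymmetry and
`η_L(R) = 1`, so `R(E_L)` must equal the rate `-∂L/∂z`. No regularity is needed, only a solution at
the point. -/
theorem reebRate_eq (hk : 1 ≤ k) {y : ExtJet n (2 * k - 1) Q}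
    (hy : y.1.base ∈ e.source) {X : ExtModel n (2 * k - 1)}
    (hX : ∀ v : ExtModel n (2 * k - 1), extDAt (contactForm L) y X v =
      tmap (extModel n (2 * k - 1)) 𝓘(ℝ, ℝ) (energy hk L) y v -
        -dzCoord (localLagrangian he hL (2 * k - 1)) (extCoord e y) * formAt (contactForm L) y v)
    {ρ : ExtJet n (2 * k - 1) Q → ℝ} (hρ : IsReebRate hk L ρ) :
    ρ y = -dzCoord (localLagrangian he hL (2 * k - 1)) (extCoord e y) := by
  rcases hρ with ⟨R, hR, rfl⟩ | rfl
  · obtain ⟨h1, h2⟩ := hR y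
    have h3 := hX (R y)
    have h1' : extDAt (contactForm L) y (R y) X = 0 := h1 X
    have h2' : formAt (contactForm L) y (R y) = 1 := h2
    have h4 : extDAt (contactForm L) y X (R y) = 0 :=
      (extDAt_swap _ y X (R y)).trans (neg_eq_zero.2 h1')
    change tmap (extModel n (2 * k - 1)) 𝓘(ℝ, ℝ) (energy hk L) y (R y) = _
    have h5 := h4.symm.trans h3
    rw [h2'] at h5
    linarith
  · change -_ = -_
    rw [dLdz_extProj_eq he hL (N := 2 * k - 1) (by omega) _ hy, pad_self]

/-- The Hessian condition of a regular Lagrangian in natural coordinates. -/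
theorem IsRegularLagrangian.hessian (hk : 1 ≤ k) (hkN : k ≤ N) (h : IsRegularLagrangian L)
    {y : ExtJet n N Q} (hey : chartAt (Model n) y.1.base = e) (u : Model n)
    (hu : ∀ v, fderiv ℝ (partialQ e.open_target (localLagrangian he hL N) k).1 (extCoord e y)
        (jetSingle N k u, 0) v = 0) : u = 0 := by
  have hy : y.1.base ∈ e.source := hey ▸ mem_chart_source _ _
  set Λ := localLagrangian he hL N
  have hΛ : DependsUpTo k Λ.1 := dependsUpTo_localLagrangian he hL N
  set x := extCoord e y
  have hx : x ∈ jetDomain n N e.target := extCoord_mem_jetDomain he hy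
  have hO := isOpen_jetDomain (N := N) e.open_target
  set y' : ExtJet n k Q := extProj hkN y
  have hb : y'.1.base = y.1.base := base_extProj _ _
  have hq : y'.1.q = tr N k x.1 := by
    have : y'.1.q = y'.1.coord e := by rw [Jet.q, hb, hey]
    rw [this]
    exact congrArg Prod.fst (extCoord_extProj he hkN hy)
  have hqk : y'.1.q (Fin.last k) = ev k x.1 := by rw [hq]; rfl
  let S : Model n →L[ℝ] ExtModel n N :=
    (ContinuousLinearMap.inl ℝ (JetModel n N) ℝ).comp (jetSingle N k)
  have hS0 : ∀ i < k, ∀ a, ev i (S a).1 = 0 := fun i hi a => by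
    change ev i (jetSingle N k a) = 0
    rw [ev_jetSingle (by omega), if_neg (by omega)]
  have hmem : ∀ a, x + S (a - ev k x.1) ∈ jetDomain n N e.target := fun a => by
    change (x + S (a - ev k x.1)).1 0 ∈ e.target
    rw [← ev_zero (x + S (a - ev k x.1)).1, Prod.fst_add, map_add, hS0 0 (by omega), add_zero,
      ev_zero]
    exact hx
  -- The function differentiated in the definition of regularity is the local Lagrangian restricted
  -- to the affine subspace through `x` in the direction of `q_k`.
  have hF : (fun a : Model n => L (Jet.ofCoord (chartAt (Model n) y'.1.base)
      (Function.update y'.1.q (Fin.last k) a), y'.2)) =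
      fun a => Λ.1 (x + S (a - ev k x.1)) := by
    funext a
    have h1 : Λ.1 (x + S (a - ev k x.1)) = L (extOfCoord e (pad N k (x + S (a - ev k x.1)))) :=
      smoothFun.mk_apply _ (hmem a)
    rw [h1, hb, hey, hq]
    have h2 : pad N k (x + S (a - ev k x.1)) =
        (Function.update (tr N k x.1) (Fin.last k) a, x.2) := by
      refine Prod.ext ?_ ?_
      · funext α
        change ev (α : ℕ) (x.1 + (S (a - ev k x.1)).1) = _
        rcases eq_or_ne α (Fin.last k) with rfl | hα
        · refine Eq.trans ?_ (Function.update_self (Fin.last k) a (tr N k x.1)).symm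
          rw [map_add]
          change ev k x.1 + ev k (jetSingle N k _) = a
          rw [ev_jetSingle (by omega), if_pos rfl, add_sub_cancel]
        · refine Eq.trans ?_ (Function.update_of_ne hα a (tr N k x.1)).symm
          rw [map_add, hS0 _ (Fin.val_lt_last hα), add_zero]
          rfl
      · change x.2 + 0 = x.2
        rw [add_zero]
    rw [h2]
    rfl
  have hd1 : fderiv ℝ (fun a => Λ.1 (x + S (a - ev k x.1))) =
      fun a => (partialQ e.open_target Λ k).1 (x + S (a - ev k x.1)) := by
    funext a
    have h1 : HasFDerivAt (fun a => x + S (a - ev k x.1)) S a :=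
      (S.hasFDerivAt.comp a ((hasFDerivAt_id a).sub_const _)).const_add _
    refine (((smoothFun.hasFDerivAt hO Λ (hmem a)).comp a h1).fderiv).trans ?_
    ext v
    exact (partialQ_apply _ _ _ (hmem a) v).symm
  refine h y' u fun v => ?_
  rw [hF, hd1, hqk]
  have h1 : HasFDerivAt (fun a => x + S (a - ev k x.1)) S (ev k x.1) :=
    (S.hasFDerivAt.comp _ ((hasFDerivAt_id _).sub_const _)).const_add _
  have h0 : x + S (ev k x.1 - ev k x.1) = x := by rw [sub_self, map_zero, add_zero]
  have h3 : fderiv ℝ (fun a => (partialQ e.open_target Λ k).1 (x + S (a - ev k x.1))) (ev k x.1) =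
      (fderiv ℝ (partialQ e.open_target Λ k).1 (x + S (ev k x.1 - ev k x.1))).comp S :=
    ((smoothFun.hasFDerivAt hO (partialQ e.open_target Λ k) (hmem (ev k x.1))).comp
      (f := fun a => x + S (a - ev k x.1)) (ev k x.1) h1).fderiv
  rw [h3, h0]
  exact hu v

end LagrangianSide

/-! ### Coordinates of the unified bundle -/

section UnifiedCoordinates

variable {n k : ℕ} {Q : Type*} [TopologicalSpace Q] [ChartedSpace (Model n) Q]
  [IsManifold 𝓘(ℝ, Model n) ∞ Q] {e : OpenPartialHomeomorph Q (Model n)}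

/-- A shortcut for instance search. -/
noncomputable abbrev Unified.topology (n k : ℕ) (Q : Type*) [TopologicalSpace Q]
    [ChartedSpace (Model n) Q] [IsManifold 𝓘(ℝ, Model n) ∞ Q] : TopologicalSpace (Unified n k Q) :=
  Pullback.TotalSpace.topologicalSpace _ _ _

attribute [local instance] Unified.topology

/-- The model of the covectors of `T^{k-1}Q`. -/
abbrev CovModel (n k : ℕ) := JetModel n (k - 1) →L[ℝ] ℝ

/-- The model space of `𝒲`. -/
abbrev UniModel (n k : ℕ) := ExtModel n (2 * k - 1) × CovModel n k

/-- The covector of a point of `𝒲`. -/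
noncomputable def covector (w : Unified n k Q) : CovModel n k := w.snd

/-- The point of `𝒲` over `p` with a given covector. -/
noncomputable def uniMk (p : ExtJet n (2 * k - 1) Q) (ξ : CovModel n k) : Unified n k Q :=
  ⟨p, ξ⟩

/-- The fibre coordinates of `𝒲` induced by the natural coordinates around `p₀`. -/
noncomputable def fiberCoord (p₀ : ExtJet n (2 * k - 1) Q) (w : Unified n k Q) : CovModel n k :=
  (trivializationAt (CovModel n k) (toMomentumBase n k Q *ᵖ (Cotangent n (k - 1) Q)) p₀ w).2

theorem momentumBase_le (k : ℕ) : k - 1 ≤ 2 * k - 1 := by omega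

/-- The differential of the natural coordinates of `T^{k-1}Q`. -/
noncomputable def momentumFrame (e : OpenPartialHomeomorph Q (Model n))
    (p : ExtJet n (2 * k - 1) Q) : JetModel n (k - 1) →L[ℝ] JetModel n (k - 1) :=
  tmap 𝓘(ℝ, JetModel n (k - 1)) 𝓘(ℝ, JetModel n (k - 1)) (Jet.coord e) (toMomentumBase n k Q p)

theorem extChartAt_jet {r : ℕ} (x : Jet n r Q) :
    (extChartAt 𝓘(ℝ, JetModel n r) x : Jet n r Q → JetModel n r) =
      Jet.coord (chartAt (Model n) x.base) := rfl

theorem base_toMomentumBase (p : ExtJet n (2 * k - 1) Q) :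
    (toMomentumBase n k Q p).base = p.1.base :=
  Jet.base_proj (momentumBase_le k) _

theorem fiberCoord_apply (p₀ : ExtJet n (2 * k - 1) Q) (w : Unified n k Q)
    (u : JetModel n (k - 1)) :
    fiberCoord p₀ w u = covector w ((trivializationAt (JetModel n (k - 1))
      (TangentSpace 𝓘(ℝ, JetModel n (k - 1))) (toMomentumBase n k Q p₀)).symmL ℝ
        (toMomentumBase n k Q w.proj) u) := by
  -- The trivialization of a bundle of homomorphisms composes with the inverse trivialization of the
  -- tangent bundle on one side and with that of the trivial line bundle on the other; the latter is
  -- the identity.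
  have h := Bundle.Trivial.continuousLinearMapAt_trivialization ℝ (Jet n (k - 1) Q) ℝ
    (toMomentumBase n k Q w.proj)
  exact congrArg (fun l : ℝ →L[ℝ] ℝ => l (covector w ((trivializationAt (JetModel n (k - 1))
      (TangentSpace 𝓘(ℝ, JetModel n (k - 1))) (toMomentumBase n k Q p₀)).symmL ℝ
        (toMomentumBase n k Q w.proj) u))) h

/-- The fibre coordinate is the covector expressed in the frame of natural coordinates, so pairing
with `v` means pairing with the natural components of `v`. -/
theorem covector_apply {p₀ : ExtJet n (2 * k - 1) Q} (hp₀ : chartAt (Model n) p₀.1.base = e)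
    {w : Unified n k Q} (hw : w.proj.1.base ∈ e.source) (v : JetModel n (k - 1)) :
    covector w v = fiberCoord p₀ w (momentumFrame e w.proj v) := by
  have hb : toMomentumBase n k Q w.proj ∈
      (chartAt (JetModel n (k - 1)) (toMomentumBase n k Q p₀)).source := by
    change (toMomentumBase n k Q w.proj).base ∈
      (chartAt (Model n) (toMomentumBase n k Q p₀).base).source
    rw [base_toMomentumBase, base_toMomentumBase, hp₀]
    exact hw
  have hb' : toMomentumBase n k Q w.proj ∈ (trivializationAt (JetModel n (k - 1))
      (TangentSpace 𝓘(ℝ, JetModel n (k - 1))) (toMomentumBase n k Q p₀)).baseSet := hb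
  have h1 := TangentBundle.continuousLinearMapAt_trivializationAt
    (I := 𝓘(ℝ, JetModel n (k - 1))) hb
  have h2 : momentumFrame e w.proj v = (trivializationAt (JetModel n (k - 1))
      (TangentSpace 𝓘(ℝ, JetModel n (k - 1))) (toMomentumBase n k Q p₀)).continuousLinearMapAt ℝ
        (toMomentumBase n k Q w.proj) v := by
    rw [h1, extChartAt_jet, base_toMomentumBase, hp₀]
    rfl
  rw [h2, fiberCoord_apply]
  have h3 := Trivialization.symmL_continuousLinearMapAt (R := ℝ) (trivializationAt (JetModel n (k - 1))
      (TangentSpace 𝓘(ℝ, JetModel n (k - 1))) (toMomentumBase n k Q p₀)) hb'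
      (show TangentSpace 𝓘(ℝ, JetModel n (k - 1)) (toMomentumBase n k Q w.proj) from v)
  exact (congrArg (covector w) h3).symm

/-- The coordinates of `𝒲` induced by the natural coordinates around `p₀`. -/
noncomputable def uniCoord (p₀ : ExtJet n (2 * k - 1) Q) (w : Unified n k Q) : UniModel n k :=
  (extCoord (chartAt (Model n) p₀.1.base) w.proj, fiberCoord p₀ w)

theorem extChartAt_uni (w₀ : Unified n k Q) :
    (extChartAt (uniModel n k) w₀ : Unified n k Q → UniModel n k) = uniCoord w₀.proj := by
  funext w
  rw [FiberBundle.extChartAt]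
  rfl

theorem tmap_uniCoord_self (w₀ : Unified n k Q) (v : UniModel n k) :
    tmap (uniModel n k) 𝓘(ℝ, UniModel n k) (uniCoord w₀.proj) w₀ v = v := by
  rw [← extChartAt_uni]
  exact tmap_extChartAt_self (I := uniModel n k) w₀ v

theorem mem_trivialization_baseSet_iff {p₀ p : ExtJet n (2 * k - 1) Q} :
    p ∈ (trivializationAt (CovModel n k) (toMomentumBase n k Q *ᵖ (Cotangent n (k - 1) Q))
      p₀).baseSet ↔ p.1.base ∈ (chartAt (Model n) p₀.1.base).source := by
  have : p ∈ (trivializationAt (CovModel n k) (toMomentumBase n k Q *ᵖ (Cotangent n (k - 1) Q))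
      p₀).baseSet ↔ (toMomentumBase n k Q p).base ∈
      (chartAt (Model n) (toMomentumBase n k Q p₀).base).source ∧ True := Iff.rfl
  rw [this, base_toMomentumBase, base_toMomentumBase, and_true]

theorem contMDiff_proj_uni : ContMDiff (uniModel n k) (extModel n (2 * k - 1)) ∞
    (fun w : Unified n k Q => w.proj) :=
  contMDiff_proj _

theorem contMDiffAt_fiberCoord {p₀ : ExtJet n (2 * k - 1) Q}
    {w : Unified n k Q} (hw : w.proj.1.base ∈ (chartAt (Model n) p₀.1.base).source) :
    ContMDiffAt (uniModel n k) 𝓘(ℝ, CovModel n k) ∞ (fiberCoord p₀) w := by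
  have h := (Trivialization.contMDiffOn (n := ∞) (IB := extModel n (2 * k - 1))
    (trivializationAt (CovModel n k) (toMomentumBase n k Q *ᵖ (Cotangent n (k - 1) Q)) p₀))
  have hs : w ∈ (trivializationAt (CovModel n k)
      (toMomentumBase n k Q *ᵖ (Cotangent n (k - 1) Q)) p₀).source :=
    (Trivialization.mem_source _).2 (mem_trivialization_baseSet_iff.2 hw)
  exact contMDiff_snd.contMDiffAt.comp w (h.contMDiffAt
    ((trivializationAt (CovModel n k)
      (toMomentumBase n k Q *ᵖ (Cotangent n (k - 1) Q)) p₀).open_source.mem_nhds hs))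

theorem contMDiffAt_uniCoord {p₀ : ExtJet n (2 * k - 1) Q}
    {w : Unified n k Q} (hw : w.proj.1.base ∈ (chartAt (Model n) p₀.1.base).source) :
    ContMDiffAt (uniModel n k) 𝓘(ℝ, UniModel n k) ∞ (uniCoord p₀) w :=
  ((contMDiffAt_extCoord (chart_mem_atlas _ _) hw).comp w
    contMDiff_proj_uni.contMDiffAt).prodMk_space (contMDiffAt_fiberCoord hw)

theorem contMDiffAt_uni_iff {E' H' M : Type*} [NormedAddCommGroup E'] [NormedSpace ℝ E']
    [TopologicalSpace H'] {I : ModelWithCorners ℝ E' H'} [TopologicalSpace M] [ChartedSpace H' M]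
    {f : M → Unified n k Q} {x : M} :
    ContMDiffAt I (uniModel n k) ∞ f x ↔
      ContMDiffAt I (extModel n (2 * k - 1)) ∞ (fun y => (f y).proj) x ∧
      ContMDiffAt I 𝓘(ℝ, CovModel n k) ∞ (fun y => fiberCoord (f x).proj (f y)) x :=
  contMDiffAt_totalSpace

end UnifiedCoordinates

attribute [local instance] Unified.topology

/-! ### Contact form, Hamiltonian and Legendre graph in coordinates -/

section UnifiedForms

variable {n k r : ℕ} {Q : Type*} [TopologicalSpace Q] [ChartedSpace (Model n) Q]
  [IsManifold 𝓘(ℝ, Model n) ∞ Q] {e : OpenPartialHomeomorph Q (Model n)}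
  {L : ExtJet n k Q → ℝ} (he : e ∈ atlas (Model n) Q)
  (hL : ContMDiff (extModel n k) 𝓘(ℝ, ℝ) ∞ L)

theorem tmap_fst {x : ExtJet n r Q} (v : ExtModel n r) :
    tmap (extModel n r) 𝓘(ℝ, JetModel n r) (Prod.fst : ExtJet n r Q → Jet n r Q) x v = v.1 :=
  congrArg (fun l : ExtModel n r →L[ℝ] JetModel n r => l v) mfderiv_fst

theorem mdifferentiableAt_coord (he : e ∈ atlas (Model n) Q) {x : Jet n r Q}
    (hx : x.base ∈ e.source) :
    MDifferentiableAt 𝓘(ℝ, JetModel n r) 𝓘(ℝ, JetModel n r) (Jet.coord e) x :=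
  ((contMDiffOn_coord he).contMDiffAt ((isOpen_base_preimage he).mem_nhds hx)).mdifferentiableAt
    (by simp)

theorem momentumFrame_fst (he : e ∈ atlas (Model n) Q) {p : ExtJet n (2 * k - 1) Q}
    (hp : p.1.base ∈ e.source) (v : ExtModel n (k - 1)) :
    momentumFrame e p v.1 = (extDeriv e (extProj (momentumBase_le k) p) v).1 := by
  have hp' : (extProj (momentumBase_le k) p).1.base ∈ e.source := by rwa [base_extProj]
  rw [← tmap_coord he hp']
  have := tmap_comp (x := extProj (momentumBase_le k) p) (f := Prod.fst) (I := extModel n (k - 1))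
    (mdifferentiableAt_coord he hp') mdifferentiableAt_fst v
  rw [tmap_fst] at this
  exact this.symm

theorem momentumFrame_inj (he : e ∈ atlas (Model n) Q) {p : ExtJet n (2 * k - 1) Q}
    (hp : p.1.base ∈ e.source) (hlt : k - 1 < 2 * k - 1) :
    momentumFrame e p (p.1.inj hlt) = sh (2 * k - 1) (k - 1) (extCoord e p).1 := by
  have h1 := momentumFrame_fst he hp ((show JetModel n (k - 1) from p.1.inj hlt), 0)
  exact h1.trans (congrArg Prod.fst (extDeriv_inj he hlt hp 0))

theorem coord_toMomentumBase (he : e ∈ atlas (Model n) Q) {p : ExtJet n (2 * k - 1) Q}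
    (hp : p.1.base ∈ e.source) : (toMomentumBase n k Q p).coord e =
      tr (2 * k - 1) (k - 1) (extCoord e p).1 :=
  ev_coord_proj he (momentumBase_le k) p.1 hp

theorem momentumFrame_tmap (he : e ∈ atlas (Model n) Q)
    {E' H' M : Type*} [NormedAddCommGroup E'] [NormedSpace ℝ E']
    [TopologicalSpace H'] {I : ModelWithCorners ℝ E' H'} [TopologicalSpace M] [ChartedSpace H' M]
    {f : M → ExtJet n (2 * k - 1) Q} {x : M} (hf : MDifferentiableAt I (extModel n (2 * k - 1)) f x)
    (hx : (f x).1.base ∈ e.source) (v : E') :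
    momentumFrame e (f x)
        (tmap I 𝓘(ℝ, JetModel n (k - 1)) (fun y => toMomentumBase n k Q (f y)) x v) =
      tr (2 * k - 1) (k - 1) (tmap I 𝓘(ℝ, ExtModel n (2 * k - 1)) (fun y => extCoord e (f y)) x v).1 := by
  have hb : (toMomentumBase n k Q (f x)).base ∈ e.source := by rwa [base_toMomentumBase]
  have hm : MDifferentiableAt (extModel n (2 * k - 1)) 𝓘(ℝ, JetModel n (k - 1))
      (toMomentumBase n k Q) (f x) :=
    (toMomentumBase n k Q).contMDiff.mdifferentiableAt (by simp)
  have h1 := tmap_comp (x := x) (mdifferentiableAt_coord he hb) (hm.comp x hf) v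
  refine h1.symm.trans ?_
  have hc : MDifferentiableAt (extModel n (2 * k - 1)) 𝓘(ℝ, ExtModel n (2 * k - 1))
      (extCoord e) (f x) := (contMDiffAt_extCoord he hx).mdifferentiableAt (by simp)
  have h2 := tmap_clm_comp ((tr (2 * k - 1) (k - 1)).comp
    (ContinuousLinearMap.fst ℝ (JetModel n (2 * k - 1)) ℝ)) (hc.comp x hf) v
  refine Eq.trans ?_ h2
  refine congrArg (fun l : E' →L[ℝ] JetModel n (k - 1) => l v) (tmap_congr ?_)
  filter_upwards [hf.continuousAt.preimage_mem_nhds ((isOpen_extDomain he).mem_nhds hx)] with y hy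
  exact coord_toMomentumBase he hy

theorem contMDiff_rho2 : ContMDiff (uniModel n k) ((cotModel n (k - 1)).prod 𝓘(ℝ, ℝ)) ∞
    (rho2 : Unified n k Q → CotangentBundle n (k - 1) Q × ℝ) := by
  intro w
  refine ContMDiffAt.prodMk ?_ (contMDiff_snd.contMDiffAt.comp w contMDiff_proj_uni.contMDiffAt)
  rw [contMDiffAt_totalSpace]
  exact ⟨(toMomentumBase n k Q).contMDiff.contMDiffAt.comp w contMDiff_proj_uni.contMDiffAt,
    contMDiffAt_fiberCoord (mem_chart_source _ _)⟩

/-- The differential of the natural coordinates of `ϱ₁`. -/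
noncomputable def projDeriv (e : OpenPartialHomeomorph Q (Model n)) (w : Unified n k Q) :
    UniModel n k →L[ℝ] ExtModel n (2 * k - 1) :=
  tmap (uniModel n k) 𝓘(ℝ, ExtModel n (2 * k - 1)) (fun w : Unified n k Q => extCoord e w.proj) w

/-- The chain rule contracts `π ∘ pr₁ ∘ ϱ₂` to the map `𝒲 → T^{k-1}Q`. Afterwards the form can be
handled on `𝒲` alone, without coordinates of the cotangent bundle. -/
theorem formAt_unifiedForm_eq (w : Unified n k Q) (v : UniModel n k) :
    formAt unifiedForm w v =
      tmap (uniModel n k) 𝓘(ℝ, ℝ) (fun w : Unified n k Q => w.proj.2) w v -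
      covector w (tmap (uniModel n k) 𝓘(ℝ, JetModel n (k - 1))
        (fun w : Unified n k Q => toMomentumBase n k Q w.proj) w v) := by
  have hr : MDifferentiableAt (uniModel n k) ((cotModel n (k - 1)).prod 𝓘(ℝ, ℝ))
      (rho2 : Unified n k Q → _) w := contMDiff_rho2.mdifferentiableAt (by simp)
  have hA : MDifferentiableAt (uniModel n k) (cotModel n (k - 1))
      (fun w : Unified n k Q => (rho2 w).1) w := mdifferentiableAt_fst.comp w hr
  have hpr : MDifferentiableAt (cotModel n (k - 1)) 𝓘(ℝ, JetModel n (k - 1))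
      (TotalSpace.proj : CotangentBundle n (k - 1) Q → _) (rho2 w).1 :=
    (contMDiff_proj (n := ∞) (Cotangent n (k - 1) Q)).mdifferentiableAt (by simp)
  have h2 := tmap_comp (f := (rho2 : Unified n k Q → _)) (x := w) (g := Prod.snd)
    (I'' := 𝓘(ℝ, ℝ)) mdifferentiableAt_snd hr v
  have h3 := tmap_comp (f := (rho2 : Unified n k Q → _)) (x := w) (g := Prod.fst)
    (I'' := cotModel n (k - 1)) mdifferentiableAt_fst hr v
  have h4 := tmap_comp (f := fun w : Unified n k Q => (rho2 w).1) (x := w)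
    (g := TotalSpace.proj) (I'' := 𝓘(ℝ, JetModel n (k - 1))) hpr hA v
  have h5 := h4.trans (congrArg _ h3)
  exact congrArg₂ (fun a b => a - covector w b) h2.symm h5.symm

theorem formAt_unifiedForm {p₀ : ExtJet n (2 * k - 1) Q} (hp₀ : chartAt (Model n) p₀.1.base = e)
    {w : Unified n k Q} (hw : w.proj.1.base ∈ e.source) (v : UniModel n k) :
    formAt unifiedForm w v = (projDeriv e w v).2 -
      fiberCoord p₀ w (tr (2 * k - 1) (k - 1) (projDeriv e w v).1) := by
  have he : e ∈ atlas (Model n) Q := hp₀ ▸ chart_mem_atlas _ _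
  have hp : MDifferentiableAt (uniModel n k) (extModel n (2 * k - 1))
      (fun w : Unified n k Q => w.proj) w := contMDiff_proj_uni.mdifferentiableAt (by simp)
  have h2 : tmap (uniModel n k) 𝓘(ℝ, ℝ) (fun w : Unified n k Q => w.proj.2) w v =
      (projDeriv e w v).2 :=
    tmap_clm_comp (ContinuousLinearMap.snd ℝ (JetModel n (2 * k - 1)) ℝ)
      (((contMDiffAt_extCoord he hw).mdifferentiableAt (by simp)).comp w hp) v
  rw [formAt_unifiedForm_eq, h2, covector_apply hp₀ hw,
    momentumFrame_tmap he (f := fun w : Unified n k Q => w.proj) hp hw]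
  rfl

theorem coupling_eq (hk : 1 ≤ k) {p₀ : ExtJet n (2 * k - 1) Q}
    (hp₀ : chartAt (Model n) p₀.1.base = e) {w : Unified n k Q} (hw : w.proj.1.base ∈ e.source) :
    coupling hk w = fiberCoord p₀ w (sh (2 * k - 1) (k - 1) (extCoord e w.proj).1) := by
  have he : e ∈ atlas (Model n) Q := hp₀ ▸ chart_mem_atlas _ _
  have hlt : k - 1 < 2 * k - 1 := by omega
  rw [← momentumFrame_inj he hw hlt]
  exact covector_apply hp₀ hw (p₀ := p₀) _

theorem hamiltonian_eq (hk : 1 ≤ k) {p₀ : ExtJet n (2 * k - 1) Q}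
    (hp₀ : chartAt (Model n) p₀.1.base = e) {w : Unified n k Q} (hw : w.proj.1.base ∈ e.source) :
    hamiltonian hk L w = fiberCoord p₀ w (sh (2 * k - 1) (k - 1) (extCoord e w.proj).1) -
      (localLagrangian he hL (2 * k - 1)).1 (extCoord e w.proj) := by
  have h0 : L (extProj (by omega) w.proj) =
      (localLagrangian he hL (2 * k - 1)).1 (extCoord e w.proj) := by
    have := (isLocalRep_lagrangian (N := 2 * k - 1) he hL (by omega)).comp_extProj he (by omega)
      (dependsUpTo_localLagrangian he hL _) (show k ≤ 2 * k - 1 by omega) w.proj hw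
    rwa [pad_self] at this
  rw [← h0, ← coupling_eq hk hp₀ hw]
  rfl

theorem extDeriv_surjective (he : e ∈ atlas (Model n) Q) {y : ExtJet n r Q}
    (hy : y.1.base ∈ e.source) : Function.Surjective (extDeriv e y) := by
  intro v
  set a := extCoord e y
  have ha : a ∈ jetDomain n r e.target := extCoord_mem_jetDomain he hy
  have hO := isOpen_jetDomain (n := n) (N := r) e.open_target
  have ho : MDifferentiableAt 𝓘(ℝ, ExtModel n r) (extModel n r) (extOfCoord (Q := Q) e) a :=
    ((contMDiffOn_extOfCoord he).contMDiffAt (hO.mem_nhds ha)).mdifferentiableAt (by simp)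
  have hya : extOfCoord e a = y := extOfCoord_extCoord he hy
  have hc : MDifferentiableAt (extModel n r) 𝓘(ℝ, ExtModel n r) (extCoord e)
      (extOfCoord (Q := Q) e a) :=
    (contMDiffAt_extCoord he (hya.symm ▸ hy)).mdifferentiableAt (by simp)
  have h1 := tmap_comp hc ho v
  have h2 : tmap 𝓘(ℝ, ExtModel n r) 𝓘(ℝ, ExtModel n r) (extCoord e ∘ extOfCoord (Q := Q) e) a =
      tmap 𝓘(ℝ, ExtModel n r) 𝓘(ℝ, ExtModel n r) id a := tmap_congr <| by
    filter_upwards [hO.mem_nhds ha] with b hb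
    exact extCoord_extOfCoord he hb
  rw [h2, tmap_eq_fderiv, fderiv_id, hya] at h1
  exact ⟨_, h1.symm⟩

theorem tr_surjective {N : ℕ} (h : r ≤ N) :
    Function.Surjective (tr N r : JetModel n N →L[ℝ] JetModel n r) := fun a =>
  ⟨tr r N a, jet_ext fun i hi => by rw [ev_tr hi, ev_tr (by omega)]⟩

/-- Both sides of the defining condition factor through the components `q_0, …, q_{k-1}` of `u`.
These take all values, because the differential of the coordinates and the truncation are
surjective. -/
theorem mem_legendreGraph_iff (hk : 1 ≤ k) {p₀ : ExtJet n (2 * k - 1) Q}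
    (hp₀ : chartAt (Model n) p₀.1.base = e) {w : Unified n k Q} (hw : w.proj.1.base ∈ e.source) :
    w ∈ legendreGraph L ↔ fiberCoord p₀ w = covec k (k - 1)
      (momentum e.open_target (localLagrangian he hL (2 * k - 1)) k) (extCoord e w.proj) := by
  have h1 : w ∈ legendreGraph L ↔ ∀ u : ExtModel n (2 * k - 1), formAt (cartanForm L) w.proj u =
      covector w (tmap (extModel n (2 * k - 1)) 𝓘(ℝ, JetModel n (k - 1)) (toMomentumBase n k Q)
        w.proj u) := Iff.rfl
  have h2 : ∀ u : ExtModel n (2 * k - 1), formAt (cartanForm L) w.proj u = covec k (k - 1)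
      (momentum e.open_target (localLagrangian he hL (2 * k - 1)) k) (extCoord e w.proj)
      (tr (2 * k - 1) (k - 1) (extDeriv e w.proj u).1) := fun u => by
    rw [isFormRep_cartanForm he hL hk w.proj hw u, pad_self, covec_apply]
    refine Finset.sum_congr rfl fun i hi => ?_
    rw [Finset.mem_range] at hi
    rw [ev_tr (by omega)]
  have h3 : ∀ u : ExtModel n (2 * k - 1), covector w (tmap (extModel n (2 * k - 1))
      𝓘(ℝ, JetModel n (k - 1)) (toMomentumBase n k Q) w.proj u) =
      fiberCoord p₀ w (tr (2 * k - 1) (k - 1) (extDeriv e w.proj u).1) := fun u => by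
    rw [covector_apply hp₀ hw]
    congr 1
    exact momentumFrame_tmap he (f := id) (x := w.proj) mdifferentiableAt_id hw u
  rw [h1]
  constructor
  · intro h
    ext a
    obtain ⟨b, rfl⟩ := tr_surjective (momentumBase_le k) a
    obtain ⟨u, hu⟩ := extDeriv_surjective he hw ((b, 0) : ExtModel n (2 * k - 1))
    have := h u
    rw [h2, h3, hu] at this
    exact this.symm
  · intro h u
    rw [h2, h3, h]

end UnifiedForms

/-! ### Differentials at the centre of a chart of the unified bundle -/

section UnifiedPoint

variable {n k : ℕ} {Q : Type*} [TopologicalSpace Q] [ChartedSpace (Model n) Q]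
  [IsManifold 𝓘(ℝ, Model n) ∞ Q] {e : OpenPartialHomeomorph Q (Model n)}
  {L : ExtJet n k Q → ℝ} (he : e ∈ atlas (Model n) Q)
  (hL : ContMDiff (extModel n k) 𝓘(ℝ, ℝ) ∞ L)

theorem tmap_snd_comp {E H M E' V : Type*} [NormedAddCommGroup E] [NormedSpace ℝ E]
    [TopologicalSpace H] {I : ModelWithCorners ℝ E H} [TopologicalSpace M] [ChartedSpace H M]
    [NormedAddCommGroup E'] [NormedSpace ℝ E'] [NormedAddCommGroup V] [NormedSpace ℝ V]
    {f : M → V × E'} {x : M}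
    (hf : MDifferentiableAt I 𝓘(ℝ, V × E') f x) (v : E) :
    tmap I 𝓘(ℝ, E') (fun y => (f y).2) x v = (tmap I 𝓘(ℝ, V × E') f x v).2 :=
  tmap_clm_comp (ContinuousLinearMap.snd ℝ V E') hf v

theorem mdifferentiableAt_uniCoord {p₀ : ExtJet n (2 * k - 1) Q}
    {w : Unified n k Q} (hw : w.proj.1.base ∈ (chartAt (Model n) p₀.1.base).source) :
    MDifferentiableAt (uniModel n k) 𝓘(ℝ, UniModel n k) (uniCoord p₀) w :=
  (contMDiffAt_uniCoord hw).mdifferentiableAt (by simp)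

theorem projDeriv_self {w : Unified n k Q} (hw : chartAt (Model n) w.proj.1.base = e)
    (v : UniModel n k) : projDeriv e w v = v.1 := by
  subst hw
  have h := tmap_fst_comp (mdifferentiableAt_uniCoord (p₀ := w.proj) (w := w)
    (mem_chart_source _ _)) v
  rw [tmap_uniCoord_self] at h
  exact h

theorem tmap_fiberCoord_self (w : Unified n k Q) (v : UniModel n k) :
    tmap (uniModel n k) 𝓘(ℝ, CovModel n k) (fiberCoord w.proj) w v = v.2 := by
  have h := tmap_snd_comp (mdifferentiableAt_uniCoord (p₀ := w.proj) (w := w)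
    (mem_chart_source _ _)) v
  rw [tmap_uniCoord_self] at h
  exact h

theorem fiberCoord_self (w : Unified n k Q) : fiberCoord w.proj w = covector w := by
  ext v
  rw [covector_apply (p₀ := w.proj) rfl (mem_chart_source _ _)]
  have h := tmap_extChartAt_self (I := 𝓘(ℝ, JetModel n (k - 1))) (toMomentumBase n k Q w.proj) v
  rw [extChartAt_jet, base_toMomentumBase] at h
  exact congrArg _ h.symm

/-- Near `w` the form is `f(dg)` with `g` the coordinates `(q, z)` and `f = dz - ξ` linear in the
fibre coordinate up to a constant, so `extD_eq` yields `-dξ ∧ dq`. -/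
theorem extDAt_unifiedForm (w : Unified n k Q) (u v : UniModel n k) :
    extDAt unifiedForm w u v =
      -(u.2 (tr (2 * k - 1) (k - 1) v.1.1) - v.2 (tr (2 * k - 1) (k - 1) u.1.1)) := by
  set e := chartAt (Model n) w.proj.1.base with hedef
  have he : e ∈ atlas (Model n) Q := chart_mem_atlas _ _
  have hw : w.proj.1.base ∈ e.source := mem_chart_source _ _
  let l : CovModel n k →L[ℝ] (ExtModel n (2 * k - 1) →L[ℝ] ℝ) :=
    (ContinuousLinearMap.compL ℝ (ExtModel n (2 * k - 1)) (JetModel n (k - 1)) ℝ).flip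
      ((tr (2 * k - 1) (k - 1)).comp (ContinuousLinearMap.fst ℝ _ _))
  have hc : ContMDiffAt (uniModel n k) 𝓘(ℝ, CovModel n k) ∞ (fiberCoord w.proj) w :=
    contMDiffAt_fiberCoord hw
  have hf : ContMDiffAt (uniModel n k) 𝓘(ℝ, ExtModel n (2 * k - 1) →L[ℝ] ℝ) ∞
      (fun z : Unified n k Q => ContinuousLinearMap.snd ℝ (JetModel n (2 * k - 1)) ℝ -
        l (fiberCoord w.proj z)) w :=
    contMDiffAt_const.sub (l.contDiff.contMDiff.contMDiffAt.comp w hc)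
  have hg : ContMDiffAt (uniModel n k) 𝓘(ℝ, ExtModel n (2 * k - 1)) ∞
      (fun z : Unified n k Q => extCoord e z.proj) w :=
    (contMDiffAt_extCoord he hw).comp w contMDiff_proj_uni.contMDiffAt
  have hd : ∀ (u : UniModel n k) (v : ExtModel n (2 * k - 1)),
      tmap (uniModel n k) 𝓘(ℝ, ExtModel n (2 * k - 1) →L[ℝ] ℝ)
      (fun z : Unified n k Q => ContinuousLinearMap.snd ℝ (JetModel n (2 * k - 1)) ℝ -
        l (fiberCoord w.proj z)) w u v = -u.2 (tr (2 * k - 1) (k - 1) v.1) := by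
    intro u v
    let c : CovModel n k → (ExtModel n (2 * k - 1) →L[ℝ] ℝ) := fun a =>
      ContinuousLinearMap.snd ℝ (JetModel n (2 * k - 1)) ℝ - l a
    have hc' : HasFDerivAt c (-l) (fiberCoord w.proj w) := l.hasFDerivAt.const_sub _
    have := tmap_comp (I := uniModel n k) (g := c)
      (I'' := 𝓘(ℝ, ExtModel n (2 * k - 1) →L[ℝ] ℝ)) (f := fiberCoord w.proj) (x := w)
      hc'.differentiableAt.mdifferentiableAt (hc.mdifferentiableAt (by simp)) u
    rw [tmap_eq_fderiv, hc'.fderiv, tmap_fiberCoord_self] at this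
    exact congrArg (fun l => l v) this
  rw [extD_eq hf hg ?_ u v, hd, hd]
  · have h1 := projDeriv_self hedef.symm u
    have h2 := projDeriv_self hedef.symm v
    unfold projDeriv at h1 h2
    rw [h1, h2]
    ring
  · have ho : IsOpen {z : Unified n k Q | z.proj.1.base ∈ e.source} :=
      (isOpen_extDomain he).preimage contMDiff_proj_uni.continuous
    filter_upwards [ho.mem_nhds hw] with z hz v
    exact formAt_unifiedForm (p₀ := w.proj) hedef.symm hz v

theorem formAt_unifiedForm_self (w : Unified n k Q) (v : UniModel n k) :
    formAt unifiedForm w v = v.1.2 - covector w (tr (2 * k - 1) (k - 1) v.1.1) := by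
  rw [formAt_unifiedForm (p₀ := w.proj) rfl (mem_chart_source _ _), projDeriv_self rfl,
    fiberCoord_self]

theorem tmap_hamiltonian (hk : 1 ≤ k) {w : Unified n k Q}
    (hw : chartAt (Model n) w.proj.1.base = e) (v : UniModel n k) :
    tmap (uniModel n k) 𝓘(ℝ, ℝ) (hamiltonian hk L) w v =
      v.2 (sh (2 * k - 1) (k - 1) (extCoord e w.proj).1) +
        covector w (sh (2 * k - 1) (k - 1) v.1.1) -
        fderiv ℝ (localLagrangian he hL (2 * k - 1)).1 (extCoord e w.proj) v.1 := by
  have hw' : w.proj.1.base ∈ e.source := hw ▸ mem_chart_source _ _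
  set Λ := localLagrangian he hL (2 * k - 1)
  set a := uniCoord w.proj w with hadef
  have ha1 : a.1 = extCoord e w.proj := by rw [hadef, ← hw]; rfl
  have ha2 : a.2 = covector w := fiberCoord_self w
  have hx : a.1 ∈ jetDomain n (2 * k - 1) e.target := ha1 ▸ extCoord_mem_jetDomain he hw'
  let S : UniModel n k →L[ℝ] JetModel n (k - 1) :=
    (sh (2 * k - 1) (k - 1)).comp ((ContinuousLinearMap.fst ℝ _ _).comp
      (ContinuousLinearMap.fst ℝ _ _))
  let F : UniModel n k → ℝ := fun a => a.2 (S a) - Λ.1 a.1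
  have hF : HasFDerivAt F ((a.2.comp S + (ContinuousLinearMap.snd ℝ _ _).flip (S a)) -
        (fderiv ℝ Λ.1 a.1).comp (ContinuousLinearMap.fst ℝ _ _)) a := by
    have h1 : HasFDerivAt (fun a : UniModel n k => a.2) (ContinuousLinearMap.snd ℝ _ _) a :=
      hasFDerivAt_snd
    have h3 := (smoothFun.hasFDerivAt (isOpen_jetDomain e.open_target) Λ hx).comp a
      (hasFDerivAt_fst (𝕜 := ℝ) (p := a))
    exact (h1.clm_apply S.hasFDerivAt).sub h3
  have hc := mdifferentiableAt_uniCoord (p₀ := w.proj) (w := w) (mem_chart_source _ _)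
  have h1 := tmap_comp (f := uniCoord w.proj) (x := w) (g := F) (I'' := 𝓘(ℝ, ℝ))
    hF.differentiableAt.mdifferentiableAt hc v
  rw [tmap_uniCoord_self, tmap_eq_fderiv, ← hadef, hF.fderiv] at h1
  have h2 : tmap (uniModel n k) 𝓘(ℝ, ℝ) (hamiltonian hk L) w =
      tmap (uniModel n k) 𝓘(ℝ, ℝ) (F ∘ uniCoord w.proj) w := tmap_congr <| by
    have ho : IsOpen {z : Unified n k Q | z.proj.1.base ∈ e.source} :=
      (isOpen_extDomain he).preimage contMDiff_proj_uni.continuous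
    filter_upwards [ho.mem_nhds hw'] with z hz
    have h5 : uniCoord w.proj z = (extCoord e z.proj, fiberCoord w.proj z) := by
      rw [uniCoord, hw]
    change _ = F (uniCoord w.proj z)
    rw [hamiltonian_eq he hL hk hw hz, h5]
    rfl
  rw [h2, h1, ← ha1, ← ha2]
  change a.2 _ + v.2 _ - _ = _
  rw [add_comm]
  rfl

end UnifiedPoint

/-! ### Tangency to a subset -/

section Tangency

variable {E H M : Type*} [NormedAddCommGroup E] [NormedSpace ℝ E] [TopologicalSpace H]
  {I : ModelWithCorners ℝ E H} [TopologicalSpace M] [ChartedSpace H M]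

theorem isTangentTo_iff {X : (x : M) → TangentSpace I x} {S : Set M} :
    IsTangentTo X S ↔ ∀ x ∈ S, ∃ γ : ℝ → M,
      (∀ᶠ t in 𝓝 (0 : ℝ), ContMDiffAt 𝓘(ℝ, ℝ) I ∞ γ t ∧ γ t ∈ S) ∧
        γ 0 = x ∧ tmap 𝓘(ℝ, ℝ) I γ 0 1 = (X x : E) := by
  refine forall₂_congr fun x _ => exists_congr fun γ => and_congr_right fun _ => ?_
  constructor
  · intro h
    exact ⟨congrArg TotalSpace.proj h, congrArg (fun p : TangentBundle I M => (p.2 : E)) h⟩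
  · rintro ⟨rfl, h⟩
    exact congrArg (fun v : E => (⟨γ 0, v⟩ : TangentBundle I M)) h

end Tangency

/-! ### The section of `ϱ₁` whose image is the Legendre graph -/

section LegendreSection

variable {n k : ℕ} {Q : Type*} [TopologicalSpace Q] [ChartedSpace (Model n) Q]
  [IsManifold 𝓘(ℝ, Model n) ∞ Q] {e : OpenPartialHomeomorph Q (Model n)}
  {L : ExtJet n k Q → ℝ} (he : e ∈ atlas (Model n) Q)
  (hL : ContMDiff (extModel n k) 𝓘(ℝ, ℝ) ∞ L)

/-- The generalized Legendre map in natural coordinates. -/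
noncomputable def legendreCovec : ExtModel n (2 * k - 1) → CovModel n k :=
  covec k (k - 1) (momentum e.open_target (localLagrangian he hL (2 * k - 1)) k)

/-- The section of `ϱ₁` whose image is the graph of the generalized Legendre map. -/
noncomputable def legendreSection (p : ExtJet n (2 * k - 1) Q) : Unified n k Q :=
  uniMk p (legendreCovec (chart_mem_atlas (Model n) p.1.base) hL
    (extCoord (chartAt (Model n) p.1.base) p))

theorem contDiffAt_legendreCovec {x : ExtModel n (2 * k - 1)}
    (hx : x ∈ jetDomain n (2 * k - 1) e.target) :
    ContDiffAt ℝ ∞ (legendreCovec he hL) x :=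
  (contDiffOn_covec _).contDiffAt ((isOpen_jetDomain e.open_target).mem_nhds hx)

theorem legendreSection_mem (hk : 1 ≤ k) (p : ExtJet n (2 * k - 1) Q) :
    legendreSection hL p ∈ legendreGraph L :=
  (mem_legendreGraph_iff (chart_mem_atlas _ _) hL hk (p₀ := p) (w := legendreSection hL p) rfl
    (mem_chart_source _ _)).2 (fiberCoord_self (legendreSection hL p))

/-- Membership in the graph determines the covector. Together with `legendreSection_mem` this makes
`ϱ₁` a bijection from the graph, with inverse `legendreSection`. -/
theorem eq_legendreSection (hk : 1 ≤ k) {w : Unified n k Q} (hw : w ∈ legendreGraph L) :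
    w = legendreSection hL w.proj := by
  have h := (mem_legendreGraph_iff (chart_mem_atlas _ _) hL hk (p₀ := w.proj) rfl
    (mem_chart_source _ _)).1 hw
  rw [fiberCoord_self] at h
  exact congrArg (uniMk w.proj) h

theorem fiberCoord_legendreSection (hk : 1 ≤ k) {p₀ : ExtJet n (2 * k - 1) Q}
    (hp₀ : chartAt (Model n) p₀.1.base = e) {p : ExtJet n (2 * k - 1) Q}
    (hp : p.1.base ∈ e.source) :
    fiberCoord p₀ (legendreSection hL p) = legendreCovec he hL (extCoord e p) :=
  (mem_legendreGraph_iff he hL hk hp₀ (w := legendreSection hL p) hp).1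
    (legendreSection_mem hL hk p)

/-- The section is defined with a chart depending on the point. Smoothness holds because the graph
condition gives the same coordinate expression in any one fixed chart around the point. -/
theorem contMDiff_legendreSection (hk : 1 ≤ k) :
    ContMDiff (extModel n (2 * k - 1)) (uniModel n k) ∞ (legendreSection (Q := Q) hL) := by
  intro p
  rw [contMDiffAt_uni_iff]
  refine ⟨contMDiffAt_id, ?_⟩
  have he := chart_mem_atlas (Model n) p.1.base
  have hp := mem_chart_source (Model n) p.1.base
  have h1 : ContMDiffAt (extModel n (2 * k - 1)) 𝓘(ℝ, CovModel n k) ∞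
      (fun y => legendreCovec he hL (extCoord (chartAt (Model n) p.1.base) y)) p :=
    (contDiffAt_legendreCovec he hL (extCoord_mem_jetDomain he hp)).contMDiffAt.comp p
      (contMDiffAt_extCoord he hp)
  refine h1.congr_of_eventuallyEq ?_
  filter_upwards [(isOpen_extDomain he).mem_nhds hp] with y hy
  exact fiberCoord_legendreSection he hL hk (p₀ := p) rfl hy

theorem tmap_rho1 (w : Unified n k Q) (v : UniModel n k) :
    tmap (uniModel n k) (extModel n (2 * k - 1)) rho1 w v = v.1 := by
  have hp := mem_chart_source (Model n) w.proj.1.base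
  have h1 := tmap_comp (f := (rho1 : Unified n k Q → _)) (x := w)
    (g := extCoord (chartAt (Model n) w.proj.1.base)) (I'' := 𝓘(ℝ, ExtModel n (2 * k - 1)))
    ((contMDiffAt_extCoord (y := rho1 w) (chart_mem_atlas _ _) hp).mdifferentiableAt (by simp))
    (contMDiff_proj_uni.mdifferentiableAt (by simp)) v
  exact ((extDeriv_self (rho1 w) _).symm.trans h1.symm).trans (projDeriv_self rfl v)

theorem tmap_uniCoord_legendreSection (hk : 1 ≤ k) {p₀ : ExtJet n (2 * k - 1) Q}
    (hp₀ : chartAt (Model n) p₀.1.base = e) {p : ExtJet n (2 * k - 1) Q}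
    (hp : p.1.base ∈ e.source) (v : ExtModel n (2 * k - 1)) :
    tmap (extModel n (2 * k - 1)) 𝓘(ℝ, UniModel n k) (uniCoord p₀ ∘ legendreSection hL) p v =
      (extDeriv e p v, fderiv ℝ (legendreCovec he hL) (extCoord e p) (extDeriv e p v)) := by
  have hs := (contMDiff_legendreSection (Q := Q) hL hk).mdifferentiableAt (x := p) (by simp)
  have hu : MDifferentiableAt (uniModel n k) 𝓘(ℝ, UniModel n k) (uniCoord p₀)
      (legendreSection hL p) := mdifferentiableAt_uniCoord (hp₀ ▸ hp)
  have hc : MDifferentiableAt (extModel n (2 * k - 1)) 𝓘(ℝ, UniModel n k)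
      (uniCoord p₀ ∘ legendreSection hL) p := hu.comp p hs
  refine Prod.ext ?_ ?_
  · have h1 := tmap_fst_comp hc v
    rw [← h1, extDeriv]
    refine congrArg (fun l : ExtModel n (2 * k - 1) →L[ℝ] ExtModel n (2 * k - 1) => l v) ?_
    rw [← hp₀]
    rfl
  · have h1 := tmap_snd_comp hc v
    rw [← h1]
    exact tmap_eq_of_extCoord he hp
      (contDiffAt_legendreCovec he hL (extCoord_mem_jetDomain he hp)).differentiableAt_top
      (fun z hz => fiberCoord_legendreSection he hL hk hp₀ hz) v

theorem tmap_legendreSection (hk : 1 ≤ k) {p : ExtJet n (2 * k - 1) Q}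
    (hp : chartAt (Model n) p.1.base = e) (v : ExtModel n (2 * k - 1)) :
    tmap (extModel n (2 * k - 1)) (uniModel n k) (legendreSection hL) p v =
      (v, fderiv ℝ (legendreCovec he hL) (extCoord e p) v) := by
  have hp' : p.1.base ∈ e.source := hp ▸ mem_chart_source _ _
  have hs := (contMDiff_legendreSection (Q := Q) hL hk).mdifferentiableAt (x := p) (by simp)
  have hu : MDifferentiableAt (uniModel n k) 𝓘(ℝ, UniModel n k) (uniCoord p)
      (legendreSection hL p) := mdifferentiableAt_uniCoord (mem_chart_source _ _)
  have h1 := tmap_comp hu hs v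
  rw [tmap_uniCoord_legendreSection he hL hk hp hp'] at h1
  have h2 := tmap_uniCoord_self (legendreSection hL p)
    (tmap (extModel n (2 * k - 1)) (uniModel n k) (legendreSection hL) p v)
  have h3 : extDeriv e p v = v := by subst hp; exact extDeriv_self p v
  rw [h3] at h1
  exact h2.symm.trans h1.symm

/-- A curve in the graph is the section composed with its own projection. Differentiation shows that
its velocity is the image under the section of the projected velocity. This is the only use of
tangency in solving the equations. -/
theorem snd_eq_of_isTangentTo (hk : 1 ≤ k) {Wf : Set (Unified n k Q)} (hWf : Wf ⊆ legendreGraph L)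
    {X : (w : Unified n k Q) → TangentSpace (uniModel n k) w} (hX : IsTangentTo X Wf)
    {w : Unified n k Q} (hw : w ∈ Wf) (hwe : chartAt (Model n) w.proj.1.base = e) :
    (X w : UniModel n k).2 =
      fderiv ℝ (legendreCovec he hL) (extCoord e w.proj) (X w : UniModel n k).1 := by
  obtain ⟨γ, hγ, rfl, hv⟩ := isTangentTo_iff.1 hX w hw
  have hγ0 : MDifferentiableAt 𝓘(ℝ, ℝ) (uniModel n k) γ 0 :=
    (hγ.self_of_nhds.1).mdifferentiableAt (by simp)
  have hr : MDifferentiableAt (uniModel n k) (extModel n (2 * k - 1)) rho1 (γ 0) :=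
    contMDiff_proj_uni.mdifferentiableAt (by simp)
  have hs := (contMDiff_legendreSection (Q := Q) hL hk).mdifferentiableAt (x := rho1 (γ 0)) (by simp)
  have h1 : tmap 𝓘(ℝ, ℝ) (uniModel n k) γ 0 =
      tmap 𝓘(ℝ, ℝ) (uniModel n k) (legendreSection hL ∘ (rho1 ∘ γ)) 0 := tmap_congr <| by
    filter_upwards [hγ] with t ht
    exact eq_legendreSection hL hk (hWf ht.2)
  have h2 := tmap_comp (f := rho1 ∘ γ) (x := (0 : ℝ)) hs (hr.comp (0 : ℝ) hγ0) 1
  have h3 := tmap_comp hr hγ0 1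
  rw [tmap_rho1, hv] at h3
  rw [← h1, hv, h3] at h2
  have h4 := h2.trans (tmap_legendreSection he hL hk (p := rho1 (γ 0)) hwe _)
  exact congrArg Prod.snd h4

theorem unifiedEq_iff (hk : 1 ≤ k) {w : Unified n k Q} (hw : w ∈ legendreGraph L)
    (hwe : chartAt (Model n) w.proj.1.base = e) {X : UniModel n k}
    (hX : X.2 = fderiv ℝ (legendreCovec he hL) (extCoord e w.proj) X.1) :
    (∀ v : UniModel n k, extDAt unifiedForm w X v =
      tmap (uniModel n k) 𝓘(ℝ, ℝ) (hamiltonian hk L) w v -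
        -dzCoord (localLagrangian he hL (2 * k - 1)) (extCoord e w.proj) *
          formAt unifiedForm w v) ↔
    (∀ i < k, ev i X.1.1 = ev (i + 1) (extCoord e w.proj).1) ∧
      MomentumEquations e.open_target (localLagrangian he hL (2 * k - 1)) k
        (extCoord e w.proj) X.1 := by
  have hw' : w.proj.1.base ∈ e.source := hwe ▸ mem_chart_source _ _
  have hc : covector w = legendreCovec he hL (extCoord e w.proj) := by
    rw [← fiberCoord_self]
    exact (mem_legendreGraph_iff he hL hk hwe hw').1 hw
  rw [← unifiedEquations_iff hk (by omega) (dependsUpTo_localLagrangian he hL _)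
    (extCoord_mem_jetDomain he hw')]
  refine forall_congr' fun v => ?_
  rw [extDAt_unifiedForm, tmap_hamiltonian he hL hk hwe, formAt_unifiedForm_self, hc, hX,
    neg_mul, sub_neg_eq_add]
  rfl

theorem hamiltonian_eq_energy (hL : ContMDiff (extModel n k) 𝓘(ℝ, ℝ) ∞ L)
    (hk : 1 ≤ k) {w : Unified n k Q} (hw : w ∈ legendreGraph L) :
    hamiltonian hk L w = energy hk L w.proj := by
  have he := chart_mem_atlas (Model n) w.proj.1.base
  have hw' := mem_chart_source (Model n) w.proj.1.base
  rw [hamiltonian_eq he hL hk (p₀ := w.proj) rfl hw', energy_eq he hL hk hw',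
    (mem_legendreGraph_iff he hL hk (p₀ := w.proj) rfl hw').1 hw, covec_apply]
  congr 1
  refine Finset.sum_congr rfl fun i hi => ?_
  rw [Finset.mem_range] at hi
  rw [ev_sh (by omega)]

theorem formAt_unifiedForm_eq_formAt_contactForm (hL : ContMDiff (extModel n k) 𝓘(ℝ, ℝ) ∞ L)
    (hk : 1 ≤ k) {w : Unified n k Q}
    (hw : w ∈ legendreGraph L) (X : UniModel n k) :
    formAt unifiedForm w X = formAt (contactForm L) w.proj X.1 := by
  have he := chart_mem_atlas (Model n) w.proj.1.base
  have hw' := mem_chart_source (Model n) w.proj.1.base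
  rw [formAt_unifiedForm_self, formAt_contactForm he hL hk hw', ← fiberCoord_self,
    (mem_legendreGraph_iff he hL hk (p₀ := w.proj) rfl hw').1 hw, covec_apply, extDeriv_self]
  congr 1
  refine Finset.sum_congr rfl fun i hi => ?_
  rw [Finset.mem_range] at hi
  rw [ev_tr (by omega)]

/-- Testing `dη_𝒲(R, ·) = 0` on covector and base directions removes the components `q_0, …,
q_{k-1}` and `ξ` of `R`, and `η_𝒲(R) = 1` makes its `z`-component `1`. The components `q_k, …,
q_{2k-1}` remain free, but on the graph `dℋ` vanishes on them by `sum_momentum_sub_fderiv`. Hence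
the value does not depend on `R`. -/
theorem reeb_hamiltonian (hk : 1 ≤ k) {R : (w : Unified n k Q) → TangentSpace (uniModel n k) w}
    (hR : IsReeb unifiedForm R) {w : Unified n k Q} (hw : w ∈ legendreGraph L)
    (hwe : chartAt (Model n) w.proj.1.base = e) :
    tmap (uniModel n k) 𝓘(ℝ, ℝ) (hamiltonian hk L) w (R w) =
      -dzCoord (localLagrangian he hL (2 * k - 1)) (extCoord e w.proj) := by
  have hw' : w.proj.1.base ∈ e.source := hwe ▸ mem_chart_source _ _
  set Λ := localLagrangian he hL (2 * k - 1)
  have hΛ : DependsUpTo k Λ.1 := dependsUpTo_localLagrangian he hL _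
  set x := extCoord e w.proj
  have hx : x ∈ jetDomain n (2 * k - 1) e.target := extCoord_mem_jetDomain he hw'
  set Y : UniModel n k := R w
  have h1 : ∀ v : UniModel n k, extDAt unifiedForm w Y v = 0 := (hR w).1
  have h2 : formAt unifiedForm w Y = 1 := (hR w).2
  have h3 : tr (2 * k - 1) (k - 1) Y.1.1 = 0 := by
    funext α
    refine ext_inner_left ℝ fun u => ?_
    have := h1 (0, (innerSL ℝ u).comp
      (ContinuousLinearMap.proj (R := ℝ) (φ := fun _ : Fin (k - 1 + 1) => Model n) α))
    rw [extDAt_unifiedForm] at this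
    simpa using this
  have h4 : Y.2 = 0 := by
    ext a
    obtain ⟨b, rfl⟩ := tr_surjective (momentumBase_le k) a
    have := h1 ((b, 0), 0)
    rw [extDAt_unifiedForm] at this
    simpa using this
  rw [formAt_unifiedForm_self, h3, map_zero, sub_zero] at h2
  have hc : covector w = legendreCovec he hL x := by
    rw [← fiberCoord_self]
    exact (mem_legendreGraph_iff he hL hk hwe hw').1 hw
  rw [tmap_hamiltonian he hL hk hwe, h4, hc]
  have h5 := sum_momentum_sub_fderiv (hT := e.open_target) hk (by omega) hΛ hx Y.1
  have h6 : legendreCovec he hL x (sh (2 * k - 1) (k - 1) Y.1.1) =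
      ∑ i ∈ Finset.range k, (momentum e.open_target Λ k i).1 x (ev (i + 1) Y.1.1) := by
    rw [legendreCovec, covec_apply]
    refine Finset.sum_congr rfl fun i hi => ?_
    rw [Finset.mem_range] at hi
    rw [ev_sh (by omega)]
  have h7 : ∀ i ∈ Finset.range k, ev i Y.1.1 = 0 := fun i hi => by
    rw [Finset.mem_range] at hi
    rw [← ev_tr (show i ≤ k - 1 by omega), h3, map_zero]
  rw [h6]
  change (0 : ℝ) + _ - _ = _
  rw [zero_add, h5, h2, Finset.sum_eq_zero, mul_one, zero_sub]
  intro i hi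
  rw [h7 i hi, map_zero, map_zero, ite_self, sub_zero]

end LegendreSection

/-! ### From the unified equations to the contact Lagrangian equations -/

section UnifiedToLagrangian

variable {n k : ℕ} {Q : Type*} [TopologicalSpace Q] [ChartedSpace (Model n) Q]
  [IsManifold 𝓘(ℝ, Model n) ∞ Q] {e : OpenPartialHomeomorph Q (Model n)}
  {L : ExtJet n k Q → ℝ} (he : e ∈ atlas (Model n) Q)
  (hL : ContMDiff (extModel n k) 𝓘(ℝ, ℝ) ∞ L)

/-- A tangent vector at `p` that is holonomic and satisfies the coordinate form of the contact
Lagrangian equations. -/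
structure IsLagrangianVector (p : ExtJet n (2 * k - 1) Q) (X : ExtModel n (2 * k - 1)) : Prop where
  ev_eq : ∀ i < k, ev i X.1 = ev (i + 1) (extCoord e p).1
  snd_eq : X.2 = (localLagrangian he hL (2 * k - 1)).1 (extCoord e p)
  momentum : MomentumEquations e.open_target (localLagrangian he hL (2 * k - 1)) k (extCoord e p) X

variable {he hL}

theorem IsLagrangianVector.solves (hk : 1 ≤ k) {p : ExtJet n (2 * k - 1) Q}
    (hp : chartAt (Model n) p.1.base = e) {X : ExtModel n (2 * k - 1)}
    (h : IsLagrangianVector he hL p X) {ρ : ExtJet n (2 * k - 1) Q → ℝ} (hρ : IsReebRate hk L ρ) :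
    (∀ v : ExtModel n (2 * k - 1), extDAt (contactForm L) p X v =
      tmap (extModel n (2 * k - 1)) 𝓘(ℝ, ℝ) (energy hk L) p v - ρ p * formAt (contactForm L) p v) ∧
    formAt (contactForm L) p X = -energy hk L p := by
  have hp' : p.1.base ∈ e.source := hp ▸ mem_chart_source _ _
  have hT : ∀ v, extDeriv e p v = v := fun v => by subst hp; exact extDeriv_self p v
  have h1 := (contactLagrangianEq_iff he hL hk hp' hT h.ev_eq _).2 ⟨rfl, h.momentum⟩
  -- The vector solves the equation with rate `-∂L/∂z`, which forces every admissible rate to have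
  -- this value at `p`.
  rw [reebRate_eq he hL hk hp' h1 hρ]
  exact ⟨h1, (formAt_contactForm_eq_neg_energy_iff he hL hk hp' hT h.ev_eq).2 h.snd_eq⟩

/-- The rate may be any real number, since the equation itself forces it to be `-∂L/∂z`. Only the
holonomy components `i < k` are retained. -/
theorem isLagrangianVector_of_solves (hk : 1 ≤ k) {p : ExtJet n (2 * k - 1) Q}
    (hp : chartAt (Model n) p.1.base = e) {X : ExtModel n (2 * k - 1)}
    (hX : IsHolonomicVector p X) {ρ : ℝ}
    (h : ∀ v : ExtModel n (2 * k - 1), extDAt (contactForm L) p X v =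
      tmap (extModel n (2 * k - 1)) 𝓘(ℝ, ℝ) (energy hk L) p v - ρ * formAt (contactForm L) p v)
    (h' : formAt (contactForm L) p X = -energy hk L p) : IsLagrangianVector he hL p X := by
  have hp' : p.1.base ∈ e.source := hp ▸ mem_chart_source _ _
  have hT : ∀ v, extDeriv e p v = v := fun v => by subst hp; exact extDeriv_self p v
  have h0 : ∀ i < k, ev i X.1 = ev (i + 1) (extCoord e p).1 := fun i hi =>
    (isHolonomicVector_iff he hp' hT X).1 hX i (by omega)
  exact ⟨h0, (formAt_contactForm_eq_neg_energy_iff he hL hk hp' hT h0).1 h',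
    ((contactLagrangianEq_iff he hL hk hp' hT h0 ρ).1 h).2⟩

/-- This is the bridge used in both directions of the theorem: for a vector tangent to the graph,
the unified equations depend only on its projection. -/
theorem isLagrangianVector_iff_unified (hk : 1 ≤ k) {w : Unified n k Q} (hw : w ∈ legendreGraph L)
    (hwe : chartAt (Model n) w.proj.1.base = e)
    {R : (w : Unified n k Q) → TangentSpace (uniModel n k) w} (hR : IsReeb unifiedForm R)
    {X : UniModel n k}
    (hX : X.2 = fderiv ℝ (legendreCovec he hL) (extCoord e w.proj) X.1) :
    ((∀ v : UniModel n k, extDAt unifiedForm w X v =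
      tmap (uniModel n k) 𝓘(ℝ, ℝ) (hamiltonian hk L) w v -
        tmap (uniModel n k) 𝓘(ℝ, ℝ) (hamiltonian hk L) w (R w) * formAt unifiedForm w v) ∧
      formAt unifiedForm w X = -hamiltonian hk L w) ↔ IsLagrangianVector he hL w.proj X.1 := by
  have hp' : w.proj.1.base ∈ e.source := hwe ▸ mem_chart_source _ _
  have hT : ∀ v, extDeriv e w.proj v = v := fun v => by subst hwe; exact extDeriv_self w.proj v
  rw [reeb_hamiltonian he hL hk hR hw hwe, unifiedEq_iff he hL hk hw hwe hX,
    formAt_unifiedForm_eq_formAt_contactForm hL hk hw, hamiltonian_eq_energy hL hk hw]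
  constructor
  · rintro ⟨⟨h1, h2⟩, h3⟩
    exact ⟨h1, (formAt_contactForm_eq_neg_energy_iff he hL hk hp' hT h1).1 h3, h2⟩
  · rintro ⟨h1, h2, h3⟩
    exact ⟨⟨h1, h3⟩, (formAt_contactForm_eq_neg_energy_iff he hL hk hp' hT h1).2 h2⟩

theorem isLagrangianVector_proj (hk : 1 ≤ k) {Wf : Set (Unified n k Q)}
    (hWf : Wf ⊆ legendreGraph L)
    {R : (w : Unified n k Q) → TangentSpace (uniModel n k) w} (hR : IsReeb unifiedForm R)
    {XH : (w : Unified n k Q) → TangentSpace (uniModel n k) w}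
    (hXH : SolvesContactEq unifiedForm (hamiltonian hk L)
      (fun w => dfun (uniModel n k) (hamiltonian hk L) w (R w)) XH Wf)
    (htan : IsTangentTo XH Wf) {w : Unified n k Q} (hw : w ∈ Wf)
    (hwe : chartAt (Model n) w.proj.1.base = e) :
    IsLagrangianVector he hL w.proj (XH w : UniModel n k).1 :=
  (isLagrangianVector_iff_unified hk (hWf hw) hwe hR
    (snd_eq_of_isTangentTo he hL hk hWf htan hw hwe)).1 (hXH w hw)

theorem IsLagrangianVector.isHolonomicVector (hk : 1 ≤ k) {p : ExtJet n (2 * k - 1) Q}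
    (hp : chartAt (Model n) p.1.base = e) {X : ExtModel n (2 * k - 1)}
    (h : IsLagrangianVector he hL p X) (hreg : k = 1 ∨ IsRegularLagrangian L) :
    IsHolonomicVector p X := by
  have hp' : p.1.base ∈ e.source := hp ▸ mem_chart_source _ _
  have hT : ∀ v, extDeriv e p v = v := fun v => by subst hp; exact extDeriv_self p v
  rw [isHolonomicVector_iff he hp' hT]
  rcases hreg with rfl | hreg
  -- For `k = 1` the full holonomy condition concerns `i < 2k - 1 = 1 = k`, so nothing is missing.
  · exact h.ev_eq
  · exact eq_totalField_of_regular hk (by omega) (dependsUpTo_localLagrangian he hL _)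
      (extCoord_mem_jetDomain he hp') (hreg.hessian he hL hk (by omega) hp) h.ev_eq h.snd_eq
      h.momentum

/-- The projection of a vector field of `𝒲` along the graph of the Legendre map. -/
noncomputable def projectedField (hL : ContMDiff (extModel n k) 𝓘(ℝ, ℝ) ∞ L)
    (XH : (w : Unified n k Q) → TangentSpace (uniModel n k) w) (p : ExtJet n (2 * k - 1) Q) :
    TangentSpace (extModel n (2 * k - 1)) p :=
  tmap (uniModel n k) (extModel n (2 * k - 1)) rho1 (legendreSection hL p)
    (XH (legendreSection hL p))

theorem projectedField_rho1 (hk : 1 ≤ k)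
    (XH : (w : Unified n k Q) → TangentSpace (uniModel n k) w) {w : Unified n k Q}
    (hw : w ∈ legendreGraph L) : projectedField hL XH (rho1 w) =
      mfderiv (uniModel n k) (extModel n (2 * k - 1)) rho1 w (XH w) := by
  obtain ⟨p, rfl⟩ : ∃ p, w = legendreSection hL p := ⟨_, eq_legendreSection hL hk hw⟩
  rfl

theorem projectedField_eq (hk : 1 ≤ k)
    (XH : (w : Unified n k Q) → TangentSpace (uniModel n k) w) {w : Unified n k Q}
    (hw : w ∈ legendreGraph L) :
    (projectedField hL XH w.proj : ExtModel n (2 * k - 1)) = (XH w : UniModel n k).1 :=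
  (projectedField_rho1 hk XH hw).trans (tmap_rho1 w (XH w))

theorem isSmoothVectorField_projectedField (hk : 1 ≤ k)
    {XH : (w : Unified n k Q) → TangentSpace (uniModel n k) w}
    (hXH : IsSmoothVectorField (uniModel n k) XH) :
    IsSmoothVectorField (extModel n (2 * k - 1)) (projectedField hL XH) := by
  have h1 : ContMDiff (uniModel n k).tangent (extModel n (2 * k - 1)).tangent ∞
      (tangentMap (uniModel n k) (extModel n (2 * k - 1)) (rho1 : Unified n k Q → _)) :=
    ContMDiff.contMDiff_tangentMap (m := ∞) (n := ∞) contMDiff_proj_uni (by simp)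
  exact h1.comp (hXH.comp (contMDiff_legendreSection hL hk))

theorem isTangentTo_projectedField (hk : 1 ≤ k) {Wf : Set (Unified n k Q)}
    (hWf : Wf ⊆ legendreGraph L) {XH : (w : Unified n k Q) → TangentSpace (uniModel n k) w}
    (htan : IsTangentTo XH Wf) : IsTangentTo (projectedField hL XH) (rho1 '' Wf) := by
  rw [isTangentTo_iff] at htan ⊢
  rintro _ ⟨w, hw, rfl⟩
  obtain ⟨γ, hγ, rfl, hv⟩ := htan w hw
  refine ⟨rho1 ∘ γ, ?_, rfl, ?_⟩
  · filter_upwards [hγ] with t ht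
    exact ⟨contMDiff_proj_uni.contMDiffAt.comp t ht.1, mem_image_of_mem _ ht.2⟩
  · have h1 := tmap_comp (f := γ) (x := (0 : ℝ)) (g := (rho1 : Unified n k Q → _))
      (I'' := extModel n (2 * k - 1)) (contMDiff_proj_uni.mdifferentiableAt (by simp))
      (hγ.self_of_nhds.1.mdifferentiableAt (by simp)) 1
    rw [hv] at h1
    exact h1.trans (projectedField_rho1 hk XH (hWf hw)).symm

end UnifiedToLagrangian

/-! ### Integral curves of holonomic fields are holonomic -/

section IntegralCurves

/-- Bootstrapping: if `u` is of class `C^m`, then so is `u' = Y(u)`, hence `u` is of class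
`C^{m+1}`. -/
theorem contDiffOn_of_hasDerivAt {E : Type*} [NormedAddCommGroup E] [NormedSpace ℝ E] {s : Set ℝ}
    (hs : IsOpen s) {O : Set E} {Y : E → E} (hY : ContDiffOn ℝ ∞ Y O) {u : ℝ → E}
    (hu : ∀ t ∈ s, HasDerivAt u (Y (u t)) t) (hO : MapsTo u s O) : ContDiffOn ℝ ∞ u s := by
  rw [contDiffOn_infty]
  intro m
  induction m with
  | zero =>
    rw [Nat.cast_zero, contDiffOn_zero]
    exact fun t ht => (hu t ht).continuousAt.continuousWithinAt
  | succ m ih =>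
    rw [Nat.cast_succ, contDiffOn_succ_iff_deriv_of_isOpen hs]
    refine ⟨fun t ht => (hu t ht).differentiableAt.differentiableWithinAt,
      fun h => absurd h (by simp), ?_⟩
    refine ((hY.of_le (by exact_mod_cast le_top)).comp ih hO).congr fun t ht => ?_
    exact (hu t ht).deriv

theorem iteratedDeriv_eventuallyEq {E : Type*} [NormedAddCommGroup E] [NormedSpace ℝ E] {s : Set ℝ}
    (hs : IsOpen s) {c : ℕ → ℝ → E} {N : ℕ}
    (hc : ∀ i < N, ∀ t ∈ s, HasDerivAt (c i) (c (i + 1) t) t) :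
    ∀ i ≤ N, ∀ t ∈ s, iteratedDeriv i (c 0) t = c i t := by
  intro i
  induction i with
  | zero => intro _ t _; rw [iteratedDeriv_zero]
  | succ i ih =>
    intro hi t ht
    rw [iteratedDeriv_succ]
    have h1 : iteratedDeriv i (c 0) =ᶠ[𝓝 t] c i := by
      filter_upwards [hs.mem_nhds ht] with t' ht'
      exact ih (by omega) t' ht'
    rw [h1.deriv_eq, (hc i (by omega) t ht).deriv]

variable {n r : ℕ} {Q : Type*} [TopologicalSpace Q] [ChartedSpace (Model n) Q]
  [IsManifold 𝓘(ℝ, Model n) ∞ Q] {e : OpenPartialHomeomorph Q (Model n)}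

theorem IsHolonomicVector.ev_extDeriv {y : ExtJet n r Q} (he : e ∈ atlas (Model n) Q)
    (hy : y.1.base ∈ e.source) {X : TangentSpace (extModel n r) y} (hX : IsHolonomicVector y X)
    {i : ℕ} (hi : i < r) : ev i (extDeriv e y X).1 = ev (i + 1) (extCoord e y).1 := by
  have h0 : extDeriv e y (extJ 1 y X) = extDeriv e y (extDelta 1 y) := congrArg _ hX
  have h1 := ((extDeriv_extJ he hy 1 X).symm.trans h0).trans
    (extDeriv_extDelta (r := r) he hy (le_refl 1))
  have h4 := congrArg (ev (i + 1)) (congrArg Prod.fst h1)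
  change ev (i + 1) (jetJ r 1 (extDeriv e y X).1) = ev (i + 1) (jetDelta r 1 (y.1.coord e)) at h4
  rw [ev_jetJ (by omega), ev_jetDelta le_rfl (by omega), if_pos (by omega), if_pos (by omega),
    Nat.descFactorial_one, Nat.add_sub_cancel] at h4
  exact smul_right_injective _ (by positivity : ((i + 1 : ℕ) : ℝ) ≠ 0) h4

theorem contDiffOn_extDeriv_field (he : e ∈ atlas (Model n) Q)
    {X : (p : ExtJet n r Q) → TangentSpace (extModel n r) p}
    (hX : IsSmoothVectorField (extModel n r) X) :
    ContDiffOn ℝ ∞ (fun a : ExtModel n r => extDeriv e (extOfCoord e a) (X (extOfCoord e a)))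
      (jetDomain n r e.target) := by
  have hO : IsOpen {y : ExtJet n r Q | y.1.base ∈ e.source} := isOpen_extDomain he
  have h1 : ContMDiffOn (extModel n r).tangent 𝓘(ℝ, ExtModel n r).tangent ∞
      (tangentMapWithin (extModel n r) 𝓘(ℝ, ExtModel n r) (extCoord e)
        {y : ExtJet n r Q | y.1.base ∈ e.source})
      (TotalSpace.proj ⁻¹' {y : ExtJet n r Q | y.1.base ∈ e.source}) :=
    (contMDiffOn_extCoord he).contMDiffOn_tangentMapWithin (by simp) hO.uniqueMDiffOn
  have h2 : ContMDiffOn 𝓘(ℝ, ExtModel n r) 𝓘(ℝ, ExtModel n r).tangent ∞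
      (fun a : ExtModel n r => tangentMapWithin (extModel n r) 𝓘(ℝ, ExtModel n r) (extCoord e)
        {y : ExtJet n r Q | y.1.base ∈ e.source}
          (⟨extOfCoord e a, X (extOfCoord e a)⟩ : TangentBundle (extModel n r) (ExtJet n r Q)))
      (jetDomain n r e.target) := by
    refine h1.comp (hX.comp_contMDiffOn (contMDiffOn_extOfCoord he)) fun a ha => ?_
    change (Jet.ofCoord e a.1).base ∈ e.source
    rw [Jet.base_ofCoord he ha]
    exact e.map_target ha
  have h3 := (contMDiff_snd_tangentBundle_modelSpace (ExtModel n r)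
    𝓘(ℝ, ExtModel n r) (n := ∞)).comp_contMDiffOn h2
  rw [contMDiffOn_iff_contDiffOn] at h3
  refine h3.congr fun a ha => ?_
  have hm : (extOfCoord e a : ExtJet n r Q) ∈ {y : ExtJet n r Q | y.1.base ∈ e.source} := by
    change (Jet.ofCoord e a.1).base ∈ e.source
    rw [Jet.base_ofCoord he ha]
    exact e.map_target ha
  change _ = mfderivWithin (extModel n r) 𝓘(ℝ, ExtModel n r) (extCoord e)
    {y : ExtJet n r Q | y.1.base ∈ e.source} (extOfCoord e a) (X (extOfCoord e a))
  rw [mfderivWithin_of_isOpen hO hm]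
  rfl

/-- Along the curve, holonomy reads `q_i' = q_{i+1}`, so each `q_i` is the `i`-th derivative of
`q_0`. Smoothness of the curve must be established as well, because jets are taken of smooth curves.
-/
theorem isHolonomicCurveOn_of_isMIntegralCurveOn
    {X : (p : ExtJet n r Q) → TangentSpace (extModel n r) p}
    (hX : IsSmoothVectorField (extModel n r) X) {γ : ℝ → ExtJet n r Q} {s : Set ℝ} (hs : IsOpen s)
    (hγ : IsMIntegralCurveOn γ X s) (hol : ∀ t ∈ s, IsHolonomicVector (γ t) (X (γ t))) :
    IsHolonomicCurveOn γ s := by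
  intro t₀ ht₀
  set e := chartAt (Model n) (γ t₀).1.base
  have he : e ∈ atlas (Model n) Q := chart_mem_atlas _ _
  have hcont : ∀ t ∈ s, ContinuousAt γ t := fun t ht => (hγ t ht).continuousWithinAt.continuousAt
    (hs.mem_nhds ht)
  set s' := s ∩ γ ⁻¹' {y : ExtJet n r Q | y.1.base ∈ e.source} with hs'def
  have hs' : IsOpen s' := by
    rw [isOpen_iff_mem_nhds]
    intro t ht
    exact inter_mem (hs.mem_nhds ht.1)
      ((hcont t ht.1).preimage_mem_nhds ((isOpen_extDomain he).mem_nhds ht.2))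
  have ht₀' : t₀ ∈ s' := ⟨ht₀, mem_chart_source _ _⟩
  set u : ℝ → ExtModel n r := fun t => extCoord e (γ t)
  have hu : ∀ t ∈ s', HasDerivAt u (extDeriv e (γ t) (X (γ t))) t := by
    intro t ht
    have h1 := (hγ t ht.1).hasMFDerivAt (hs.mem_nhds ht.1)
    have h2 : MDifferentiableAt (extModel n r) 𝓘(ℝ, ExtModel n r) (extCoord e) (γ t) :=
      (contMDiffAt_extCoord he ht.2).mdifferentiableAt (by simp)
    have h3 : tmap 𝓘(ℝ, ℝ) (extModel n r) γ t 1 = X (γ t) := by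
      refine (congrArg (fun l : ℝ →L[ℝ] ExtModel n r => l 1) h1.mfderiv).trans ?_
      exact one_smul ℝ (show ExtModel n r from X (γ t))
    have h4 := tmap_comp h2 h1.mdifferentiableAt 1
    rw [h3, tmap_eq_fderiv] at h4
    have h5 : DifferentiableAt ℝ u t :=
      mdifferentiableAt_iff_differentiableAt.1 (h2.comp t h1.mdifferentiableAt)
    have h6 := h5.hasDerivAt
    rw [← fderiv_apply_one_eq_deriv] at h6
    exact h4 ▸ h6
  have hsm : ContDiffOn ℝ ∞ u s' := by
    refine contDiffOn_of_hasDerivAt hs' (contDiffOn_extDeriv_field he hX) (fun t ht => ?_)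
      (fun t ht => extCoord_mem_jetDomain he ht.2)
    have h1 : extOfCoord e (u t) = γ t := extOfCoord_extCoord he ht.2
    rw [h1]
    exact hu t ht
  set c : ℕ → ℝ → Model n := fun i t => ev i (u t).1
  have hc : ∀ i < r, ∀ t ∈ s', HasDerivAt (c i) (c (i + 1) t) t := by
    intro i hi t ht
    have h1 := ((ev i).comp (ContinuousLinearMap.fst ℝ (JetModel n r) ℝ)).hasFDerivAt.comp_hasDerivAt
      t (hu t ht)
    have h2 : c (i + 1) t = ev i (extDeriv e (γ t) (X (γ t))).1 :=
      ((hol t ht.1).ev_extDeriv he ht.2 hi).symm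
    rw [h2]
    exact h1
  have hbase : ∀ t ∈ s', e (γ t).1.base = c 0 t := by
    intro t ht
    exact (Jet.coord_zero he _ ht.2).symm.trans (ev_zero _).symm
  have hshift : ∀ᶠ τ in 𝓝 (0 : ℝ), τ + t₀ ∈ s' :=
    (continuous_add_const t₀).continuousAt.preimage_mem_nhds
      (hs'.mem_nhds (by rwa [zero_add]))
  have hsmooth : ∀ t ∈ s', ContMDiffAt 𝓘(ℝ, ℝ) 𝓘(ℝ, Model n) ∞ (fun t => (γ t).1.base) t := by
    intro t ht
    have h1 : ContDiffAt ℝ ∞ (c 0) t := ((ev 0).comp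
      (ContinuousLinearMap.fst ℝ (JetModel n r) ℝ)).contDiff.contDiffAt.comp t
        (hsm.contDiffAt (hs'.mem_nhds ht))
    have hct : c 0 t ∈ e.target := hbase t ht ▸ e.map_source ht.2
    have h2 := ((contMDiffOn_symm_of_mem_maximalAtlas (I := 𝓘(ℝ, Model n)) (n := ∞)
      (IsManifold.subset_maximalAtlas he)).contMDiffAt (e.open_target.mem_nhds hct)).comp t
        h1.contMDiffAt
    refine h2.congr_of_eventuallyEq ?_
    filter_upwards [hs'.mem_nhds ht] with t' ht'
    change _ = e.symm (c 0 t')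
    rw [← hbase t' ht', e.left_inv ht'.2]
  have hnear : SmoothNearZero n (fun τ => (γ (τ + t₀)).1.base) := by
    filter_upwards [hshift] with τ hτ
    have h1 : ContMDiff 𝓘(ℝ, ℝ) 𝓘(ℝ, ℝ) ∞ (fun τ : ℝ => τ + t₀) :=
      contMDiff_iff_contDiff.2 (contDiff_id.add contDiff_const)
    exact ContMDiffAt.comp (f := fun τ : ℝ => τ + t₀) (g := fun t => (γ t).1.base) τ
      (hsmooth _ hτ) h1.contMDiffAt
  refine ⟨hnear, ?_⟩
  have h0 : (γ (0 + t₀)).1.base ∈ e.source := by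
    rw [zero_add]
    exact ht₀'.2
  have h1 : (Jet.mk _ hnear : Jet n r Q).coord e = (γ t₀).1.coord e := by
    funext α
    rw [Jet.coord_mk he _ _ h0]
    have h2 : (e ∘ fun τ => (γ (τ + t₀)).1.base) =ᶠ[𝓝 0] fun τ => c 0 (τ + t₀) := by
      filter_upwards [hshift] with τ hτ
      exact hbase _ hτ
    -- Translation of the parameter carries the derivatives at `0` to those at `t₀`.
    rw [h2.iteratedDeriv_eq, iteratedDeriv_comp_add_const]
    beta_reduce
    rw [zero_add, iteratedDeriv_eventuallyEq hs' hc _ (Nat.le_of_lt_succ α.2) t₀ ht₀']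
    exact ev_fin _ α
  rw [← ofCoord_coord he (x := (γ t₀).1) ht₀'.2, ← h1, ofCoord_coord he]
  exact h0

end IntegralCurves

/-! ### The unified bundle is Hausdorff and σ-compact -/

section UnifiedTopology

variable {n k r : ℕ} {Q : Type*} [TopologicalSpace Q] [ChartedSpace (Model n) Q]
  [IsManifold 𝓘(ℝ, Model n) ∞ Q]

theorem continuous_base : Continuous (Jet.base : Jet n r Q → Q) := by
  rw [continuous_iff_continuousAt]
  intro x
  have he := chart_mem_atlas (Model n) x.base
  have hx := mem_chart_source (Model n) x.base
  have h1 : ContinuousAt (fun y : Jet n r Q =>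
      (chartAt (Model n) x.base).symm (y.coord (chartAt (Model n) x.base) 0)) x := by
    have h2 : ContinuousAt (fun y : Jet n r Q => y.coord (chartAt (Model n) x.base) 0) x :=
      ContinuousAt.comp (f := fun y : Jet n r Q => y.coord (chartAt (Model n) x.base))
        (g := fun a : JetModel n r => a 0) (continuous_apply 0).continuousAt
        ((contMDiffOn_coord he).continuousOn.continuousAt
        ((isOpen_base_preimage he).mem_nhds hx))
    refine ContinuousAt.comp (f := fun y : Jet n r Q => y.coord (chartAt (Model n) x.base) 0)
      ((chartAt (Model n) x.base).continuousAt_symm (coord_mem_target he hx)) h2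
  refine h1.congr ?_
  filter_upwards [(isOpen_base_preimage he).mem_nhds hx] with y hy
  rw [Jet.coord_zero he y hy, (chartAt (Model n) x.base).left_inv hy]

/-- Points with different images are separated in the base. Points of a bundle over the same base
point lie in one common trivialization or chart, which is Hausdorff. -/
theorem t2Space_of_local {X Y : Type*} [TopologicalSpace X] [TopologicalSpace Y] [T2Space Y]
    {f : X → Y} (hf : Continuous f)
    (h : ∀ x y : X, f x = f y → x ≠ y → ∃ u v : Set X, IsOpen u ∧ IsOpen v ∧ x ∈ u ∧ y ∈ v ∧
      Disjoint u v) : T2Space X := by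
  refine ⟨fun x y hxy => ?_⟩
  by_cases hfxy : f x = f y
  · exact h x y hfxy hxy
  · exact separated_by_continuous hf hfxy

theorem separated_of_openPartialHomeomorph {X Y : Type*} [TopologicalSpace X] [TopologicalSpace Y]
    [T2Space Y] (e : OpenPartialHomeomorph X Y) {x y : X} (hx : x ∈ e.source) (hy : y ∈ e.source)
    (hxy : x ≠ y) : ∃ u v : Set X, IsOpen u ∧ IsOpen v ∧ x ∈ u ∧ y ∈ v ∧ Disjoint u v := by
  obtain ⟨u, v, hu, hv, hxu, hyv, huv⟩ := t2_separation (e.injOn.ne hx hy hxy)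
  exact ⟨_, _, e.isOpen_inter_preimage hu, e.isOpen_inter_preimage hv, ⟨hx, hxu⟩, ⟨hy, hyv⟩,
    (huv.preimage e).mono inter_subset_right inter_subset_right⟩

instance [T2Space Q] : T2Space (Jet n r Q) :=
  t2Space_of_local continuous_base fun x _ hxy hne =>
    separated_of_openPartialHomeomorph (chartAt (JetModel n r) x) (mem_chart_source _ _)
      (show Jet.base _ ∈ (chartAt (Model n) x.base).source from hxy ▸ mem_chart_source _ _) hne

theorem Unified.t2Space [T2Space Q] : T2Space (Unified n k Q) :=
  t2Space_of_local (f := fun w : Unified n k Q => w.proj) contMDiff_proj_uni.continuous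
    fun x _ hxy hne => separated_of_openPartialHomeomorph (trivializationAt (CovModel n k)
        (toMomentumBase n k Q *ᵖ (Cotangent n (k - 1) Q)) x.proj).toOpenPartialHomeomorph
      ((Trivialization.mem_source _).2 (mem_trivialization_baseSet_iff.2 (mem_chart_source _ _)))
      ((Trivialization.mem_source _).2 (mem_trivialization_baseSet_iff.2
        (hxy ▸ mem_chart_source (Model n) x.proj.1.base))) hne

theorem mem_chart_source_uni {w₀ w : Unified n k Q}
    (h : w.proj.1.base ∈ (chartAt (Model n) w₀.proj.1.base).source) :
    w ∈ (chartAt (ModelProd (ModelProd (JetModel n (2 * k - 1)) ℝ) (CovModel n k)) w₀).source := by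
  rw [FiberBundle.chartedSpace_chartAt]
  exact ⟨(Trivialization.mem_source _).2 (mem_trivialization_baseSet_iff.2 h), ⟨h, trivial⟩, trivial⟩

instance : SecondCountableTopology (ModelProd (ModelProd (JetModel n r) ℝ) (CovModel n k)) :=
  inferInstanceAs (SecondCountableTopology ((JetModel n r × ℝ) × CovModel n k))

instance : LocallyCompactSpace (ModelProd (ModelProd (JetModel n r) ℝ) (CovModel n k)) :=
  inferInstanceAs (LocallyCompactSpace ((JetModel n r × ℝ) × CovModel n k))

/-- The chart of `𝒲` at a point contains everything above the chart domain of its base point in `Q`,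
so countably many chart domains covering `Q` suffice. -/
theorem Unified.secondCountableTopology [SecondCountableTopology Q] :
    SecondCountableTopology (Unified n k Q) := by
  obtain ⟨t, ht, htu⟩ := TopologicalSpace.countable_cover_nhds
    (fun q : Q => (chartAt (Model n) q).open_source.mem_nhds (mem_chart_source (Model n) q))
  -- Above every `q` lies the jet of the constant curve, with `z = 0` and zero covector.
  have hj : ∀ q : Q, ∃ w : Unified n k Q, w.proj.1.base = q := fun q =>
    ⟨uniMk (Jet.mk (fun _ => q) (.of_forall fun _ => contMDiffAt_const), 0) 0, rfl⟩
  choose j hj using hj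
  refine ChartedSpace.secondCountable_of_countable_cover
    (ModelProd (ModelProd (JetModel n (2 * k - 1)) ℝ) (CovModel n k)) (s := j '' t) ?_ (ht.image j)
  rw [eq_univ_iff_forall]
  intro w
  obtain ⟨q, hq, hwq⟩ := mem_iUnion₂.1 (htu.symm ▸ mem_univ w.proj.1.base :
    w.proj.1.base ∈ ⋃ q ∈ t, (chartAt (Model n) q).source)
  refine mem_iUnion₂.2 ⟨j q, mem_image_of_mem _ hq, ?_⟩
  exact mem_chart_source_uni (by rwa [hj])

theorem Unified.sigmaCompactSpace [SecondCountableTopology Q] :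
    SigmaCompactSpace (Unified n k Q) := by
  have := Unified.secondCountableTopology (n := n) (k := k) (Q := Q)
  have : LocallyCompactSpace (Unified n k Q) :=
    ChartedSpace.locallyCompactSpace
      (ModelProd (ModelProd (JetModel n (2 * k - 1)) ℝ) (CovModel n k)) _
  infer_instance

end UnifiedTopology

/-! ### Vector fields given by their components in a trivialization -/

section TrivializedSection

variable {E H M : Type*} [NormedAddCommGroup E] [NormedSpace ℝ E] [TopologicalSpace H]
  {I : ModelWithCorners ℝ E H} [TopologicalSpace M] [ChartedSpace H M] [IsManifold I ∞ M]

theorem contMDiffOn_trivializationAt_symm (x₀ : M) {U : Set M} {Z : M → E}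
    (hU : U ⊆ (trivializationAt E (TangentSpace I (M := M)) x₀).baseSet)
    (hZ : ContMDiffOn I 𝓘(ℝ, E) ∞ Z U) :
    ContMDiffOn I I.tangent ∞ (fun x => (⟨x, (trivializationAt E (TangentSpace I (M := M)) x₀).symm
      x (Z x)⟩ : TangentBundle I M)) U := by
  set τ := trivializationAt E (TangentSpace I (M := M)) x₀
  have h1 : ContMDiffOn (I.prod 𝓘(ℝ, E)) I.tangent ∞ τ.toOpenPartialHomeomorph.symm τ.target :=
    τ.contMDiffOn_symm
  have h2 : ContMDiffOn I (I.prod 𝓘(ℝ, E)) ∞ (fun x => (x, Z x)) U := contMDiffOn_id.prodMk hZ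
  exact (h1.comp h2 fun x hx => τ.mem_target.2 (hU hx)).congr fun x hx => τ.mk_symm (hU hx) _

theorem trivializationAt_symm_tmap_extChartAt (x₀ : M) {x : M}
    (hx : x ∈ (chartAt H x₀).source) (v : E) :
    ((trivializationAt E (TangentSpace I (M := M)) x₀).symm x
      (tmap I 𝓘(ℝ, E) (extChartAt I x₀) x v) : E) = v := by
  set τ := trivializationAt E (TangentSpace I (M := M)) x₀
  have hb : x ∈ τ.baseSet := by rwa [TangentBundle.trivializationAt_baseSet]
  have h4 := TangentBundle.continuousLinearMapAt_trivializationAt (I := I) hx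
  have h5 := τ.symmL_continuousLinearMapAt (R := ℝ) hb v
  have h6 : ∀ y : E, (τ.symmL ℝ x y : E) = τ.symm x y := fun y => τ.symmL_apply hb y
  exact (congrArg (fun l : E →L[ℝ] E => (τ.symm x (l v) : E)) h4.symm).trans
    ((h6 _).symm.trans h5)

end TrivializedSection

/-! ### Lifting Lagrangian vector fields to the unified bundle -/

section LagrangianToUnified

variable {n k r : ℕ} {Q : Type*} [TopologicalSpace Q] [ChartedSpace (Model n) Q]
  [IsManifold 𝓘(ℝ, Model n) ∞ Q] {e : OpenPartialHomeomorph Q (Model n)}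
  {L : ExtJet n k Q → ℝ} (hL : ContMDiff (extModel n k) 𝓘(ℝ, ℝ) ∞ L)

theorem exists_curve (p : ExtJet n r Q) (v : ExtModel n r) : ∃ γ : ℝ → ExtJet n r Q,
    (∀ᶠ t in 𝓝 (0 : ℝ), ContMDiffAt 𝓘(ℝ, ℝ) (extModel n r) ∞ γ t) ∧ γ 0 = p ∧
      tmap 𝓘(ℝ, ℝ) (extModel n r) γ 0 1 = v := by
  set e := chartAt (Model n) p.1.base with hedef
  have he : e ∈ atlas (Model n) Q := chart_mem_atlas _ _
  have hp : p.1.base ∈ e.source := mem_chart_source _ _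
  set x := extCoord e p
  have hx : x ∈ jetDomain n r e.target := extCoord_mem_jetDomain he hp
  have hO := isOpen_jetDomain (n := n) (N := r) e.open_target
  have hl : ContDiff ℝ ∞ (fun t : ℝ => x + t • v) :=
    contDiff_const.add (contDiff_id.smul contDiff_const)
  have hmem : ∀ᶠ t in 𝓝 (0 : ℝ), x + t • v ∈ jetDomain n r e.target :=
    hl.continuous.continuousAt.preimage_mem_nhds (hO.mem_nhds (by simpa using hx))
  have hγ : ∀ᶠ t in 𝓝 (0 : ℝ), ContMDiffAt 𝓘(ℝ, ℝ) (extModel n r) ∞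
      (fun t : ℝ => extOfCoord (Q := Q) e (x + t • v)) t := by
    filter_upwards [hmem] with t ht
    exact ContMDiffAt.comp (g := extOfCoord (Q := Q) e) t
      ((contMDiffOn_extOfCoord he).contMDiffAt (hO.mem_nhds ht)) hl.contMDiff.contMDiffAt
  have h0 : extOfCoord e (x + (0 : ℝ) • v) = p := by
    rw [zero_smul, add_zero]
    exact extOfCoord_extCoord he hp
  refine ⟨_, hγ, h0, ?_⟩
  have hc : MDifferentiableAt (extModel n r) 𝓘(ℝ, ExtModel n r) (extCoord e)
      (extOfCoord (Q := Q) e (x + (0 : ℝ) • v)) := by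
    rw [h0]
    exact (contMDiffAt_extCoord he hp).mdifferentiableAt (by simp)
  have h1 := tmap_comp (f := fun t : ℝ => extOfCoord (Q := Q) e (x + t • v)) (x := (0 : ℝ)) hc
    (hγ.self_of_nhds.mdifferentiableAt (by simp)) 1
  have h2 : tmap 𝓘(ℝ, ℝ) 𝓘(ℝ, ExtModel n r)
      (extCoord e ∘ fun t : ℝ => extOfCoord (Q := Q) e (x + t • v)) 0 =
      tmap 𝓘(ℝ, ℝ) 𝓘(ℝ, ExtModel n r) (fun t : ℝ => x + t • v) 0 := tmap_congr <| by
    filter_upwards [hmem] with t ht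
    exact extCoord_extOfCoord he ht
  have h3 : HasDerivAt (fun t : ℝ => x + t • v) v 0 := by
    simpa using ((hasDerivAt_id (0 : ℝ)).smul_const v).const_add x
  rw [h2, tmap_eq_fderiv, fderiv_apply_one_eq_deriv, h3.deriv, h0] at h1
  exact (h1.trans (extDeriv_self p _)).symm

theorem contMDiffOn_extCoord_field_lift (he : e ∈ atlas (Model n) Q)
    {XL : (p : ExtJet n (2 * k - 1) Q) → TangentSpace (extModel n (2 * k - 1)) p}
    (hXL : IsSmoothVectorField (extModel n (2 * k - 1)) XL) :
    ContMDiffOn (uniModel n k) 𝓘(ℝ, UniModel n k) ∞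
      (fun w : Unified n k Q =>
        ((extDeriv e w.proj (XL w.proj),
          fderiv ℝ (legendreCovec he hL) (extCoord e w.proj) (extDeriv e w.proj (XL w.proj))) :
            UniModel n k)) {w | w.proj.1.base ∈ e.source} := by
  intro w hw
  let z : ExtModel n (2 * k - 1) → UniModel n k := fun a =>
    (extDeriv e (extOfCoord e a) (XL (extOfCoord e a)),
      fderiv ℝ (legendreCovec he hL) a (extDeriv e (extOfCoord e a) (XL (extOfCoord e a))))
  have hx : extCoord e w.proj ∈ jetDomain n (2 * k - 1) e.target := extCoord_mem_jetDomain he hw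
  have hz : ContDiffAt ℝ ∞ z (extCoord e w.proj) := by
    have h1 := (contDiffOn_extDeriv_field he hXL).contDiffAt
      ((isOpen_jetDomain e.open_target).mem_nhds hx)
    exact h1.prodMk
      (((contDiffAt_legendreCovec he hL hx).fderiv_right (m := ∞) (by simp)).clm_apply h1)
  have h1 : ContMDiffAt (extModel n (2 * k - 1)) 𝓘(ℝ, UniModel n k) ∞
      (fun p => z (extCoord e p)) w.proj :=
    ContMDiffAt.comp w.proj hz.contMDiffAt (contMDiffAt_extCoord he hw)
  have h2 : ContMDiffAt (extModel n (2 * k - 1)) 𝓘(ℝ, UniModel n k) ∞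
      (fun p => ((extDeriv e p (XL p),
          fderiv ℝ (legendreCovec he hL) (extCoord e p) (extDeriv e p (XL p))) :
            UniModel n k)) w.proj := by
    refine h1.congr_of_eventuallyEq ?_
    filter_upwards [(isOpen_extDomain he).mem_nhds hw] with p hp
    have h3 : extOfCoord e (extCoord e p) = p := extOfCoord_extCoord he hp
    simp only [z]
    rw [h3]
  exact (ContMDiffAt.comp w h2 contMDiff_proj_uni.contMDiffAt).contMDiffWithinAt

/-- In coordinates around `w₀`, take the components `(X, dp(X))` at every point, independently of
the covector. On the graph they are the components of `Ts(X_L)`; away from it any smooth extension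
is acceptable. -/
theorem exists_lift_local (hk : 1 ≤ k)
    {XL : (p : ExtJet n (2 * k - 1) Q) → TangentSpace (extModel n (2 * k - 1)) p}
    (hXL : IsSmoothVectorField (extModel n (2 * k - 1)) XL) (w₀ : Unified n k Q) :
    ∃ U ∈ 𝓝 w₀, ∃ X : (w : Unified n k Q) → TangentSpace (uniModel n k) w,
      ContMDiffOn (uniModel n k) (uniModel n k).tangent ∞
        (fun w => (⟨w, X w⟩ : TangentBundle (uniModel n k) (Unified n k Q))) U ∧
      ∀ w ∈ U, w ∈ legendreGraph L → (X w : UniModel n k) =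
        tmap (extModel n (2 * k - 1)) (uniModel n k) (legendreSection hL) w.proj (XL w.proj) := by
  have he : chartAt (Model n) w₀.proj.1.base ∈ atlas (Model n) Q := chart_mem_atlas _ _
  have hU : IsOpen {w : Unified n k Q |
      w.proj.1.base ∈ (chartAt (Model n) w₀.proj.1.base).source} :=
    (isOpen_extDomain he).preimage contMDiff_proj_uni.continuous
  refine ⟨_, hU.mem_nhds (mem_chart_source _ _), _,
    contMDiffOn_trivializationAt_symm w₀
      (fun w hw => by
        rw [TangentBundle.trivializationAt_baseSet]
        exact mem_chart_source_uni hw)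
      (contMDiffOn_extCoord_field_lift hL he hXL), ?_⟩
  intro w hw hgr
  obtain ⟨p, rfl⟩ : ∃ p, w = legendreSection hL p := ⟨_, eq_legendreSection hL hk hgr⟩
  have hs := (contMDiff_legendreSection (Q := Q) hL hk).mdifferentiableAt (x := p) (by simp)
  have hu : MDifferentiableAt (uniModel n k) 𝓘(ℝ, UniModel n k) (uniCoord w₀.proj)
      (legendreSection hL p) := mdifferentiableAt_uniCoord hw
  have h1 := tmap_comp hu hs (XL p)
  have h2 := (tmap_uniCoord_legendreSection he hL hk rfl (p := p) hw (XL p)).symm.trans h1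
  rw [← extChartAt_uni w₀] at h2
  exact (congrArg (fun v : UniModel n k => ((trivializationAt (UniModel n k)
    (TangentSpace (uniModel n k) (M := Unified n k Q)) w₀).symm (legendreSection hL p) v :
      UniModel n k)) h2).trans
    (trivializationAt_symm_tmap_extChartAt (I := uniModel n k) w₀ (mem_chart_source_uni hw)
      (tmap (extModel n (2 * k - 1)) (uniModel n k) (legendreSection hL) p (XL p)))

/-- The condition at each point is convex: a single vector on the graph and no restriction
elsewhere. Local solutions are therefore glued by a partition of unity, which preserves the
prescribed values on the graph. -/
theorem exists_lift [T2Space Q] [SecondCountableTopology Q] (hk : 1 ≤ k)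
    {XL : (p : ExtJet n (2 * k - 1) Q) → TangentSpace (extModel n (2 * k - 1)) p}
    (hXL : IsSmoothVectorField (extModel n (2 * k - 1)) XL) :
    ∃ XH : (w : Unified n k Q) → TangentSpace (uniModel n k) w,
      IsSmoothVectorField (uniModel n k) XH ∧
      ∀ w ∈ legendreGraph L, (XH w : UniModel n k) =
        tmap (extModel n (2 * k - 1)) (uniModel n k) (legendreSection hL) w.proj (XL w.proj) := by
  have := Unified.t2Space (n := n) (k := k) (Q := Q)
  have := Unified.sigmaCompactSpace (n := n) (k := k) (Q := Q)
  obtain ⟨X, hX⟩ := exists_contMDiffSection_forall_mem_convex_of_local (n := ⊤)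
    (F_fiber := UniModel n k)
    (uniModel n k) (TangentSpace (uniModel n k) (M := Unified n k Q))
    (fun w => {v | w ∈ legendreGraph L → (v : UniModel n k) =
      tmap (extModel n (2 * k - 1)) (uniModel n k) (legendreSection hL) w.proj (XL w.proj)})
    (fun w => by
      by_cases hw : w ∈ legendreGraph L
      · simp only [hw, true_imp_iff]
        exact convex_singleton (𝕜 := ℝ) (E := UniModel n k) _
      · simp only [hw, false_imp_iff]
        exact convex_univ)
    (fun w₀ => by
      obtain ⟨U, hU, X, h1, h2⟩ := exists_lift_local hL hk hXL w₀
      exact ⟨U, hU, X, h1, h2⟩)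
  exact ⟨X, X.contMDiff, hX⟩

/-- Compose the given curve in `ϱ₁(𝒲_f)` with the section. It stays in `𝒲_f`, because `𝒲_f ⊆ 𝒲₁`
consists of values of the section. -/
theorem isTangentTo_lift (hk : 1 ≤ k)
    {XL : (p : ExtJet n (2 * k - 1) Q) → TangentSpace (extModel n (2 * k - 1)) p}
    {XH : (w : Unified n k Q) → TangentSpace (uniModel n k) w}
    (hXH : ∀ w ∈ legendreGraph L, (XH w : UniModel n k) =
        tmap (extModel n (2 * k - 1)) (uniModel n k) (legendreSection hL) w.proj (XL w.proj))
    {Wf : Set (Unified n k Q)} (hWf : Wf ⊆ legendreGraph L) (h : IsTangentTo XL (rho1 '' Wf)) :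
    IsTangentTo XH Wf := by
  rw [isTangentTo_iff] at h ⊢
  intro w hw
  obtain ⟨γ, hγ, h0, hv⟩ := h _ (mem_image_of_mem rho1 hw)
  have hs := contMDiff_legendreSection (Q := Q) hL hk
  refine ⟨legendreSection hL ∘ γ, ?_, ?_, ?_⟩
  · filter_upwards [hγ] with t ht
    refine ⟨hs.contMDiffAt.comp t ht.1, ?_⟩
    obtain ⟨w', hw', hw''⟩ := ht.2
    rw [Function.comp_apply, ← hw'']
    exact eq_legendreSection hL hk (hWf hw') ▸ hw'
  · rw [Function.comp_apply, h0]
    exact (eq_legendreSection hL hk (hWf hw)).symm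
  · have h1 := tmap_comp (f := γ) (x := (0 : ℝ)) (g := legendreSection hL)
      (I'' := uniModel n k) (hs.mdifferentiableAt (by simp))
      (hγ.self_of_nhds.1.mdifferentiableAt (by simp)) 1
    rw [hv, h0] at h1
    exact h1.trans (hXH w (hWf hw)).symm

theorem rho1_image_legendreGraph (hk : 1 ≤ k) (hL : ContMDiff (extModel n k) 𝓘(ℝ, ℝ) ∞ L) :
    rho1 '' legendreGraph L = (univ : Set (ExtJet n (2 * k - 1) Q)) :=
  eq_univ_of_forall fun p => ⟨legendreSection hL p, legendreSection_mem hL hk p, rfl⟩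

theorem isTangentTo_univ
    (XL : (p : ExtJet n r Q) → TangentSpace (extModel n r) p) : IsTangentTo XL univ := by
  rw [isTangentTo_iff]
  intro p _
  obtain ⟨γ, h1, h2, h3⟩ := exists_curve p (XL p)
  exact ⟨γ, h1.mono fun t ht => ⟨ht, mem_univ _⟩, h2, h3⟩

end LagrangianToUnified

end HigherOrderContact

/-! ### Assembly of the theorem -/

theorem mainTheorem5 {n k : ℕ} (hk : 1 ≤ k) {Q : Type*} [TopologicalSpace Q] [T2Space Q]
    [SecondCountableTopology Q] [ChartedSpace (Model n) Q]
    [IsManifold 𝓘(ℝ, Model n) ∞ Q]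
    (L : ExtJet n k Q → ℝ)
    (hL : ContMDiff (extModel n k) 𝓘(ℝ, ℝ) ∞ L)
    (R : (w : Unified n k Q) →
      TangentSpace (uniModel n k) w)
    (hR : IsReeb unifiedForm R)
    (Wf : Set (Unified n k Q))
    (hWf : Wf ⊆ legendreGraph L) :
    (∀ p : ExtJet n (2 * k - 1) Q,
      ∃! w : Unified n k Q,
        w ∈ legendreGraph L ∧ rho1 w = p) ∧
    (∀ w ∈ legendreGraph L,
      hamiltonian hk L w =
        energy hk L (rho1 w)) ∧
    (∀ XH : (w : Unified n k Q) →
        TangentSpace (uniModel n k) w,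
      IsSmoothVectorField (uniModel n k) XH →
      SolvesContactEq unifiedForm
        (hamiltonian hk L)
        (fun w => dfun (uniModel n k)
          (hamiltonian hk L) w (R w)) XH Wf →
      IsTangentTo XH Wf →
      (k = 1 ∨ IsRegularLagrangian L ∨
        ∀ w ∈ Wf, IsHolonomicVector (rho1 w)
          (mfderiv (uniModel n k) (extModel n (2 * k - 1))
            rho1 w (XH w))) →
      ∃ XL : (p : ExtJet n (2 * k - 1) Q) →
          TangentSpace (extModel n (2 * k - 1)) p,
        IsSmoothVectorField (extModel n (2 * k - 1)) XL ∧
        (∀ w ∈ legendreGraph L,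
          XL (rho1 w) =
            mfderiv (uniModel n k) (extModel n (2 * k - 1))
              rho1 w (XH w)) ∧
        (∀ p ∈ rho1 '' Wf, IsHolonomicVector p (XL p)) ∧
        (∀ (γ : ℝ → ExtJet n (2 * k - 1) Q) (s : Set ℝ), IsOpen s →
          IsMIntegralCurveOn γ XL s → (∀ t ∈ s, γ t ∈ rho1 '' Wf) →
          IsHolonomicCurveOn γ s) ∧
        IsTangentTo XL (rho1 '' Wf) ∧
        ∀ ρ, IsReebRate hk L ρ →
          SolvesContactEq (contactForm L)
            (energy hk L) ρ XL (rho1 '' Wf)) ∧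
    (∀ (XL : (p : ExtJet n (2 * k - 1) Q) →
        TangentSpace (extModel n (2 * k - 1)) p)
      (ρ : ExtJet n (2 * k - 1) Q → ℝ),
      IsSmoothVectorField (extModel n (2 * k - 1)) XL →
      IsReebRate hk L ρ →
      SolvesContactEq (contactForm L)
        (energy hk L) ρ XL (rho1 '' Wf) →
      (∀ p ∈ rho1 '' Wf, IsHolonomicVector p (XL p)) →
      ∃ XH : (w : Unified n k Q) →
          TangentSpace (uniModel n k) w,
        IsSmoothVectorField (uniModel n k) XH ∧
        SolvesContactEq unifiedForm
          (hamiltonian hk L)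
          (fun w => dfun (uniModel n k)
            (hamiltonian hk L) w (R w)) XH Wf ∧
        IsTangentTo XH (legendreGraph L) ∧
        (IsTangentTo XL (rho1 '' Wf) →
          IsTangentTo XH Wf) ∧
        ∀ w ∈ legendreGraph L,
          XL (rho1 w) =
            mfderiv (uniModel n k) (extModel n (2 * k - 1))
              rho1 w (XH w)) := by
  refine ⟨fun p => ⟨legendreSection hL p, ⟨legendreSection_mem hL hk p, rfl⟩, ?_⟩,
    fun w hw => hamiltonian_eq_energy hL hk hw, fun XH hXH hsol htan hcase => ?_,
    fun XL ρ hXL hρ hsol hhol => ?_⟩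
  · rintro w ⟨hw, rfl⟩
    exact eq_legendreSection hL hk hw
  -- Tangency and the unified equations give all the conditions on the projected field except
  -- holonomy in the higher components.
  · have hlag : ∀ w (hw : w ∈ Wf), IsLagrangianVector
        (chart_mem_atlas (Model n) w.proj.1.base) hL w.proj (projectedField hL XH w.proj) :=
      fun w hw => (projectedField_eq hk XH (hWf hw)).symm ▸
        isLagrangianVector_proj hk hWf hR hsol htan hw rfl
    have hhol : ∀ p ∈ rho1 '' Wf, IsHolonomicVector p (projectedField hL XH p) := by
      rintro _ ⟨w, hw, rfl⟩
      rcases hcase with h | h | h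
      · exact (hlag w hw).isHolonomicVector hk rfl (Or.inl h)
      · exact (hlag w hw).isHolonomicVector hk rfl (Or.inr h)
      · rw [projectedField_rho1 hk XH (hWf hw)]
        exact h w hw
    have hsm := isSmoothVectorField_projectedField (hL := hL) hk hXH
    refine ⟨projectedField hL XH, hsm, fun w hw => projectedField_rho1 hk XH hw, hhol,
      fun γ s hs hγ hmem => isHolonomicCurveOn_of_isMIntegralCurveOn hsm hs hγ
        fun t ht => hhol _ (hmem t ht), isTangentTo_projectedField hk hWf htan, fun ρ hρ => ?_⟩
    rintro _ ⟨w, hw, rfl⟩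
    exact (hlag w hw).solves hk rfl hρ
  · obtain ⟨XH, hXH, hval⟩ := exists_lift hL hk hXL
    have hval' : ∀ w ∈ legendreGraph L, (XH w : UniModel n k) = ((XL w.proj : ExtModel n (2 * k - 1)),
        fderiv ℝ (legendreCovec (chart_mem_atlas (Model n) w.proj.1.base) hL)
          (extCoord (chartAt (Model n) w.proj.1.base) w.proj) (XL w.proj)) := fun w hw =>
      (hval w hw).trans (tmap_legendreSection _ hL hk rfl (XL w.proj))
    have hfst : ∀ w ∈ legendreGraph L, (XH w : UniModel n k).1 = XL w.proj := fun w hw =>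
      congrArg Prod.fst (hval' w hw)
    refine ⟨XH, hXH, fun w hw => ?_, ?_, isTangentTo_lift hL hk hval hWf, fun w hw => ?_⟩
    -- The projection of the lift is `X_L`, and the lift is tangent to the graph at the point, so
    -- the pointwise equivalence can be read backwards.
    · have hlag : IsLagrangianVector (chart_mem_atlas (Model n) w.proj.1.base) hL w.proj
          (XH w : UniModel n k).1 := (hfst w (hWf hw)).symm ▸
        isLagrangianVector_of_solves hk rfl (hhol _ (mem_image_of_mem rho1 hw))
          (hsol _ (mem_image_of_mem rho1 hw)).1 (hsol _ (mem_image_of_mem rho1 hw)).2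
      refine (isLagrangianVector_iff_unified hk (hWf hw) rfl hR ?_).2 hlag
      rw [hval' w (hWf hw)]
    -- The graph projects onto the whole space, to which every vector field is tangent, so here
    -- tangency of `X_L` needs no hypothesis.
    · refine isTangentTo_lift hL hk hval subset_rfl ?_
      rw [rho1_image_legendreGraph hk hL]
      exact isTangentTo_univ XL
    · exact ((tmap_rho1 w (XH w)).trans (hfst w hw)).symm
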